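/- Let $\gamma>1$. Consider the reduced system of one-dimensional cylindrically symmetric MHD flows with $H^r\equiv 0$ in mass Lagrangian coordinates $(t,s)$, for the unknowns $r,\theta,u,v,\rho,p,E^\theta,E^z,H^\theta,H^z$ with $r,\rho,p>0$: $$\rho_t=-\rho^2(ru)_s,\qquad u_t-\frac{v^2}{r}=-rp_s-\frac1{2r}\big(r^2(H^\theta)^2\big)_s-\frac r2\big((H^z)^2\big)_s,\qquad r_t=u,$$ $$v_t+\frac{uv}{r}=0,\qquad \theta_t=\frac vr,\qquad p_t=-\gamma\rho p(ru)_s+(\gamma-1)\sigma\big((E^\theta)^2+(E^z)^2\big),$$ $$H^\theta_t=r\rho(E^z_s-H^\theta u_s),\qquad H^z_t=-\rho\big((rE^\theta)_s+H^z(ru)_s\big),\qquad \sigma E^\theta=-r\rho H^z_s,\qquad \sigma E^z=\rho(rH^\theta)_s .$$ A conductivity is a smooth function $\sigma(\rho,p)$ of $\rho,p>0$ that does not vanish identically on any nonempty open set. Let $L_\sigma$ be the space of vector fields (generators of Lie point symmetries), with coefficients smooth in all independent and dependent variables on $\{r,\rho,p>0\}$, whose first prolongation annihilates every equation at all first-order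 jets satisfying the system. The kernel $L_0$ is the intersection of $L_\sigma$ over all conductivities. Put $$Y_3=t\partial_t+2s\partial_s-u\partial_u-v\partial_v+2\rho\partial_\rho-E^\theta\partial_{E^\theta}-E^z\partial_{E^z},$$ $$Y_4=-2s\partial_s+r\partial_r+u\partial_u+v\partial_v-4\rho\partial_\rho-2p\partial_p-H^\theta\partial_{H^\theta}-H^z\partial_{H^z},$$ $$Y_5=2s\partial_s+2\rho\partial_\rho+2p\partial_p+E^\theta\partial_{E^\theta}+E^z\partial_{E^z}+H^\theta\partial_{H^\theta}+H^z\partial_{H^z}.$$ 1. The kernel consists exactly of the fields $a_1\partial_t+a_2\partial_s+h(s,rv)\partial_\theta$ with $a_1,a_2\in\mathbb R$ and $h$ smooth. For every conductivity, every element of $L_\sigma$ is the sum of an element of $L_0$ and a linear combination of $Y_3,Y_4,Y_5$, and $\dim(L_\sigma/L_0)\le 2$. 2. (One additional generator; "dimension 4", the family $h(s,rv)\partial_\theta$ being counted once.) Consider the following list, with $F$ a smooth function on $(0,\infty)$ and real $\alpha,\beta$: (a) $X_4=Y_3$, $\sigma=\sqrt\rho\,F(p)$; (b) $X_4=Y_4+\alpha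 Y_3$, $\sigma=\sqrt\rho\,F\big(p\rho^{1/(\alpha-2)}\big)$ if $\alpha\ne2$, and $\sigma=F(\rho)$ if $\alpha=2$; (c) $X_4=Y_5+\alpha Y_4+\beta Y_3$, $\sigma=\rho^{\frac{2\alpha-\beta}{2(2\alpha-\beta-1)}}F\big(p\rho^{\frac{1-\alpha}{2\alpha-\beta-1}}\big)$ if $\beta\ne2\alpha-1$, and $\sigma=F(\rho)\,p^{\frac1{2(\alpha-1)}}$ if $\beta=2\alpha-1$, $\alpha\ne1$. If a conductivity has one of these forms then the corresponding $X_4$ lies in $L_\sigma\setminus L_0$; moreover $L_\sigma=L_0$ if and only if $\sigma$ has none of these forms. One has $\dim(L_\sigma/L_0)=1$ if and only if $\sigma$ has one of the forms (a)–(c) and none of the forms of item 3, and then $L_\sigma=L_0\oplus\mathbb R X_4$. Each of (a), (b) for every $\alpha$, and (c) for every $(\alpha,\beta)\neq(1,1)$ occurs for some conductivity with $\dim(L_\sigma/L_0)=1$. 3. (Two additional generators; "dimension 5".) One has $\dim(L_\sigma/L_0)=2$ if and only if $\sigma$ has one of the following forms with a constant $C$, and then $L_\sigma=L_0\oplus\mathbb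 RX_4\oplus\mathbb RX_5$: (a) $X_4=Y_3$, $X_5=Y_4$, $\sigma=C\sqrt\rho$; (b) $X_4=Y_3$, $X_5=Y_5+\alpha Y_4$, $\sigma=C\sqrt\rho\,p^{\frac1{2(\alpha-1)}}$, $\alpha\ne1$; (c) $X_4=Y_4+\alpha Y_3$, $X_5=Y_5+\beta Y_3$, $\sigma=C\rho^{\frac{\alpha+\beta-2}{2(\alpha+\beta-1)}}p^{\frac{2-\alpha}{2(\alpha+\beta-1)}}$, $\alpha+\beta\ne1$. All these cases, for all such parameters, are realized by conductivities. 4. A full three-parameter extension is impossible: if $\sigma$ is any smooth function of $\rho,p>0$ with $Y_3,Y_4,Y_5\in L_\sigma$, then $\sigma\equiv0$. -/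

import Mathlib

open Set
open scoped ContDiff

noncomputable section

namespace MHD

/-- The dependent variables of the reduced system. -/
inductive Dep
  | r | θ | u | v | ρ | p | Eθ | Ez | Hθ | Hz
  deriving DecidableEq

instance : Fintype Dep where
  elems := {.r, .θ, .u, .v, .ρ, .p, .Eθ, .Ez, .Hθ, .Hz}
  complete := fun x => by cases x <;> simp

/-- Points `(t, s, y)`: time, mass coordinate, values of the dependent variables. -/
abbrev Phase : Type := ℝ × ℝ × (Dep → ℝ)

/-- First-order jets `((t, s, y), y_t, y_s)`. -/
abbrev Jet : Type := Phase × (Dep → ℝ) × (Dep → ℝ)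

/-- The physical region `r > 0`, `ρ > 0`, `p > 0`. -/
def region : Set Phase := {x | 0 < x.2.2 .r ∧ 0 < x.2.2 .ρ ∧ 0 < x.2.2 .p}

/-- The range of `(ρ, p)`. -/
def quadrant : Set (ℝ × ℝ) := Ioi 0 ×ˢ Ioi 0

/-- The reduced system (`H^r = 0`), each equation in the form `left side - right side = 0`.
Products under an `s`-derivative are expanded by the Leibniz rule. -/
def residual (γ : ℝ) (σ : ℝ → ℝ → ℝ) (j : Jet) : Fin 10 → ℝ :=
  let y := j.1.2.2
  let yt := j.2.1
  let ys := j.2.2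
  -- `(r u)_s`
  let ru_s := ys .r * y .u + y .r * ys .u
  -- `(r E^θ)_s`
  let rE_s := ys .r * y .Eθ + y .r * ys .Eθ
  -- `(r H^θ)_s`
  let rH_s := ys .r * y .Hθ + y .r * ys .Hθ
  -- `(r² (H^θ)²)_s`
  let rH2_s := 2 * (y .r * y .Hθ) * rH_s
  -- `((H^z)²)_s`
  let Hz2_s := 2 * y .Hz * ys .Hz
  let sig := σ (y .ρ) (y .p)
  ![yt .ρ - (-(y .ρ) ^ 2 * ru_s),
    (yt .u - y .v ^ 2 / y .r)
      - (-(y .r) * ys .p - 1 / (2 * y .r) * rH2_s - y .r / 2 * Hz2_s),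
    yt .r - y .u,
    yt .v + y .u * y .v / y .r,
    yt .θ - y .v / y .r,
    yt .p - (-γ * y .ρ * y .p * ru_s + (γ - 1) * sig * (y .Eθ ^ 2 + y .Ez ^ 2)),
    yt .Hθ - y .r * y .ρ * (ys .Ez - y .Hθ * ys .u),
    yt .Hz - (-(y .ρ) * (rE_s + y .Hz * ru_s)),
    sig * y .Eθ - (-(y .r) * y .ρ * ys .Hz),
    sig * y .Ez - y .ρ * rH_s]

/-- Total derivative in `t` of all components of the vector field `X`. -/
def totalT (X : Phase → Phase) (j : Jet) : Phase := fderiv ℝ X j.1 (1, 0, j.2.1)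

/-- Total derivative in `s` of all components of the vector field `X`. -/
def totalS (X : Phase → Phase) (j : Jet) : Phase := fderiv ℝ X j.1 (0, 1, j.2.2)

/-- First prolongation of `X = ξ^t ∂_t + ξ^s ∂_s + ∑ η^i ∂_{y^i}`: the coefficients at
`∂_{y^i_t}` and `∂_{y^i_s}` are `D_t η^i - y^i_t D_t ξ^t - y^i_s D_t ξ^s` and
`D_s η^i - y^i_t D_s ξ^t - y^i_s D_s ξ^s`. -/
def prolong (X : Phase → Phase) (j : Jet) : Jet :=
  (X j.1,
    fun i => (totalT X j).2.2 i - j.2.1 i * (totalT X j).1 - j.2.2 i * (totalT X j).2.1,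
    fun i => (totalS X j).2.2 i - j.2.1 i * (totalS X j).1 - j.2.2 i * (totalS X j).2.1)

/-- The vector field `X`, smooth on the physical region, satisfies the infinitesimal criterion
of invariance: its first prolongation annihilates every equation on the solution manifold. -/
def Admitted (γ : ℝ) (σ : ℝ → ℝ → ℝ) (X : Phase → Phase) : Prop :=
  ContDiffOn ℝ ∞ X region ∧
    ∀ j : Jet, j.1 ∈ region → (∀ k, residual γ σ j k = 0) →
      ∀ k, fderiv ℝ (fun j' => residual γ σ j' k) j (prolong X j) = 0

theorem isOpen_region : IsOpen region := by
  have h : ∀ i : Dep, Continuous fun x : Phase => x.2.2 i := fun i => by fun_prop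
  exact (isOpen_lt continuous_const (h .r)).inter
    ((isOpen_lt continuous_const (h .ρ)).inter (isOpen_lt continuous_const (h .p)))

theorem differentiableAt_of_smooth {X : Phase → Phase} (hX : ContDiffOn ℝ ∞ X region)
    {x : Phase} (hx : x ∈ region) : DifferentiableAt ℝ X x :=
  (hX.contDiffAt (isOpen_region.mem_nhds hx)).differentiableAt (by simp)

theorem prolong_add {X Y : Phase → Phase} (hX : ContDiffOn ℝ ∞ X region)
    (hY : ContDiffOn ℝ ∞ Y region) {j : Jet} (hj : j.1 ∈ region) :
    prolong (X + Y) j = prolong X j + prolong Y j := by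
  have h := fderiv_add (differentiableAt_of_smooth hX hj) (differentiableAt_of_smooth hY hj)
  refine Prod.ext rfl (Prod.ext ?_ ?_) <;> funext i <;>
    simp [prolong, totalT, totalS, h] <;> ring

theorem prolong_smul (c : ℝ) {X : Phase → Phase} (hX : ContDiffOn ℝ ∞ X region)
    {j : Jet} (hj : j.1 ∈ region) : prolong (c • X) j = c • prolong X j := by
  have h := fderiv_const_smul (differentiableAt_of_smooth hX hj) c
  refine Prod.ext rfl (Prod.ext ?_ ?_) <;> funext i <;>
    simp [prolong, totalT, totalS, h] <;> ring

theorem prolong_zero (j : Jet) : prolong 0 j = 0 := by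
  refine Prod.ext rfl (Prod.ext ?_ ?_) <;> funext i <;> simp [prolong, totalT, totalS]

/-- The algebra of admitted generators for the conductivity `σ`. Generators are functions on the
whole space, but only their restriction to the physical region matters. -/
def symmetries (γ : ℝ) (σ : ℝ → ℝ → ℝ) : Submodule ℝ (Phase → Phase) where
  carrier := {X | Admitted γ σ X}
  zero_mem' := ⟨contDiffOn_const, fun j _ _ k => by rw [prolong_zero, map_zero]⟩
  add_mem' := fun {X Y} hX hY => ⟨hX.1.add hY.1, fun j hj h0 k => by
    rw [prolong_add hX.1 hY.1 hj, map_add, hX.2 j hj h0 k, hY.2 j hj h0 k, add_zero]⟩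
  smul_mem' := fun c X hX => ⟨hX.1.const_smul c, fun j hj h0 k => by
    rw [prolong_smul c hX.1 hj, map_smul, hX.2 j hj h0 k, smul_zero]⟩

/-- Smoothness of a function of `(ρ, p)` for positive `ρ` and `p`. -/
def SmoothOnQuadrant (σ : ℝ → ℝ → ℝ) : Prop :=
  ContDiffOn ℝ ∞ (fun q : ℝ × ℝ => σ q.1 q.2) quadrant

/-- Finite electric conductivity: a smooth function of positive `ρ` and `p` that does not vanish
identically on any nonempty open set. -/
def IsConductivity (σ : ℝ → ℝ → ℝ) : Prop :=
  SmoothOnQuadrant σ ∧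
    ∀ U : Set (ℝ × ℝ), IsOpen U → U ⊆ quadrant → U.Nonempty → ∃ q ∈ U, σ q.1 q.2 ≠ 0

/-- The kernel of the admitted Lie algebras: generators admitted for all conductivities. -/
def kernel (γ : ℝ) : Submodule ℝ (Phase → Phase) :=
  ⨅ (σ : ℝ → ℝ → ℝ) (_ : IsConductivity σ), symmetries γ σ

/-- The dimension of the extension of the kernel, `dim (L / kernel)`. -/
def extensionRank (γ : ℝ) (σ : ℝ → ℝ → ℝ) : Cardinal :=
  Module.rank ℝ (symmetries γ σ ⧸ (kernel γ).submoduleOf (symmetries γ σ))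

/-- `∂_t` -/
def Y1 : Phase → Phase := fun _ => (1, 0, 0)

/-- `∂_s` -/
def Y2 : Phase → Phase := fun _ => (0, 1, 0)

/-- `t ∂_t + 2 s ∂_s - u ∂_u - v ∂_v + 2 ρ ∂_ρ - E^θ ∂_{E^θ} - E^z ∂_{E^z}` -/
def Y3 : Phase → Phase := fun x =>
  (x.1, 2 * x.2.1, fun
    | .u => -x.2.2 .u
    | .v => -x.2.2 .v
    | .ρ => 2 * x.2.2 .ρ
    | .Eθ => -x.2.2 .Eθ
    | .Ez => -x.2.2 .Ez
    | _ => 0)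

/-- `-2 s ∂_s + r ∂_r + u ∂_u + v ∂_v - 4 ρ ∂_ρ - 2 p ∂_p - H^θ ∂_{H^θ} - H^z ∂_{H^z}` -/
def Y4 : Phase → Phase := fun x =>
  (0, -2 * x.2.1, fun
    | .r => x.2.2 .r
    | .u => x.2.2 .u
    | .v => x.2.2 .v
    | .ρ => -4 * x.2.2 .ρ
    | .p => -2 * x.2.2 .p
    | .Hθ => -x.2.2 .Hθ
    | .Hz => -x.2.2 .Hz
    | _ => 0)

/-- `2 s ∂_s + 2 ρ ∂_ρ + 2 p ∂_p + E^θ ∂_{E^θ} + E^z ∂_{E^z} + H^θ ∂_{H^θ} + H^z ∂_{H^z}` -/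
def Y5 : Phase → Phase := fun x =>
  (0, 2 * x.2.1, fun
    | .ρ => 2 * x.2.2 .ρ
    | .p => 2 * x.2.2 .p
    | .Eθ => x.2.2 .Eθ
    | .Ez => x.2.2 .Ez
    | .Hθ => x.2.2 .Hθ
    | .Hz => x.2.2 .Hz
    | _ => 0)

/-- `h(s, r v) ∂_θ` -/
def Yθ (h : ℝ → ℝ → ℝ) : Phase → Phase := fun x =>
  (0, 0, fun
    | .θ => h x.2.1 (x.2.2 .r * x.2.2 .v)
    | _ => 0)

/-- Rows with one additional generator: `Row4 σ X₄`. -/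
inductive Row4 (σ : ℝ → ℝ → ℝ) : (Phase → Phase) → Prop
  | y3 (F : ℝ → ℝ) (hF : ContDiffOn ℝ ∞ F (Ioi 0))
      (h : ∀ ρ p : ℝ, 0 < ρ → 0 < p → σ ρ p = √ρ * F p) :
      Row4 σ Y3
  | y4 (α : ℝ) (hα : α ≠ 2) (F : ℝ → ℝ) (hF : ContDiffOn ℝ ∞ F (Ioi 0))
      (h : ∀ ρ p : ℝ, 0 < ρ → 0 < p → σ ρ p = √ρ * F (p * ρ ^ (1 / (α - 2)))) :
      Row4 σ (Y4 + α • Y3)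
  | y4_singular (F : ℝ → ℝ) (hF : ContDiffOn ℝ ∞ F (Ioi 0))
      (h : ∀ ρ p : ℝ, 0 < ρ → 0 < p → σ ρ p = F ρ) :
      Row4 σ (Y4 + (2 : ℝ) • Y3)
  | y5 (α β : ℝ) (hαβ : 2 * α - β - 1 ≠ 0) (F : ℝ → ℝ) (hF : ContDiffOn ℝ ∞ F (Ioi 0))
      (h : ∀ ρ p : ℝ, 0 < ρ → 0 < p → σ ρ p =
        ρ ^ ((2 * α - β) / (2 * (2 * α - β - 1))) *
          F (p * ρ ^ ((1 - α) / (2 * α - β - 1)))) :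
      Row4 σ (Y5 + α • Y4 + β • Y3)
  | y5_singular (α : ℝ) (hα : α ≠ 1) (F : ℝ → ℝ) (hF : ContDiffOn ℝ ∞ F (Ioi 0))
      (h : ∀ ρ p : ℝ, 0 < ρ → 0 < p → σ ρ p = F ρ * p ^ (1 / (2 * (α - 1)))) :
      Row4 σ (Y5 + α • Y4 + (2 * α - 1) • Y3)

/-- Rows with two additional generators: `Row5 σ X₄ X₅`. -/
inductive Row5 (σ : ℝ → ℝ → ℝ) : (Phase → Phase) → (Phase → Phase) → Prop
  | y3_y4 (C : ℝ) (h : ∀ ρ p : ℝ, 0 < ρ → 0 < p → σ ρ p = C * √ρ) :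
      Row5 σ Y3 Y4
  | y3_y5 (α : ℝ) (hα : α ≠ 1) (C : ℝ)
      (h : ∀ ρ p : ℝ, 0 < ρ → 0 < p → σ ρ p = C * √ρ * p ^ (1 / (2 * (α - 1)))) :
      Row5 σ Y3 (Y5 + α • Y4)
  | y4_y5 (α β : ℝ) (hαβ : α + β ≠ 1) (C : ℝ)
      (h : ∀ ρ p : ℝ, 0 < ρ → 0 < p → σ ρ p =
        C * ρ ^ ((α + β - 2) / (2 * (α + β - 1))) * p ^ ((2 - α) / (2 * (α + β - 1)))) :
      Row5 σ (Y4 + α • Y3) (Y5 + β • Y3)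

end MHD

end

open MHD

noncomputable section

namespace MHD

/-! The proof has an analytic half, which shows that an admitted generator is a scaling up to the
kernel, and an algebraic half, which decides which scalings a given `σ` admits.

Analytic half. On the solution manifold the system fixes every `t`-derivative except those of the
electric field, and Ohm's law fixes `H^θ_s` and `H^z_s`. The ten other derivatives are free
(`solutionJet`), and the linearized equations are polynomials in them, so every coefficient
vanishes. The coefficients of products, with a few linear ones, make `ξ^t` a function of `t` and
`ξ^s` a function of `s` (`Admitted.projectable`); the remaining ones form `Determining`. Joule
heating then drives the integration: it enters `p_t` with the factor `σ |E|²`, while the nonelectric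
coefficients do not depend on `E`. Comparing powers of `E` and cancelling `σ`, which is nonzero on a
dense set, removes the dependence on `p`, and homogeneity relations follow until the coefficients at
`r`, `u`, `ρ`, `p` are scalings (`Admitted.exists_scaling`). Ohm's law makes `σ` a relative
invariant (`Scaling.sigma_eq`), and together with the energy and induction equations it makes the
electric and magnetic coefficients linear (`Scaling.electric`, `Scaling.magnetic`). A rotation of
`(H^θ, H^z)` is excluded because the two components enter with different powers of `r`. The
coefficient at `θ` is constant along trajectories, hence a function of `s` and of the conserved
angular momentum `r v`. All this is collected in `Admitted.normal_form`; the converse is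
`Invariant.admitted` with `admitted_Y1`, `admitted_Y2` and `admitted_Yθ`.

Algebraic half. A combination of `Y3`, `Y4`, `Y5` with parameters `a` is admitted exactly when `σ`
solves `wρ ρ σ_ρ + wp p σ_p = wσ σ`, that is, when `σ` is multiplied by an exponential along the
orbits (`invariant_iff`). So `L_σ / L_0` is isomorphic to the subspace `scalings σ` of `ℝ³`
(`scalingClass_bijective`). The vector `(1, 1, 1)` fixes `ρ` and `p` but gives `σ` the weight `-1`,
so no conductivity admits it and the dimension is at most 2. One nonzero vector, integrated along
its orbits, gives the rows of `Row4` (`exists_row4`). In dimension 2 the weights `(wρ, wp)` take all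
values, so `σ` is a monomial, and the monomials are exactly the rows of `Row5` (`exists_row5`,
`exists_row5_of_monomial`). Exponential profiles are not monomials and therefore realize every row
of `Row4` with dimension exactly 1; `expConductivity` admits no scaling at all and detects the
kernel. -/

/-! ### Partial derivatives on the phase space. -/

/-- The coordinate direction `∂_t`. -/
def eT : Phase := (1, 0, 0)

/-- The coordinate direction `∂_s`. -/
def eS : Phase := (0, 1, 0)

/-- The coordinate direction of the dependent variable `i`. -/
def eY (i : Dep) : Phase := (0, 0, Pi.single i 1)

/-- The derivative of a function of the phase variables in a fixed direction. -/
def pd (e : Phase) (f : Phase → ℝ) (x : Phase) : ℝ := fderiv ℝ f x e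

/-- Smoothness on the physical region. -/
abbrev Smooth (f : Phase → ℝ) : Prop := ContDiffOn ℝ ∞ f region

theorem sum_dep (f : Dep → ℝ) : ∑ i, f i = f .r + f .θ + f .u + f .v + f .ρ + f .p + f .Eθ
    + f .Ez + f .Hθ + f .Hz := by
  change ∑ i ∈ ({.r, .θ, .u, .v, .ρ, .p, .Eθ, .Ez, .Hθ, .Hz} : Finset Dep), f i = _
  rw [Finset.sum_insert (by decide), Finset.sum_insert (by decide), Finset.sum_insert (by decide),
    Finset.sum_insert (by decide), Finset.sum_insert (by decide), Finset.sum_insert (by decide),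
    Finset.sum_insert (by decide), Finset.sum_insert (by decide), Finset.sum_insert (by decide),
    Finset.sum_singleton]
  ring

theorem phase_decomp (c d : ℝ) (w : Dep → ℝ) :
    ((c, d, w) : Phase) = c • eT + d • eS + ∑ i, w i • eY i := by
  have h1 : (∑ i, w i • eY i) = ((0, 0, w) : Phase) := by
    refine Prod.ext ?_ (Prod.ext ?_ ?_)
    · simp [Prod.fst_sum, eY]
    · simp [Prod.fst_sum, Prod.snd_sum, eY]
    · simp only [Prod.snd_sum, Prod.smul_snd, eY]
      funext i
      simp [Finset.sum_apply, Pi.single_apply]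
  rw [h1]
  refine Prod.ext ?_ (Prod.ext ?_ ?_) <;> simp [eT, eS]

/-- The chain rule in coordinates. -/
theorem fderiv_apply_eq (f : Phase → ℝ) (x : Phase) (c d : ℝ) (w : Dep → ℝ) :
    fderiv ℝ f x (c, d, w) = c * pd eT f x + d * pd eS f x + w .r * pd (eY .r) f x
      + w .θ * pd (eY .θ) f x + w .u * pd (eY .u) f x + w .v * pd (eY .v) f x
      + w .ρ * pd (eY .ρ) f x + w .p * pd (eY .p) f x + w .Eθ * pd (eY .Eθ) f x
      + w .Ez * pd (eY .Ez) f x + w .Hθ * pd (eY .Hθ) f x + w .Hz * pd (eY .Hz) f x := by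
  rw [phase_decomp, map_add, map_add, map_smul, map_smul, map_sum, sum_dep]
  simp only [map_smul, smul_eq_mul, pd]
  ring

theorem Smooth.contDiffAt {f : Phase → ℝ} (hf : Smooth f) {x : Phase} (hx : x ∈ region) :
    ContDiffAt ℝ ∞ f x :=
  ContDiffOn.contDiffAt hf (isOpen_region.mem_nhds hx)

theorem Smooth.differentiableAt {f : Phase → ℝ} (hf : Smooth f) {x : Phase} (hx : x ∈ region) :
    DifferentiableAt ℝ f x :=
  (hf.contDiffAt hx).differentiableAt (by simp)

theorem Smooth.pd {f : Phase → ℝ} (hf : Smooth f) (e : Phase) : Smooth (pd e f) := by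
  have h : ContDiffOn ℝ ∞ (fderiv ℝ f) region :=
    ContDiffOn.fderiv_of_isOpen hf isOpen_region (by simp)
  exact h.clm_apply contDiffOn_const

theorem pd_congr {f g : Phase → ℝ} (h : ∀ x ∈ region, f x = g x) (e : Phase) {x : Phase}
    (hx : x ∈ region) : pd e f x = pd e g x := by
  have : f =ᶠ[nhds x] g := Filter.eventuallyEq_of_mem (isOpen_region.mem_nhds hx) h
  rw [pd, pd, this.fderiv_eq]

theorem pd_const (e : Phase) (c : ℝ) (x : Phase) : pd e (fun _ => c) x = 0 := by
  simp [pd]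

theorem pd_eq_zero_of_const {f : Phase → ℝ} {c : ℝ} (h : ∀ x ∈ region, f x = c) (e : Phase)
    {x : Phase} (hx : x ∈ region) : pd e f x = 0 := by
  rw [pd_congr h e hx, pd_const]

theorem pd_comm {f : Phase → ℝ} (hf : Smooth f) (e e' : Phase) {x : Phase} (hx : x ∈ region) :
    pd e (pd e' f) x = pd e' (pd e f) x := by
  have h2 : DifferentiableAt ℝ (fderiv ℝ f) x :=
    ((hf.contDiffAt hx).fderiv_right (m := ∞) (by simp)).differentiableAt (by simp)
  have h3 : IsSymmSndFDerivAt ℝ f x := (hf.contDiffAt hx).isSymmSndFDerivAt (by simpa using WithTop.coe_le_coe.2 (le_top : (2 : ℕ∞) ≤ ⊤))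
  have key : ∀ a b : Phase, pd a (pd b f) x = fderiv ℝ (fderiv ℝ f) x a b := by
    intro a b
    change fderiv ℝ (fun z => fderiv ℝ f z b) x a = _
    rw [fderiv_clm_apply h2 (differentiableAt_const b)]
    simp
  rw [key, key, h3]

/-- A derivative of `f` vanishes in `e` if the derivative of `f` in `e` vanishes. -/
theorem pd_pd_eq_zero {f : Phase → ℝ} (hf : Smooth f) {e : Phase}
    (h : ∀ x ∈ region, pd e f x = 0) (e' : Phase) {x : Phase} (hx : x ∈ region) :
    pd e (pd e' f) x = 0 := by
  rw [pd_comm hf e e' hx]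
  exact pd_eq_zero_of_const h e' hx

theorem smooth_coord (i : Dep) : Smooth (fun x : Phase => x.2.2 i) := by
  apply ContDiff.contDiffOn
  fun_prop

theorem region_r_pos {x : Phase} (hx : x ∈ region) : 0 < x.2.2 .r := hx.1
theorem region_ρ_pos {x : Phase} (hx : x ∈ region) : 0 < x.2.2 .ρ := hx.2.1
theorem region_p_pos {x : Phase} (hx : x ∈ region) : 0 < x.2.2 .p := hx.2.2

theorem isPreconnected_region : IsPreconnected region := by
  apply Convex.isPreconnected
  have h : ∀ i : Dep, Convex ℝ {x : Phase | 0 < x.2.2 i} := fun i =>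
    convex_halfSpace_gt (f := fun x : Phase => x.2.2 i)
      ⟨fun x y => by simp, fun c x => by simp⟩ 0
  exact (h .r).inter ((h .ρ).inter (h .p))

/-- The base point of the physical region. -/
def basePoint : Phase := (0, 0, fun _ => 1)

theorem basePoint_mem : basePoint ∈ region := by
  simp [basePoint, region]

/-- A function whose partial derivatives all vanish is constant on the region. -/
theorem const_of_pd_eq_zero {f : Phase → ℝ} (hf : Smooth f)
    (hT : ∀ x ∈ region, pd eT f x = 0) (hS : ∀ x ∈ region, pd eS f x = 0)
    (hY : ∀ i, ∀ x ∈ region, pd (eY i) f x = 0) {x : Phase} (hx : x ∈ region) :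
    f x = f basePoint := by
  refine isOpen_region.is_const_of_fderiv_eq_zero isPreconnected_region
    (fun z hz => (hf.differentiableAt hz).differentiableWithinAt) (fun z hz => ?_) hx basePoint_mem
  refine ContinuousLinearMap.ext fun e => ?_
  obtain ⟨c, d, w⟩ := e
  simp [fderiv_apply_eq, hY _ z hz, hS z hz, hT z hz]

/-! ### The linearized system and the solution manifold. -/

/-- Partial derivatives of a conductivity. -/
def sρ (σ : ℝ → ℝ → ℝ) (ρ p : ℝ) : ℝ := fderiv ℝ (fun q : ℝ × ℝ => σ q.1 q.2) (ρ, p) (1, 0)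
def sp (σ : ℝ → ℝ → ℝ) (ρ p : ℝ) : ℝ := fderiv ℝ (fun q : ℝ × ℝ => σ q.1 q.2) (ρ, p) (0, 1)

theorem isOpen_quadrant : IsOpen quadrant := isOpen_Ioi.prod isOpen_Ioi

theorem SmoothOnQuadrant.differentiableAt {σ : ℝ → ℝ → ℝ} (hσ : SmoothOnQuadrant σ) {ρ p : ℝ}
    (hρ : 0 < ρ) (hp : 0 < p) : DifferentiableAt ℝ (fun q : ℝ × ℝ => σ q.1 q.2) (ρ, p) :=
  (ContDiffOn.contDiffAt hσ (isOpen_quadrant.mem_nhds (show (ρ, p) ∈ quadrant from ⟨hρ, hp⟩))).differentiableAt (by simp)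

/-- Differentiation of a conductivity along a curve. -/
theorem SmoothOnQuadrant.hasDerivAt_comp {σ : ℝ → ℝ → ℝ} (hσ : SmoothOnQuadrant σ) {a b : ℝ → ℝ}
    {a' b' ε : ℝ} (ha : HasDerivAt a a' ε) (hb : HasDerivAt b b' ε) (ha0 : 0 < a ε)
    (hb0 : 0 < b ε) : HasDerivAt (fun ε => σ (a ε) (b ε))
      (sρ σ (a ε) (b ε) * a' + sp σ (a ε) (b ε) * b') ε := by
  have h := (hσ.differentiableAt ha0 hb0).hasFDerivAt.comp_hasDerivAt ε (ha.prodMk hb)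
  refine h.congr_deriv ?_
  have : ((a', b') : ℝ × ℝ) = a' • (1, 0) + b' • (0, 1) := by simp
  rw [this, map_add, map_smul, map_smul]
  simp only [smul_eq_mul, sρ, sp]
  ring

/-- The linearization of the system, in the direction `δ`. -/
def linearized (γ : ℝ) (σ : ℝ → ℝ → ℝ) (j δ : Jet) : Fin 10 → ℝ :=
  let y := j.1.2.2
  let ys := j.2.2
  let d := δ.1.2.2
  let dt := δ.2.1
  let ds := δ.2.2
  let ru_s := ys .r * y .u + y .r * ys .u
  let dru_s := ds .r * y .u + ys .r * d .u + d .r * ys .u + y .r * ds .u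
  let rE_s := ys .r * y .Eθ + y .r * ys .Eθ
  let drE_s := ds .r * y .Eθ + ys .r * d .Eθ + d .r * ys .Eθ + y .r * ds .Eθ
  let rH_s := ys .r * y .Hθ + y .r * ys .Hθ
  let drH_s := ds .r * y .Hθ + ys .r * d .Hθ + d .r * ys .Hθ + y .r * ds .Hθ
  let sig := σ (y .ρ) (y .p)
  let dsig := sρ σ (y .ρ) (y .p) * d .ρ + sp σ (y .ρ) (y .p) * d .p
  ![dt .ρ + 2 * y .ρ * d .ρ * ru_s + y .ρ ^ 2 * dru_s,
    dt .u - 2 * y .v * d .v * (y .r)⁻¹ + y .v ^ 2 * d .r * (y .r)⁻¹ ^ 2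
      + d .r * ys .p + y .r * ds .p + d .Hθ * rH_s + y .Hθ * drH_s
      + d .r * y .Hz * ys .Hz + y .r * d .Hz * ys .Hz + y .r * y .Hz * ds .Hz,
    dt .r - d .u,
    dt .v + (d .u * y .v + y .u * d .v) * (y .r)⁻¹ - y .u * y .v * d .r * (y .r)⁻¹ ^ 2,
    dt .θ - d .v * (y .r)⁻¹ + y .v * d .r * (y .r)⁻¹ ^ 2,
    dt .p + γ * (d .ρ * y .p + y .ρ * d .p) * ru_s + γ * y .ρ * y .p * dru_s
      - (γ - 1) * (dsig * (y .Eθ ^ 2 + y .Ez ^ 2)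
        + 2 * sig * (y .Eθ * d .Eθ + y .Ez * d .Ez)),
    dt .Hθ - (d .r * y .ρ + y .r * d .ρ) * (ys .Ez - y .Hθ * ys .u)
      - y .r * y .ρ * (ds .Ez - d .Hθ * ys .u - y .Hθ * ds .u),
    dt .Hz + d .ρ * (rE_s + y .Hz * ru_s) + y .ρ * (drE_s + d .Hz * ru_s + y .Hz * dru_s),
    dsig * y .Eθ + sig * d .Eθ + (d .r * y .ρ + y .r * d .ρ) * ys .Hz + y .r * y .ρ * ds .Hz,
    dsig * y .Ez + sig * d .Ez - d .ρ * rH_s - y .ρ * drH_s]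

theorem differentiableAt_residual (γ : ℝ) {σ : ℝ → ℝ → ℝ} (hσ : SmoothOnQuadrant σ) {j : Jet}
    (hj : j.1 ∈ region) (k : Fin 10) : DifferentiableAt ℝ (fun j' => residual γ σ j' k) j := by
  have hr : j.1.2.2 .r ≠ 0 := (region_r_pos hj).ne'
  have hs : DifferentiableAt ℝ (fun j' : Jet => σ (j'.1.2.2 .ρ) (j'.1.2.2 .p)) j :=
    DifferentiableAt.comp (g := fun q : ℝ × ℝ => σ q.1 q.2)
      (f := fun j' : Jet => (j'.1.2.2 .ρ, j'.1.2.2 .p)) j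
      (hσ.differentiableAt (region_ρ_pos hj) (region_p_pos hj)) (by fun_prop)
  have h2r : 2 * j.1.2.2 .r ≠ 0 := mul_ne_zero two_ne_zero hr
  -- The composite with `σ` is made opaque, so that `fun_prop` uses `hs` for it as a whole.
  obtain ⟨g, hg⟩ : ∃ g : Jet → ℝ, ∀ j', σ (j'.1.2.2 .ρ) (j'.1.2.2 .p) = g j' := ⟨_, fun _ => rfl⟩
  simp only [hg] at hs
  fin_cases k <;> simp only [residual, Fin.reduceFinMk, Fin.isValue, Fin.zero_eta, Fin.mk_one,
    Matrix.cons_val, hg] <;> fun_prop (disch := assumption)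

theorem fderiv_residual (γ : ℝ) {σ : ℝ → ℝ → ℝ} (hσ : SmoothOnQuadrant σ) {j : Jet}
    (hj : j.1 ∈ region) (δ : Jet) (k : Fin 10) :
    fderiv ℝ (fun j' => residual γ σ j' k) j δ = linearized γ σ j δ k := by
  have hr : j.1.2.2 .r ≠ 0 := (region_r_pos hj).ne'
  -- By differentiability the differential in the direction `δ` is an ordinary derivative along `j +
  -- ε δ` at `ε = 0`.
  rw [← (differentiableAt_residual γ hσ hj k).lineDeriv_eq_fderiv, lineDeriv]
  apply HasDerivAt.deriv
  have hY : ∀ i, HasDerivAt (fun ε : ℝ => j.1.2.2 i + ε * δ.1.2.2 i) (δ.1.2.2 i) 0 := fun i => by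
    simpa using ((hasDerivAt_id (0 : ℝ)).mul_const (δ.1.2.2 i)).const_add (j.1.2.2 i)
  have hT : ∀ i, HasDerivAt (fun ε : ℝ => j.2.1 i + ε * δ.2.1 i) (δ.2.1 i) 0 := fun i => by
    simpa using ((hasDerivAt_id (0 : ℝ)).mul_const (δ.2.1 i)).const_add (j.2.1 i)
  have hS : ∀ i, HasDerivAt (fun ε : ℝ => j.2.2 i + ε * δ.2.2 i) (δ.2.2 i) 0 := fun i => by
    simpa using ((hasDerivAt_id (0 : ℝ)).mul_const (δ.2.2 i)).const_add (j.2.2 i)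
  have hsig := hσ.hasDerivAt_comp (hY .ρ) (hY .p) (by simpa using region_ρ_pos hj)
    (by simpa using region_p_pos hj)
  have hru := ((hS .r).mul (hY .u)).add ((hY .r).mul (hS .u))
  have hrE := ((hS .r).mul (hY .Eθ)).add ((hY .r).mul (hS .Eθ))
  have hrH := ((hS .r).mul (hY .Hθ)).add ((hY .r).mul (hS .Hθ))
  have hr' : j.1.2.2 .r + 0 * δ.1.2.2 .r ≠ 0 := by simpa using hr
  have h2r' : 2 * (j.1.2.2 .r + 0 * δ.1.2.2 .r) ≠ 0 := by simpa using hr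
  fin_cases k <;> simp only [residual, linearized, Fin.reduceFinMk, Fin.isValue, Fin.zero_eta,
    Fin.mk_one, Matrix.cons_val, Prod.fst_add, Prod.snd_add, Prod.smul_fst, Prod.smul_snd,
    Pi.add_apply, Pi.smul_apply, smul_eq_mul]
  · refine ((hT .ρ).sub (((hY .ρ).pow 2).neg.mul hru)).congr_deriv ?_
    simp; ring
  · refine (((hT .u).sub (((hY .v).pow 2).div (hY .r) hr')).sub
      ((((hY .r).neg.mul (hS .p)).sub (((hasDerivAt_const (0 : ℝ) (1 : ℝ)).div
        ((hY .r).const_mul 2) h2r').mul ((((hY .r).mul (hY .Hθ)).const_mul 2).mul hrH))).sub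
        (((hY .r).div_const 2).mul (((hY .Hz).const_mul 2).mul (hS .Hz))))).congr_deriv ?_
    simp; field_simp; ring
  · exact (hT .r).sub (hY .u)
  · refine ((hT .v).add (((hY .u).mul (hY .v)).div (hY .r) hr')).congr_deriv ?_
    simp; field_simp; ring
  · refine ((hT .θ).sub ((hY .v).div (hY .r) hr')).congr_deriv ?_
    simp; field_simp; ring
  · refine ((hT .p).sub ((((((hY .ρ).const_mul (-γ)).mul (hY .p))).mul hru).add
      ((hsig.const_mul (γ - 1)).mul (((hY .Eθ).pow 2).add ((hY .Ez).pow 2))))).congr_deriv ?_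
    simp; ring
  · refine ((hT .Hθ).sub (((hY .r).mul (hY .ρ)).mul
      ((hS .Ez).sub ((hY .Hθ).mul (hS .u))))).congr_deriv ?_
    simp; ring
  · refine ((hT .Hz).sub ((hY .ρ).neg.mul (hrE.add ((hY .Hz).mul hru)))).congr_deriv ?_
    simp; ring
  · refine ((hsig.mul (hY .Eθ)).sub (((hY .r).neg.mul (hY .ρ)).mul (hS .Hz))).congr_deriv ?_
    simp; ring
  · refine ((hsig.mul (hY .Ez)).sub ((hY .ρ).mul hrH)).congr_deriv ?_
    simp; ring

/-- The first-order jets on the solution manifold, parametrized by the free derivatives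
`a = E^θ_t`, `b = E^z_t`, `rs = r_s`, …, `fs = E^θ_s`, `gs = E^z_s`. -/
def solutionJet (γ : ℝ) (σ : ℝ → ℝ → ℝ) (x : Phase) (a b rs θs us vs ρs ps fs gs : ℝ) : Jet :=
  let y := x.2.2
  let sig := σ (y .ρ) (y .p)
  let w := (y .r)⁻¹
  let ru_s := rs * y .u + y .r * us
  (x, fun
    | .r => y .u
    | .θ => y .v * w
    | .u => y .v ^ 2 * w - y .r * ps - (y .Hθ * y .Ez - y .Hz * y .Eθ) * (sig * (y .ρ)⁻¹)
    | .v => -(y .u * y .v * w)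
    | .ρ => -(y .ρ) ^ 2 * ru_s
    | .p => -γ * y .ρ * y .p * ru_s + (γ - 1) * sig * (y .Eθ ^ 2 + y .Ez ^ 2)
    | .Eθ => a
    | .Ez => b
    | .Hθ => y .r * y .ρ * (gs - y .Hθ * us)
    | .Hz => -(y .ρ) * (rs * y .Eθ + y .r * fs + y .Hz * ru_s),
  fun
    | .r => rs
    | .θ => θs
    | .u => us
    | .v => vs
    | .ρ => ρs
    | .p => ps
    | .Eθ => fs
    | .Ez => gs
    | .Hθ => y .Ez * (sig * (y .ρ)⁻¹) * w - rs * y .Hθ * w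
    | .Hz => -(y .Eθ * (sig * (y .ρ)⁻¹) * w))

theorem residual_solutionJet (γ : ℝ) (σ : ℝ → ℝ → ℝ) {x : Phase} (hx : x ∈ region)
    (a b rs θs us vs ρs ps fs gs : ℝ) (k : Fin 10) :
    residual γ σ (solutionJet γ σ x a b rs θs us vs ρs ps fs gs) k = 0 := by
  have hr := (region_r_pos hx).ne'
  have hρ := (region_ρ_pos hx).ne'
  fin_cases k <;> simp only [residual, solutionJet, Fin.reduceFinMk, Fin.isValue, Fin.zero_eta,
    Fin.mk_one, Matrix.cons_val] <;> field_simp <;> ring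

theorem fderiv_fst {X : Phase → Phase} {x : Phase} (h : DifferentiableAt ℝ X x) (e : Phase) :
    (fderiv ℝ X x e).1 = fderiv ℝ (fun z => (X z).1) x e := by
  rw [fderiv.fst h]; rfl

theorem fderiv_snd_fst {X : Phase → Phase} {x : Phase} (h : DifferentiableAt ℝ X x) (e : Phase) :
    (fderiv ℝ X x e).2.1 = fderiv ℝ (fun z => (X z).2.1) x e := by
  rw [fderiv.fst h.snd, fderiv.snd h]; rfl

theorem fderiv_snd_snd {X : Phase → Phase} {x : Phase} (h : DifferentiableAt ℝ X x) (i : Dep)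
    (e : Phase) : (fderiv ℝ X x e).2.2 i = fderiv ℝ (fun z => (X z).2.2 i) x e := by
  have h2 : DifferentiableAt ℝ (fun z => (X z).2.2) x := h.snd.snd
  have := fderiv_apply (𝕜 := ℝ) (Φ := fun z => (X z).2.2) h2 i
  rw [this, fderiv.snd h.snd, fderiv.snd h]; rfl

theorem Admitted.linearized_eq_zero {γ : ℝ} {σ : ℝ → ℝ → ℝ} (hσ : SmoothOnQuadrant σ)
    {X : Phase → Phase} (hX : Admitted γ σ X) {x : Phase} (hx : x ∈ region)
    (a b rs θs us vs ρs ps fs gs : ℝ) (k : Fin 10) :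
    linearized γ σ (solutionJet γ σ x a b rs θs us vs ρs ps fs gs)
      (prolong X (solutionJet γ σ x a b rs θs us vs ρs ps fs gs)) k = 0 := by
  rw [← fderiv_residual γ hσ (by exact hx)]
  exact hX.2 _ hx (residual_solutionJet γ σ hx a b rs θs us vs ρs ps fs gs) k

/-! ### Splitting of the determining equations. -/

/-- The components of a vector field. -/
def cT (X : Phase → Phase) (x : Phase) : ℝ := (X x).1
def cS (X : Phase → Phase) (x : Phase) : ℝ := (X x).2.1
def cY (X : Phase → Phase) (i : Dep) (x : Phase) : ℝ := (X x).2.2 i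

theorem Admitted.smooth_cT {γ : ℝ} {σ : ℝ → ℝ → ℝ} {X : Phase → Phase} (hX : Admitted γ σ X) :
    Smooth (cT X) := hX.1.fst
theorem Admitted.smooth_cS {γ : ℝ} {σ : ℝ → ℝ → ℝ} {X : Phase → Phase} (hX : Admitted γ σ X) :
    Smooth (cS X) := hX.1.snd.fst
theorem Admitted.smooth_cY {γ : ℝ} {σ : ℝ → ℝ → ℝ} {X : Phase → Phase} (hX : Admitted γ σ X)
    (i : Dep) : Smooth (cY X i) :=
  contDiffOn_pi.1 hX.1.snd.snd i

theorem prolong_eq {X : Phase → Phase} {j : Jet} (h : DifferentiableAt ℝ X j.1) :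
    prolong X j = (X j.1,
      fun i => fderiv ℝ (cY X i) j.1 (1, 0, j.2.1) - j.2.1 i * fderiv ℝ (cT X) j.1 (1, 0, j.2.1)
        - j.2.2 i * fderiv ℝ (cS X) j.1 (1, 0, j.2.1),
      fun i => fderiv ℝ (cY X i) j.1 (0, 1, j.2.2) - j.2.1 i * fderiv ℝ (cT X) j.1 (0, 1, j.2.2)
        - j.2.2 i * fderiv ℝ (cS X) j.1 (0, 1, j.2.2)) := by
  simp only [prolong, totalT, totalS, fderiv_fst h, fderiv_snd_fst h, fderiv_snd_snd h]
  rfl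

/-- The system is autonomous in `t` and `s`, so `linearized` ignores the corresponding components of
its direction, and they may be replaced by zeros. -/
theorem Admitted.linearized_cY_eq_zero {γ : ℝ} {σ : ℝ → ℝ → ℝ} (hσ : SmoothOnQuadrant σ)
    {X : Phase → Phase} (hX : Admitted γ σ X) {x : Phase} (hx : x ∈ region)
    (a b rs θs us vs ρs ps fs gs : ℝ) (k : Fin 10) :
    linearized γ σ (solutionJet γ σ x a b rs θs us vs ρs ps fs gs)
      ((0, 0, fun i => cY X i x),
      fun i => fderiv ℝ (cY X i) x (1, 0, (solutionJet γ σ x a b rs θs us vs ρs ps fs gs).2.1)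
        - (solutionJet γ σ x a b rs θs us vs ρs ps fs gs).2.1 i
          * fderiv ℝ (cT X) x (1, 0, (solutionJet γ σ x a b rs θs us vs ρs ps fs gs).2.1)
        - (solutionJet γ σ x a b rs θs us vs ρs ps fs gs).2.2 i
          * fderiv ℝ (cS X) x (1, 0, (solutionJet γ σ x a b rs θs us vs ρs ps fs gs).2.1),
      fun i => fderiv ℝ (cY X i) x (0, 1, (solutionJet γ σ x a b rs θs us vs ρs ps fs gs).2.2)
        - (solutionJet γ σ x a b rs θs us vs ρs ps fs gs).2.1 i
          * fderiv ℝ (cT X) x (0, 1, (solutionJet γ σ x a b rs θs us vs ρs ps fs gs).2.2)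
        - (solutionJet γ σ x a b rs θs us vs ρs ps fs gs).2.2 i
          * fderiv ℝ (cS X) x (0, 1, (solutionJet γ σ x a b rs θs us vs ρs ps fs gs).2.2)) k = 0 := by
  have h := hX.linearized_eq_zero hσ hx a b rs θs us vs ρs ps fs gs k
  rwa [prolong_eq (j := solutionJet γ σ x a b rs θs us vs ρs ps fs gs)
    (differentiableAt_of_smooth hX.1 hx)] at h

set_option maxHeartbeats 2000000 in
/-- The coefficients at `∂_t` and `∂_s` depend on `t` and on `s` only, and the coefficients
at the nonelectric variables do not depend on the electric field. -/
theorem Admitted.projectable {γ : ℝ} {σ : ℝ → ℝ → ℝ} (hσ : SmoothOnQuadrant σ)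
    {X : Phase → Phase} (hX : Admitted γ σ X) {x : Phase} (hx : x ∈ region) :
    (pd eS (cT X) x = 0 ∧ ∀ i, pd (eY i) (cT X) x = 0) ∧
    (pd eT (cS X) x = 0 ∧ ∀ i, pd (eY i) (cS X) x = 0) ∧
    (∀ i, i ≠ .Eθ → i ≠ .Ez → pd (eY .Eθ) (cY X i) x = 0 ∧ pd (eY .Ez) (cY X i) x = 0) := by
  have hr := (region_r_pos hx).ne'
  have hρ := (region_ρ_pos hx).ne'
  have L := hX.linearized_cY_eq_zero hσ hx
  have L0 := fun a b rs θs us vs ρs ps fs gs => L a b rs θs us vs ρs ps fs gs 0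
  have L1 := fun a b rs θs us vs ρs ps fs gs => L a b rs θs us vs ρs ps fs gs 1
  have L2 := fun a b rs θs us vs ρs ps fs gs => L a b rs θs us vs ρs ps fs gs 2
  have L3 := fun a b rs θs us vs ρs ps fs gs => L a b rs θs us vs ρs ps fs gs 3
  have L4 := fun a b rs θs us vs ρs ps fs gs => L a b rs θs us vs ρs ps fs gs 4
  have L5 := fun a b rs θs us vs ρs ps fs gs => L a b rs θs us vs ρs ps fs gs 5
  have L6 := fun a b rs θs us vs ρs ps fs gs => L a b rs θs us vs ρs ps fs gs 6
  have L7 := fun a b rs θs us vs ρs ps fs gs => L a b rs θs us vs ρs ps fs gs 7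
  have L9 := fun a b rs θs us vs ρs ps fs gs => L a b rs θs us vs ρs ps fs gs 9
  clear L
  simp only [linearized, Matrix.cons_val, fderiv_apply_eq, solutionJet, zero_mul, zero_add,
    one_mul] at L0 L1 L2 L3 L4 L5 L6 L7 L9
  -- Each equation has degree at most two in the free derivatives. A mixed second difference of its
  -- values at 0 and 1 therefore isolates the coefficient of one product, here `E^θ_t r_s`.
  have ξf : pd (eY .Eθ) (cS X) x = 0 := by
    linear_combination -(L2 1 0 1 0 0 0 0 0 0 0 - L2 1 0 0 0 0 0 0 0 0 0
      - L2 0 0 1 0 0 0 0 0 0 0 + L2 0 0 0 0 0 0 0 0 0 0)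
  have ξg : pd (eY .Ez) (cS X) x = 0 := by
    linear_combination -(L2 0 1 1 0 0 0 0 0 0 0 - L2 0 1 0 0 0 0 0 0 0 0
      - L2 0 0 1 0 0 0 0 0 0 0 + L2 0 0 0 0 0 0 0 0 0 0)
  have ξu : pd (eY .u) (cS X) x = 0 := by
    refine (mul_eq_zero.1 (?_ : x.2.2 .r * _ = 0)).resolve_left hr
    linear_combination (L2 0 0 1 0 0 0 0 1 0 0 - L2 0 0 1 0 0 0 0 0 0 0
      - L2 0 0 0 0 0 0 0 1 0 0 + L2 0 0 0 0 0 0 0 0 0 0)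
  have ξHθ : pd (eY .Hθ) (cS X) x = 0 := by
    refine (mul_eq_zero.1 (?_ : (x.2.2 .r * x.2.2 .ρ) * _ = 0)).resolve_left (mul_ne_zero hr hρ)
    linear_combination -(L2 0 0 1 0 0 0 0 0 0 1 - L2 0 0 1 0 0 0 0 0 0 0
      - L2 0 0 0 0 0 0 0 0 0 1 + L2 0 0 0 0 0 0 0 0 0 0)
  have ξHz : pd (eY .Hz) (cS X) x = 0 := by
    refine (mul_eq_zero.1 (?_ : (x.2.2 .r * x.2.2 .ρ) * _ = 0)).resolve_left (mul_ne_zero hr hρ)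
    linear_combination (L2 0 0 1 0 0 0 0 0 1 0 - L2 0 0 1 0 0 0 0 0 0 0
      - L2 0 0 0 0 0 0 0 0 1 0 + L2 0 0 0 0 0 0 0 0 0 0)
  have τf : pd (eY .Eθ) (cT X) x = 0 := by
    refine (mul_eq_zero.1 (?_ : (x.2.2 .r * x.2.2 .ρ ^ 2) * _ = 0)).resolve_left
      (mul_ne_zero hr (pow_ne_zero 2 hρ))
    linear_combination (L0 1 0 0 0 1 0 0 0 0 0 - L0 1 0 0 0 0 0 0 0 0 0
      - L0 0 0 0 0 1 0 0 0 0 0 + L0 0 0 0 0 0 0 0 0 0 0)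
  have τg : pd (eY .Ez) (cT X) x = 0 := by
    refine (mul_eq_zero.1 (?_ : (x.2.2 .r * x.2.2 .ρ ^ 2) * _ = 0)).resolve_left
      (mul_ne_zero hr (pow_ne_zero 2 hρ))
    linear_combination (L0 0 1 0 0 1 0 0 0 0 0 - L0 0 1 0 0 0 0 0 0 0 0
      - L0 0 0 0 0 1 0 0 0 0 0 + L0 0 0 0 0 0 0 0 0 0 0)
  simp only [ξf, ξg, ξu, ξHθ, ξHz, τf, τg, mul_zero, add_zero,
    sub_zero] at L0 L1 L2 L3 L4 L5 L6 L7 L9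
  have hrρ : x.2.2 .r * x.2.2 .ρ ≠ 0 := mul_ne_zero hr hρ
  have τθ : pd (eY .θ) (cT X) x = 0 := by
    refine (mul_eq_zero.1 (?_ : (x.2.2 .r * x.2.2 .ρ) * _ = 0)).resolve_left hrρ
    linear_combination (L6 0 1 0 1 0 0 0 0 0 0 - L6 0 1 0 0 0 0 0 0 0 0
      - L6 0 0 0 1 0 0 0 0 0 0 + L6 0 0 0 0 0 0 0 0 0 0)
  have τu : pd (eY .u) (cT X) x = 0 := by
    refine (mul_eq_zero.1 (?_ : (x.2.2 .r * x.2.2 .ρ) * _ = 0)).resolve_left hrρ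
    linear_combination (L6 0 1 0 0 1 0 0 0 0 0 - L6 0 1 0 0 0 0 0 0 0 0
      - L6 0 0 0 0 1 0 0 0 0 0 + L6 0 0 0 0 0 0 0 0 0 0)
  have τv : pd (eY .v) (cT X) x = 0 := by
    refine (mul_eq_zero.1 (?_ : (x.2.2 .r * x.2.2 .ρ) * _ = 0)).resolve_left hrρ
    linear_combination (L6 0 1 0 0 0 1 0 0 0 0 - L6 0 1 0 0 0 0 0 0 0 0
      - L6 0 0 0 0 0 1 0 0 0 0 + L6 0 0 0 0 0 0 0 0 0 0)
  have τρ : pd (eY .ρ) (cT X) x = 0 := by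
    refine (mul_eq_zero.1 (?_ : (x.2.2 .r * x.2.2 .ρ) * _ = 0)).resolve_left hrρ
    linear_combination (L6 0 1 0 0 0 0 1 0 0 0 - L6 0 1 0 0 0 0 0 0 0 0
      - L6 0 0 0 0 0 0 1 0 0 0 + L6 0 0 0 0 0 0 0 0 0 0)
  have τp : pd (eY .p) (cT X) x = 0 := by
    refine (mul_eq_zero.1 (?_ : (x.2.2 .r * x.2.2 .ρ) * _ = 0)).resolve_left hrρ
    linear_combination (L6 0 1 0 0 0 0 0 1 0 0 - L6 0 1 0 0 0 0 0 0 0 0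
      - L6 0 0 0 0 0 0 0 1 0 0 + L6 0 0 0 0 0 0 0 0 0 0)
  -- By Ohm's law `r_s` also enters `H^θ_s`, so `r_s` only gives this combination; the momentum
  -- equation separates the two derivatives afterwards.
  have τrH : pd (eY .r) (cT X) x - x.2.2 .Hθ * (x.2.2 .r)⁻¹ * pd (eY .Hθ) (cT X) x = 0 := by
    refine (mul_eq_zero.1 (?_ : (x.2.2 .r * x.2.2 .ρ) * _ = 0)).resolve_left hrρ
    linear_combination (L6 0 1 1 0 0 0 0 0 0 0 - L6 0 1 0 0 0 0 0 0 0 0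
      - L6 0 0 1 0 0 0 0 0 0 0 + L6 0 0 0 0 0 0 0 0 0 0)
  simp only [τθ, τu, τv, τρ, τp, mul_zero, add_zero, sub_zero] at L0 L1 L2 L3 L4 L5 L6 L7 L9
  have τHθ : pd (eY .Hθ) (cT X) x = 0 := by
    refine (mul_eq_zero.1 (?_ : (x.2.2 .r * (x.2.2 .r * x.2.2 .ρ)) * _ = 0)).resolve_left
      (mul_ne_zero hr hrρ)
    linear_combination (L1 0 0 0 0 0 0 0 1 0 1 - L1 0 0 0 0 0 0 0 1 0 0
      - L1 0 0 0 0 0 0 0 0 0 1 + L1 0 0 0 0 0 0 0 0 0 0)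
  have τHz : pd (eY .Hz) (cT X) x = 0 := by
    refine (mul_eq_zero.1 (?_ : (x.2.2 .r * (x.2.2 .r * x.2.2 .ρ)) * _ = 0)).resolve_left
      (mul_ne_zero hr hrρ)
    linear_combination -(L1 0 0 0 0 0 0 0 1 1 0 - L1 0 0 0 0 0 0 0 1 0 0
      - L1 0 0 0 0 0 0 0 0 1 0 + L1 0 0 0 0 0 0 0 0 0 0)
  have τr : pd (eY .r) (cT X) x = 0 := by simpa [τHθ] using τrH
  simp only [τHθ, τHz, τr, mul_zero, add_zero, sub_zero] at L0 L1 L2 L3 L4 L5 L6 L7 L9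
  have rg : pd (eY .Ez) (cY X .r) x = 0 := by
    linear_combination L2 0 1 0 0 0 0 0 0 0 0 - L2 0 0 0 0 0 0 0 0 0 0
  -- The coefficient of `E^z_t` in the induction equation and that of `E^z_s` in Ohm's law both
  -- contain the `E^z`-derivative of the coefficient at `H^θ`. It cancels in this combination, while
  -- the two occurrences of `∂_s ξ^t` add up.
  have τs : pd eS (cT X) x = 0 := by
    refine (mul_eq_zero.1 (?_ : (2 * (x.2.2 .ρ * x.2.2 .r) * (x.2.2 .r * x.2.2 .ρ)) * _ = 0)).resolve_left
      (by positivity)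
    linear_combination (x.2.2 .ρ * x.2.2 .r) * (L6 0 1 0 0 0 0 0 0 0 0 - L6 0 0 0 0 0 0 0 0 0 0)
      + (L9 0 0 0 0 0 0 0 0 0 1 - L9 0 0 0 0 0 0 0 0 0 0) + x.2.2 .ρ * x.2.2 .Hθ * rg
  simp only [τs, mul_zero, add_zero, sub_zero] at L0 L1 L2 L3 L4 L5 L6 L7 L9
  have hrρ2 : x.2.2 .r * x.2.2 .ρ ^ 2 ≠ 0 := mul_ne_zero hr (pow_ne_zero 2 hρ)
  have ξθ : pd (eY .θ) (cS X) x = 0 := by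
    refine (mul_eq_zero.1 (?_ : (x.2.2 .r * x.2.2 .ρ ^ 2) * _ = 0)).resolve_left hrρ2
    linear_combination -(L0 0 0 0 1 1 0 0 0 0 0 - L0 0 0 0 1 0 0 0 0 0 0
      - L0 0 0 0 0 1 0 0 0 0 0 + L0 0 0 0 0 0 0 0 0 0 0)
  have ξv : pd (eY .v) (cS X) x = 0 := by
    refine (mul_eq_zero.1 (?_ : (x.2.2 .r * x.2.2 .ρ ^ 2) * _ = 0)).resolve_left hrρ2
    linear_combination -(L0 0 0 0 0 1 1 0 0 0 0 - L0 0 0 0 0 0 1 0 0 0 0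
      - L0 0 0 0 0 1 0 0 0 0 0 + L0 0 0 0 0 0 0 0 0 0 0)
  have ξp : pd (eY .p) (cS X) x = 0 := by
    refine (mul_eq_zero.1 (?_ : (x.2.2 .r * x.2.2 .ρ ^ 2) * _ = 0)).resolve_left hrρ2
    linear_combination -(L0 0 0 0 0 1 0 0 1 0 0 - L0 0 0 0 0 0 0 0 1 0 0
      - L0 0 0 0 0 1 0 0 0 0 0 + L0 0 0 0 0 0 0 0 0 0 0)
  simp only [ξθ, ξv, ξp, mul_zero, add_zero, sub_zero] at L0 L1 L2 L3 L4 L5 L6 L7 L9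
  have ξρ : pd (eY .ρ) (cS X) x = 0 := by
    refine (mul_eq_zero.1 (?_ : (x.2.2 .r * x.2.2 .ρ ^ 2) * _ = 0)).resolve_left hrρ2
    linear_combination (L2 0 0 1 0 1 0 0 0 0 0 - L2 0 0 1 0 0 0 0 0 0 0
      - L2 0 0 0 0 1 0 0 0 0 0 + L2 0 0 0 0 0 0 0 0 0 0)
  simp only [ξρ, mul_zero, add_zero, sub_zero] at L0 L1 L2 L3 L4 L5 L6 L7 L9
  have ξr : pd (eY .r) (cS X) x = 0 := by
    refine (mul_eq_zero.1 (?_ : (x.2.2 .r * x.2.2 .ρ ^ 2) * _ = 0)).resolve_left hrρ2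
    linear_combination -(L0 0 0 1 0 1 0 0 0 0 0 - L0 0 0 1 0 0 0 0 0 0 0
      - L0 0 0 0 0 1 0 0 0 0 0 + L0 0 0 0 0 0 0 0 0 0 0)
  simp only [ξr, mul_zero, add_zero, sub_zero] at L0 L1 L2 L3 L4 L5 L6 L7 L9
  have ξt : pd eT (cS X) x = 0 := by
    linear_combination -(L4 0 0 0 1 0 0 0 0 0 0 - L4 0 0 0 0 0 0 0 0 0 0)
  simp only [ξt, mul_zero, add_zero, sub_zero] at L0 L1 L2 L3 L4 L5 L6 L7 L9
  refine ⟨⟨τs, ?_⟩, ⟨ξt, ?_⟩, ?_⟩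
  · rintro (_ | _ | _ | _ | _ | _ | _ | _ | _ | _) <;> assumption
  · rintro (_ | _ | _ | _ | _ | _ | _ | _ | _ | _) <;> assumption
  · rintro (_ | _ | _ | _ | _ | _ | _ | _ | _ | _) h1 h2
    · exact ⟨by linear_combination L2 1 0 0 0 0 0 0 0 0 0 - L2 0 0 0 0 0 0 0 0 0 0,
        by linear_combination L2 0 1 0 0 0 0 0 0 0 0 - L2 0 0 0 0 0 0 0 0 0 0⟩
    · exact ⟨by linear_combination L4 1 0 0 0 0 0 0 0 0 0 - L4 0 0 0 0 0 0 0 0 0 0,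
        by linear_combination L4 0 1 0 0 0 0 0 0 0 0 - L4 0 0 0 0 0 0 0 0 0 0⟩
    · exact ⟨by linear_combination L1 1 0 0 0 0 0 0 0 0 0 - L1 0 0 0 0 0 0 0 0 0 0,
        by linear_combination L1 0 1 0 0 0 0 0 0 0 0 - L1 0 0 0 0 0 0 0 0 0 0⟩
    · exact ⟨by linear_combination L3 1 0 0 0 0 0 0 0 0 0 - L3 0 0 0 0 0 0 0 0 0 0,
        by linear_combination L3 0 1 0 0 0 0 0 0 0 0 - L3 0 0 0 0 0 0 0 0 0 0⟩
    · exact ⟨by linear_combination L0 1 0 0 0 0 0 0 0 0 0 - L0 0 0 0 0 0 0 0 0 0 0,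
        by linear_combination L0 0 1 0 0 0 0 0 0 0 0 - L0 0 0 0 0 0 0 0 0 0 0⟩
    · exact ⟨by linear_combination L5 1 0 0 0 0 0 0 0 0 0 - L5 0 0 0 0 0 0 0 0 0 0,
        by linear_combination L5 0 1 0 0 0 0 0 0 0 0 - L5 0 0 0 0 0 0 0 0 0 0⟩
    · exact absurd rfl h1
    · exact absurd rfl h2
    · exact ⟨by linear_combination L6 1 0 0 0 0 0 0 0 0 0 - L6 0 0 0 0 0 0 0 0 0 0,
        by linear_combination L6 0 1 0 0 0 0 0 0 0 0 - L6 0 0 0 0 0 0 0 0 0 0⟩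
    · exact ⟨by linear_combination L7 1 0 0 0 0 0 0 0 0 0 - L7 0 0 0 0 0 0 0 0 0 0,
        by linear_combination L7 0 1 0 0 0 0 0 0 0 0 - L7 0 0 0 0 0 0 0 0 0 0⟩

/-- The determining equations of a field whose coefficients at `∂_t` and `∂_s` depend on `t` and on
`s` only, split with respect to the free derivatives. The suffix names the free derivative; `c`
marks the terms without free derivatives. -/
structure Determining (γ : ℝ) (σ : ℝ → ℝ → ℝ) (X : Phase → Phase) (x : Phase) : Prop where
  r_u_eq : pd (eY .u) (cY X .r) x = 0
  r_Hθ_eq : pd (eY .Hθ) (cY X .r) x = 0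
  r_Hz_eq : pd (eY .Hz) (cY X .r) x = 0
  r_us_eq : x.2.2 .ρ * pd (eY .ρ) (cY X .r) x + γ * x.2.2 .p * pd (eY .p) (cY X .r) x = 0
  r_c_eq : pd eT (cY X .r) x + x.2.2 .u * pd (eY .r) (cY X .r) x + x.2.2 .v * (x.2.2 .r)⁻¹ * pd
    (eY .θ) (cY X .r) x - x.2.2 .u * x.2.2 .v * (x.2.2 .r)⁻¹ * pd (eY .v) (cY X .r) x + (γ - 1) *
    σ (x.2.2 .ρ) (x.2.2 .p) * (x.2.2 .Eθ ^ 2 + x.2.2 .Ez ^ 2) * pd (eY .p) (cY X .r) x - x.2.2 .u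
    * pd eT (cT X) x - cY X .u x = 0
  θ_u_eq : pd (eY .u) (cY X .θ) x = 0
  θ_Hθ_eq : pd (eY .Hθ) (cY X .θ) x = 0
  θ_Hz_eq : pd (eY .Hz) (cY X .θ) x = 0
  θ_us_eq : x.2.2 .ρ * pd (eY .ρ) (cY X .θ) x + γ * x.2.2 .p * pd (eY .p) (cY X .θ) x = 0
  θ_c_eq : pd eT (cY X .θ) x + x.2.2 .u * pd (eY .r) (cY X .θ) x + x.2.2 .v * (x.2.2 .r)⁻¹ * pd
    (eY .θ) (cY X .θ) x - x.2.2 .u * x.2.2 .v * (x.2.2 .r)⁻¹ * pd (eY .v) (cY X .θ) x + (γ - 1) *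
    σ (x.2.2 .ρ) (x.2.2 .p) * (x.2.2 .Eθ ^ 2 + x.2.2 .Ez ^ 2) * pd (eY .p) (cY X .θ) x - x.2.2 .v
    * (x.2.2 .r)⁻¹ * pd eT (cT X) x - cY X .v x * (x.2.2 .r)⁻¹ + x.2.2 .v * cY X .r x * (x.2.2
    .r)⁻¹ ^ 2 = 0
  v_u_eq : pd (eY .u) (cY X .v) x = 0
  v_Hθ_eq : pd (eY .Hθ) (cY X .v) x = 0
  v_Hz_eq : pd (eY .Hz) (cY X .v) x = 0
  v_us_eq : x.2.2 .ρ * pd (eY .ρ) (cY X .v) x + γ * x.2.2 .p * pd (eY .p) (cY X .v) x = 0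
  v_c_eq : pd eT (cY X .v) x + x.2.2 .u * pd (eY .r) (cY X .v) x + x.2.2 .v * (x.2.2 .r)⁻¹ * pd
    (eY .θ) (cY X .v) x - x.2.2 .u * x.2.2 .v * (x.2.2 .r)⁻¹ * pd (eY .v) (cY X .v) x + (γ - 1) *
    σ (x.2.2 .ρ) (x.2.2 .p) * (x.2.2 .Eθ ^ 2 + x.2.2 .Ez ^ 2) * pd (eY .p) (cY X .v) x + x.2.2 .u
    * x.2.2 .v * (x.2.2 .r)⁻¹ * pd eT (cT X) x + (cY X .u x * x.2.2 .v + x.2.2 .u * cY X .v x) *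
    (x.2.2 .r)⁻¹ - x.2.2 .u * x.2.2 .v * cY X .r x * (x.2.2 .r)⁻¹ ^ 2 = 0
  ρ_ps_eq : -x.2.2 .r * pd (eY .u) (cY X .ρ) x + x.2.2 .ρ ^ 2 * (x.2.2 .u * pd (eY .p) (cY X .r) x
    + x.2.2 .r * pd (eY .p) (cY X .u) x) = 0
  ρ_Hθ_eq : pd (eY .Hθ) (cY X .ρ) x = 0
  ρ_Hz_eq : pd (eY .Hz) (cY X .ρ) x = 0
  ρ_θs_eq : x.2.2 .u * pd (eY .θ) (cY X .r) x + x.2.2 .r * pd (eY .θ) (cY X .u) x = 0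
  ρ_vs_eq : x.2.2 .u * pd (eY .v) (cY X .r) x + x.2.2 .r * pd (eY .v) (cY X .u) x = 0
  ρ_rs_eq : -x.2.2 .ρ * x.2.2 .u * pd (eY .ρ) (cY X .ρ) x - γ * x.2.2 .p * x.2.2 .u * pd (eY .p)
    (cY X .ρ) x + x.2.2 .ρ * x.2.2 .u * pd eT (cT X) x + 2 * x.2.2 .u * cY X .ρ x + x.2.2 .ρ *
    (x.2.2 .u * pd (eY .r) (cY X .r) x - x.2.2 .u * pd eS (cS X) x + cY X .u x + x.2.2 .r * pd (eY
    .r) (cY X .u) x - x.2.2 .r * (x.2.2 .r)⁻¹ * x.2.2 .Hθ * pd (eY .Hθ) (cY X .u) x) = 0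
  ρ_c_eq : pd eT (cY X .ρ) x + x.2.2 .u * pd (eY .r) (cY X .ρ) x + x.2.2 .v * (x.2.2 .r)⁻¹ * pd
    (eY .θ) (cY X .ρ) x + (x.2.2 .v ^ 2 * (x.2.2 .r)⁻¹ - (x.2.2 .Hθ * x.2.2 .Ez - x.2.2 .Hz *
    x.2.2 .Eθ) * (σ (x.2.2 .ρ) (x.2.2 .p) * (x.2.2 .ρ)⁻¹)) * pd (eY .u) (cY X .ρ) x - x.2.2 .u *
    x.2.2 .v * (x.2.2 .r)⁻¹ * pd (eY .v) (cY X .ρ) x + (γ - 1) * σ (x.2.2 .ρ) (x.2.2 .p) * (x.2.2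
    .Eθ ^ 2 + x.2.2 .Ez ^ 2) * pd (eY .p) (cY X .ρ) x + x.2.2 .ρ ^ 2 * (x.2.2 .u * pd eS (cY X .r)
    x + x.2.2 .r * (pd eS (cY X .u) x + x.2.2 .Ez * (σ (x.2.2 .ρ) (x.2.2 .p) * (x.2.2 .ρ)⁻¹) *
    (x.2.2 .r)⁻¹ * pd (eY .Hθ) (cY X .u) x - x.2.2 .Eθ * (σ (x.2.2 .ρ) (x.2.2 .p) * (x.2.2 .ρ)⁻¹)
    * (x.2.2 .r)⁻¹ * pd (eY .Hz) (cY X .u) x)) = 0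
  p_ps_eq : -x.2.2 .r * pd (eY .u) (cY X .p) x + γ * x.2.2 .ρ * x.2.2 .p * (x.2.2 .u * pd (eY .p)
    (cY X .r) x + x.2.2 .r * pd (eY .p) (cY X .u) x) = 0
  p_Hθ_eq : pd (eY .Hθ) (cY X .p) x = 0
  p_Hz_eq : pd (eY .Hz) (cY X .p) x = 0
  p_us_eq : -x.2.2 .ρ * x.2.2 .r * pd (eY .ρ) (cY X .p) x - γ * x.2.2 .p * x.2.2 .r * pd (eY .p)
    (cY X .p) x + γ * x.2.2 .p * x.2.2 .r * pd eT (cT X) x + γ * (cY X .ρ x * x.2.2 .p * (x.2.2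
    .ρ)⁻¹ + cY X .p x) * x.2.2 .r + γ * x.2.2 .p * (cY X .r x + x.2.2 .r * pd (eY .u) (cY X .u) x
    - x.2.2 .r * pd eS (cS X) x) = 0
  p_c_eq : pd eT (cY X .p) x + x.2.2 .u * pd (eY .r) (cY X .p) x + x.2.2 .v * (x.2.2 .r)⁻¹ * pd
    (eY .θ) (cY X .p) x + (x.2.2 .v ^ 2 * (x.2.2 .r)⁻¹ - (x.2.2 .Hθ * x.2.2 .Ez - x.2.2 .Hz *
    x.2.2 .Eθ) * (σ (x.2.2 .ρ) (x.2.2 .p) * (x.2.2 .ρ)⁻¹)) * pd (eY .u) (cY X .p) x - x.2.2 .u *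
    x.2.2 .v * (x.2.2 .r)⁻¹ * pd (eY .v) (cY X .p) x + (γ - 1) * σ (x.2.2 .ρ) (x.2.2 .p) * (x.2.2
    .Eθ ^ 2 + x.2.2 .Ez ^ 2) * (pd (eY .p) (cY X .p) x - pd eT (cT X) x) + γ * x.2.2 .ρ * x.2.2 .p
    * (x.2.2 .u * pd eS (cY X .r) x + x.2.2 .r * (pd eS (cY X .u) x + x.2.2 .Ez * (σ (x.2.2 .ρ)
    (x.2.2 .p) * (x.2.2 .ρ)⁻¹) * (x.2.2 .r)⁻¹ * pd (eY .Hθ) (cY X .u) x - x.2.2 .Eθ * (σ (x.2.2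
    .ρ) (x.2.2 .p) * (x.2.2 .ρ)⁻¹) * (x.2.2 .r)⁻¹ * pd (eY .Hz) (cY X .u) x)) - (γ - 1) * ((sρ σ
    (x.2.2 .ρ) (x.2.2 .p) * cY X .ρ x + sp σ (x.2.2 .ρ) (x.2.2 .p) * cY X .p x) * (x.2.2 .Eθ ^ 2 +
    x.2.2 .Ez ^ 2) + 2 * σ (x.2.2 .ρ) (x.2.2 .p) * (x.2.2 .Eθ * cY X .Eθ x + x.2.2 .Ez * cY X .Ez
    x)) = 0
  Hz_p_eq : pd (eY .p) (cY X .Hz) x = 0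
  Hz_ρ_eq : pd (eY .ρ) (cY X .Hz) x = 0
  Hz_θ_eq : pd (eY .θ) (cY X .Hz) x = 0
  Hz_v_eq : pd (eY .v) (cY X .Hz) x = 0
  Hz_rs_eq : pd (eY .r) (cY X .Hz) x - x.2.2 .Hθ * (x.2.2 .r)⁻¹ * pd (eY .Hθ) (cY X .Hz) x = 0
  Eθ_c_eq : (sρ σ (x.2.2 .ρ) (x.2.2 .p) * cY X .ρ x + sp σ (x.2.2 .ρ) (x.2.2 .p) * cY X .p x) *
    x.2.2 .Eθ + σ (x.2.2 .ρ) (x.2.2 .p) * cY X .Eθ x - (cY X .r x * x.2.2 .ρ + x.2.2 .r * cY X .ρ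
    x) * (x.2.2 .Eθ * (σ (x.2.2 .ρ) (x.2.2 .p) * (x.2.2 .ρ)⁻¹) * (x.2.2 .r)⁻¹) + x.2.2 .r * x.2.2
    .ρ * (pd eS (cY X .Hz) x + x.2.2 .Ez * (σ (x.2.2 .ρ) (x.2.2 .p) * (x.2.2 .ρ)⁻¹) * (x.2.2 .r)⁻¹
    * pd (eY .Hθ) (cY X .Hz) x - x.2.2 .Eθ * (σ (x.2.2 .ρ) (x.2.2 .p) * (x.2.2 .ρ)⁻¹) * (x.2.2
    .r)⁻¹ * pd (eY .Hz) (cY X .Hz) x + x.2.2 .Eθ * (σ (x.2.2 .ρ) (x.2.2 .p) * (x.2.2 .ρ)⁻¹) *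
    (x.2.2 .r)⁻¹ * pd eS (cS X) x) = 0
  Hθ_p_eq : x.2.2 .Hθ * pd (eY .p) (cY X .r) x + x.2.2 .r * pd (eY .p) (cY X .Hθ) x = 0
  Hθ_ρ_eq : x.2.2 .Hθ * pd (eY .ρ) (cY X .r) x + x.2.2 .r * pd (eY .ρ) (cY X .Hθ) x = 0
  Hθ_u_eq : x.2.2 .Hθ * pd (eY .u) (cY X .r) x + x.2.2 .r * pd (eY .u) (cY X .Hθ) x = 0
  Hθ_θ_eq : x.2.2 .Hθ * pd (eY .θ) (cY X .r) x + x.2.2 .r * pd (eY .θ) (cY X .Hθ) x = 0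
  Hθ_v_eq : x.2.2 .Hθ * pd (eY .v) (cY X .r) x + x.2.2 .r * pd (eY .v) (cY X .Hθ) x = 0
  Hθ_rs_eq : x.2.2 .Hθ * pd (eY .r) (cY X .r) x + cY X .Hθ x - x.2.2 .Hθ * (x.2.2 .r)⁻¹ * cY X .r
    x + x.2.2 .r * (pd (eY .r) (cY X .Hθ) x - x.2.2 .Hθ * (x.2.2 .r)⁻¹ * pd (eY .Hθ) (cY X .Hθ) x)
    + (x.2.2 .r * (x.2.2 .r)⁻¹ - 1) * x.2.2 .Hθ * pd eS (cS X) x = 0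
  Ez_c_eq : (sρ σ (x.2.2 .ρ) (x.2.2 .p) * cY X .ρ x + sp σ (x.2.2 .ρ) (x.2.2 .p) * cY X .p x) *
    x.2.2 .Ez + σ (x.2.2 .ρ) (x.2.2 .p) * cY X .Ez x - cY X .ρ x * (x.2.2 .r * (x.2.2 .Ez * (σ
    (x.2.2 .ρ) (x.2.2 .p) * (x.2.2 .ρ)⁻¹) * (x.2.2 .r)⁻¹)) - x.2.2 .ρ * (x.2.2 .Hθ * pd eS (cY X
    .r) x + cY X .r x * (x.2.2 .Ez * (σ (x.2.2 .ρ) (x.2.2 .p) * (x.2.2 .ρ)⁻¹) * (x.2.2 .r)⁻¹) +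
    x.2.2 .r * (pd eS (cY X .Hθ) x + x.2.2 .Ez * (σ (x.2.2 .ρ) (x.2.2 .p) * (x.2.2 .ρ)⁻¹) * (x.2.2
    .r)⁻¹ * pd (eY .Hθ) (cY X .Hθ) x - x.2.2 .Eθ * (σ (x.2.2 .ρ) (x.2.2 .p) * (x.2.2 .ρ)⁻¹) *
    (x.2.2 .r)⁻¹ * pd (eY .Hz) (cY X .Hθ) x - x.2.2 .Ez * (σ (x.2.2 .ρ) (x.2.2 .p) * (x.2.2 .ρ)⁻¹)
    * (x.2.2 .r)⁻¹ * pd eS (cS X) x)) = 0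
  u_ρs_eq : x.2.2 .r * pd (eY .ρ) (cY X .p) x + x.2.2 .Hθ * (x.2.2 .Hθ * pd (eY .ρ) (cY X .r) x +
    x.2.2 .r * pd (eY .ρ) (cY X .Hθ) x) + x.2.2 .r * x.2.2 .Hz * pd (eY .ρ) (cY X .Hz) x = 0
  u_θs_eq : x.2.2 .r * pd (eY .θ) (cY X .p) x + x.2.2 .Hθ * (x.2.2 .Hθ * pd (eY .θ) (cY X .r) x +
    x.2.2 .r * pd (eY .θ) (cY X .Hθ) x) + x.2.2 .r * x.2.2 .Hz * pd (eY .θ) (cY X .Hz) x = 0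
  u_vs_eq : x.2.2 .r * pd (eY .v) (cY X .p) x + x.2.2 .Hθ * (x.2.2 .Hθ * pd (eY .v) (cY X .r) x +
    x.2.2 .r * pd (eY .v) (cY X .Hθ) x) + x.2.2 .r * x.2.2 .Hz * pd (eY .v) (cY X .Hz) x = 0
  u_rs_eq : -x.2.2 .ρ ^ 2 * x.2.2 .u * pd (eY .ρ) (cY X .u) x - γ * x.2.2 .ρ * x.2.2 .p * x.2.2 .u
    * pd (eY .p) (cY X .u) x - x.2.2 .ρ * (x.2.2 .Eθ + x.2.2 .Hz * x.2.2 .u) * pd (eY .Hz) (cY X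
    .u) x + x.2.2 .r * pd (eY .r) (cY X .p) x = 0
  u_ps_eq : -x.2.2 .r * pd (eY .u) (cY X .u) x + x.2.2 .r * pd eT (cT X) x + cY X .r x + x.2.2 .r
    * pd (eY .p) (cY X .p) x - x.2.2 .r * pd eS (cS X) x + x.2.2 .Hθ * (x.2.2 .Hθ * pd (eY .p) (cY
    X .r) x + x.2.2 .r * pd (eY .p) (cY X .Hθ) x) + x.2.2 .r * x.2.2 .Hz * pd (eY .p) (cY X .Hz) x
    = 0
  u_c_eq : pd eT (cY X .u) x + x.2.2 .u * pd (eY .r) (cY X .u) x + x.2.2 .v * (x.2.2 .r)⁻¹ * pd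
    (eY .θ) (cY X .u) x + (x.2.2 .v ^ 2 * (x.2.2 .r)⁻¹ - (x.2.2 .Hθ * x.2.2 .Ez - x.2.2 .Hz *
    x.2.2 .Eθ) * (σ (x.2.2 .ρ) (x.2.2 .p) * (x.2.2 .ρ)⁻¹)) * (pd (eY .u) (cY X .u) x - pd eT (cT
    X) x) - x.2.2 .u * x.2.2 .v * (x.2.2 .r)⁻¹ * pd (eY .v) (cY X .u) x + (γ - 1) * σ (x.2.2 .ρ)
    (x.2.2 .p) * (x.2.2 .Eθ ^ 2 + x.2.2 .Ez ^ 2) * pd (eY .p) (cY X .u) x - 2 * x.2.2 .v * cY X .v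
    x * (x.2.2 .r)⁻¹ + x.2.2 .v ^ 2 * cY X .r x * (x.2.2 .r)⁻¹ ^ 2 + x.2.2 .r * pd eS (cY X .p) x
    + cY X .Hθ x * (x.2.2 .r * (x.2.2 .Ez * (σ (x.2.2 .ρ) (x.2.2 .p) * (x.2.2 .ρ)⁻¹) * (x.2.2
    .r)⁻¹)) + x.2.2 .Hθ * (x.2.2 .Hθ * pd eS (cY X .r) x + cY X .r x * (x.2.2 .Ez * (σ (x.2.2 .ρ)
    (x.2.2 .p) * (x.2.2 .ρ)⁻¹) * (x.2.2 .r)⁻¹) + x.2.2 .r * (pd eS (cY X .Hθ) x + x.2.2 .Ez * (σ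
    (x.2.2 .ρ) (x.2.2 .p) * (x.2.2 .ρ)⁻¹) * (x.2.2 .r)⁻¹ * pd (eY .Hθ) (cY X .Hθ) x - x.2.2 .Eθ *
    (σ (x.2.2 .ρ) (x.2.2 .p) * (x.2.2 .ρ)⁻¹) * (x.2.2 .r)⁻¹ * pd (eY .Hz) (cY X .Hθ) x - x.2.2 .Ez
    * (σ (x.2.2 .ρ) (x.2.2 .p) * (x.2.2 .ρ)⁻¹) * (x.2.2 .r)⁻¹ * pd eS (cS X) x)) - (cY X .r x *
    x.2.2 .Hz + x.2.2 .r * cY X .Hz x) * (x.2.2 .Eθ * (σ (x.2.2 .ρ) (x.2.2 .p) * (x.2.2 .ρ)⁻¹) *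
    (x.2.2 .r)⁻¹) + x.2.2 .r * x.2.2 .Hz * (pd eS (cY X .Hz) x + x.2.2 .Ez * (σ (x.2.2 .ρ) (x.2.2
    .p) * (x.2.2 .ρ)⁻¹) * (x.2.2 .r)⁻¹ * pd (eY .Hθ) (cY X .Hz) x - x.2.2 .Eθ * (σ (x.2.2 .ρ)
    (x.2.2 .p) * (x.2.2 .ρ)⁻¹) * (x.2.2 .r)⁻¹ * pd (eY .Hz) (cY X .Hz) x + x.2.2 .Eθ * (σ (x.2.2
    .ρ) (x.2.2 .p) * (x.2.2 .ρ)⁻¹) * (x.2.2 .r)⁻¹ * pd eS (cS X) x) = 0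
  Hθ_us_eq : -x.2.2 .ρ * x.2.2 .r * pd (eY .ρ) (cY X .Hθ) x - γ * x.2.2 .p * x.2.2 .r * pd (eY .p)
    (cY X .Hθ) x - x.2.2 .r * x.2.2 .Hθ * pd (eY .Hθ) (cY X .Hθ) x - x.2.2 .r * x.2.2 .Hz * pd (eY
    .Hz) (cY X .Hθ) x + x.2.2 .r * x.2.2 .Hθ * pd eT (cT X) x + (cY X .r x + x.2.2 .r * (cY X .ρ x
    * (x.2.2 .ρ)⁻¹)) * x.2.2 .Hθ - x.2.2 .r * (pd (eY .u) (cY X .Ez) x - cY X .Hθ x - x.2.2 .Hθ *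
    (pd (eY .u) (cY X .u) x - pd eS (cS X) x)) = 0
  Hθ_gs_eq : x.2.2 .r * pd (eY .Hθ) (cY X .Hθ) x - x.2.2 .r * pd eT (cT X) x - (cY X .r x + x.2.2
    .r * (cY X .ρ x * (x.2.2 .ρ)⁻¹)) - x.2.2 .r * (pd (eY .Ez) (cY X .Ez) x - pd eS (cS X) x) = 0
  Hθ_fs_eq : pd (eY .Hz) (cY X .Hθ) x + pd (eY .Eθ) (cY X .Ez) x = 0
  Hz_us_eq : -x.2.2 .r * x.2.2 .Hθ * pd (eY .Hθ) (cY X .Hz) x - x.2.2 .r * x.2.2 .Hz * pd (eY .Hz)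
    (cY X .Hz) x + x.2.2 .r * x.2.2 .Hz * pd eT (cT X) x + cY X .ρ x * (x.2.2 .ρ)⁻¹ * x.2.2 .Hz *
    x.2.2 .r + (x.2.2 .r * pd (eY .u) (cY X .Eθ) x + cY X .Hz x * x.2.2 .r + x.2.2 .Hz * (cY X .r
    x + x.2.2 .r * pd (eY .u) (cY X .u) x - x.2.2 .r * pd eS (cS X) x)) = 0
  Hz_fs_eq : -x.2.2 .r * pd (eY .Hz) (cY X .Hz) x + x.2.2 .r * pd eT (cT X) x + cY X .ρ x * (x.2.2
    .ρ)⁻¹ * x.2.2 .r + (cY X .r x + x.2.2 .r * pd (eY .Eθ) (cY X .Eθ) x - x.2.2 .r * pd eS (cS X)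
    x) = 0
  Hz_gs_eq : pd (eY .Hθ) (cY X .Hz) x + pd (eY .Ez) (cY X .Eθ) x = 0

set_option maxHeartbeats 4000000 in
theorem Admitted.determining {γ : ℝ} {σ : ℝ → ℝ → ℝ} (hσ : SmoothOnQuadrant σ)
    {X : Phase → Phase} (hX : Admitted γ σ X) {x : Phase} (hx : x ∈ region) :
    Determining γ σ X x := by
  obtain ⟨⟨τs, τY⟩, ⟨ξt, ξY⟩, hE⟩ := hX.projectable hσ hx
  have hr := (region_r_pos hx).ne'
  have hρ := (region_ρ_pos hx).ne'
  have hrρ := mul_ne_zero hr hρ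
  -- In the identities below `r⁻¹` and `ρ⁻¹` are independent indeterminates for `ring`; `hw` and
  -- `hρw` are the only relations that tie them to `r` and `ρ`.
  have hw := mul_inv_cancel₀ hr
  have hρw := mul_inv_cancel₀ hρ
  have cancel : ∀ {c e : ℝ}, c ≠ 0 → c * e = 0 → e = 0 := fun h h' =>
    (mul_eq_zero.1 h').resolve_left h
  have L := hX.linearized_cY_eq_zero hσ hx
  have L0 := fun a b rs θs us vs ρs ps fs gs => L a b rs θs us vs ρs ps fs gs 0
  have L1 := fun a b rs θs us vs ρs ps fs gs => L a b rs θs us vs ρs ps fs gs 1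
  have L2 := fun a b rs θs us vs ρs ps fs gs => L a b rs θs us vs ρs ps fs gs 2
  have L3 := fun a b rs θs us vs ρs ps fs gs => L a b rs θs us vs ρs ps fs gs 3
  have L4 := fun a b rs θs us vs ρs ps fs gs => L a b rs θs us vs ρs ps fs gs 4
  have L5 := fun a b rs θs us vs ρs ps fs gs => L a b rs θs us vs ρs ps fs gs 5
  have L6 := fun a b rs θs us vs ρs ps fs gs => L a b rs θs us vs ρs ps fs gs 6
  have L7 := fun a b rs θs us vs ρs ps fs gs => L a b rs θs us vs ρs ps fs gs 7
  have L8 := fun a b rs θs us vs ρs ps fs gs => L a b rs θs us vs ρs ps fs gs 8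
  have L9 := fun a b rs θs us vs ρs ps fs gs => L a b rs θs us vs ρs ps fs gs 9
  clear L
  simp only [linearized, Matrix.cons_val, fderiv_apply_eq, solutionJet, zero_mul, zero_add,
    one_mul, τs, τY, ξt, ξY, mul_zero, add_zero, sub_zero] at L0 L1 L2 L3 L4 L5 L6 L7 L8 L9
  obtain ⟨r_f, r_g⟩ := hE .r (by decide) (by decide)
  obtain ⟨θ_f, θ_g⟩ := hE .θ (by decide) (by decide)
  obtain ⟨u_f, u_g⟩ := hE .u (by decide) (by decide)
  obtain ⟨v_f, v_g⟩ := hE .v (by decide) (by decide)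
  obtain ⟨ρ_f, ρ_g⟩ := hE .ρ (by decide) (by decide)
  obtain ⟨p_f, p_g⟩ := hE .p (by decide) (by decide)
  obtain ⟨Hθ_f, Hθ_g⟩ := hE .Hθ (by decide) (by decide)
  obtain ⟨Hz_f, Hz_g⟩ := hE .Hz (by decide) (by decide)
  simp only [r_f, r_g, θ_f, θ_g, u_f, u_g, v_f, v_g, ρ_f, ρ_g, p_f, p_g, Hθ_f, Hθ_g, Hz_f,
    Hz_g, mul_zero, add_zero] at L0 L1 L2 L3 L4 L5 L6 L7 L8 L9
  -- With `ξ^t = ξ^t(t)` and `ξ^s = ξ^s(s)` the equations are affine in the free derivatives: a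
  -- first difference gives the coefficient of one of them, the value at 0 the free term.
  have r_u : pd (eY .u) (cY X .r) x = 0 := by
    refine cancel (c := -x.2.2 .r) (neg_ne_zero.2 hr) ?_
    linear_combination (L2 0 0 0 0 0 0 0 1 0 0 - L2 0 0 0 0 0 0 0 0 0 0)
  have r_Hθ : pd (eY .Hθ) (cY X .r) x = 0 := by
    refine cancel (c := (x.2.2 .r * x.2.2 .ρ)) hrρ ?_
    linear_combination (L2 0 0 0 0 0 0 0 0 0 1 - L2 0 0 0 0 0 0 0 0 0 0)
  have r_Hz : pd (eY .Hz) (cY X .r) x = 0 := by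
    refine cancel (c := -(x.2.2 .r * x.2.2 .ρ)) (neg_ne_zero.2 hrρ) ?_
    linear_combination (L2 0 0 0 0 0 0 0 0 1 0 - L2 0 0 0 0 0 0 0 0 0 0)
  have r_us : x.2.2 .ρ * pd (eY .ρ) (cY X .r) x + γ * x.2.2 .p * pd (eY .p) (cY X .r) x = 0 := by
    refine cancel (c := -(x.2.2 .r * x.2.2 .ρ)) (neg_ne_zero.2 hrρ) ?_
    linear_combination (L2 0 0 0 0 1 0 0 0 0 0 - L2 0 0 0 0 0 0 0 0 0 0) - (- x.2.2 .r*x.2.2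
      .ρ*(x.2.2 .Hθ*r_Hθ + x.2.2 .Hz*r_Hz))
  have r_c : pd eT (cY X .r) x + x.2.2 .u * pd (eY .r) (cY X .r) x + x.2.2 .v * (x.2.2 .r)⁻¹ * pd
    (eY .θ) (cY X .r) x - x.2.2 .u * x.2.2 .v * (x.2.2 .r)⁻¹ * pd (eY .v) (cY X .r) x + (γ - 1) *
    σ (x.2.2 .ρ) (x.2.2 .p) * (x.2.2 .Eθ ^ 2 + x.2.2 .Ez ^ 2) * pd (eY .p) (cY X .r) x - x.2.2 .u
    * pd eT (cT X) x - cY X .u x = 0 := by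
    linear_combination L2 0 0 0 0 0 0 0 0 0 0 - ((x.2.2 .v ^ 2 * (x.2.2 .r)⁻¹ - (x.2.2 .Hθ * x.2.2
      .Ez - x.2.2 .Hz * x.2.2 .Eθ) * (σ (x.2.2 .ρ) (x.2.2 .p) * (x.2.2 .ρ)⁻¹)) * r_u)
  have θ_u : pd (eY .u) (cY X .θ) x = 0 := by
    refine cancel (c := -x.2.2 .r) (neg_ne_zero.2 hr) ?_
    linear_combination (L4 0 0 0 0 0 0 0 1 0 0 - L4 0 0 0 0 0 0 0 0 0 0)
  have θ_Hθ : pd (eY .Hθ) (cY X .θ) x = 0 := by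
    refine cancel (c := (x.2.2 .r * x.2.2 .ρ)) hrρ ?_
    linear_combination (L4 0 0 0 0 0 0 0 0 0 1 - L4 0 0 0 0 0 0 0 0 0 0)
  have θ_Hz : pd (eY .Hz) (cY X .θ) x = 0 := by
    refine cancel (c := -(x.2.2 .r * x.2.2 .ρ)) (neg_ne_zero.2 hrρ) ?_
    linear_combination (L4 0 0 0 0 0 0 0 0 1 0 - L4 0 0 0 0 0 0 0 0 0 0)
  have θ_us : x.2.2 .ρ * pd (eY .ρ) (cY X .θ) x + γ * x.2.2 .p * pd (eY .p) (cY X .θ) x = 0 := by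
    refine cancel (c := -(x.2.2 .r * x.2.2 .ρ)) (neg_ne_zero.2 hrρ) ?_
    linear_combination (L4 0 0 0 0 1 0 0 0 0 0 - L4 0 0 0 0 0 0 0 0 0 0) - (- x.2.2 .r*x.2.2
      .ρ*(x.2.2 .Hθ*θ_Hθ + x.2.2 .Hz*θ_Hz))
  have θ_c : pd eT (cY X .θ) x + x.2.2 .u * pd (eY .r) (cY X .θ) x + x.2.2 .v * (x.2.2 .r)⁻¹ * pd
    (eY .θ) (cY X .θ) x - x.2.2 .u * x.2.2 .v * (x.2.2 .r)⁻¹ * pd (eY .v) (cY X .θ) x + (γ - 1) *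
    σ (x.2.2 .ρ) (x.2.2 .p) * (x.2.2 .Eθ ^ 2 + x.2.2 .Ez ^ 2) * pd (eY .p) (cY X .θ) x - x.2.2 .v
    * (x.2.2 .r)⁻¹ * pd eT (cT X) x - cY X .v x * (x.2.2 .r)⁻¹ + x.2.2 .v * cY X .r x * (x.2.2
    .r)⁻¹ ^ 2 = 0 := by
    linear_combination L4 0 0 0 0 0 0 0 0 0 0 - ((x.2.2 .v ^ 2 * (x.2.2 .r)⁻¹ - (x.2.2 .Hθ * x.2.2
      .Ez - x.2.2 .Hz * x.2.2 .Eθ) * (σ (x.2.2 .ρ) (x.2.2 .p) * (x.2.2 .ρ)⁻¹)) * θ_u)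
  have v_u : pd (eY .u) (cY X .v) x = 0 := by
    refine cancel (c := -x.2.2 .r) (neg_ne_zero.2 hr) ?_
    linear_combination (L3 0 0 0 0 0 0 0 1 0 0 - L3 0 0 0 0 0 0 0 0 0 0)
  have v_Hθ : pd (eY .Hθ) (cY X .v) x = 0 := by
    refine cancel (c := (x.2.2 .r * x.2.2 .ρ)) hrρ ?_
    linear_combination (L3 0 0 0 0 0 0 0 0 0 1 - L3 0 0 0 0 0 0 0 0 0 0)
  have v_Hz : pd (eY .Hz) (cY X .v) x = 0 := by
    refine cancel (c := -(x.2.2 .r * x.2.2 .ρ)) (neg_ne_zero.2 hrρ) ?_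
    linear_combination (L3 0 0 0 0 0 0 0 0 1 0 - L3 0 0 0 0 0 0 0 0 0 0)
  have v_us : x.2.2 .ρ * pd (eY .ρ) (cY X .v) x + γ * x.2.2 .p * pd (eY .p) (cY X .v) x = 0 := by
    refine cancel (c := -(x.2.2 .r * x.2.2 .ρ)) (neg_ne_zero.2 hrρ) ?_
    linear_combination (L3 0 0 0 0 1 0 0 0 0 0 - L3 0 0 0 0 0 0 0 0 0 0) - (- x.2.2 .r*x.2.2
      .ρ*(x.2.2 .Hθ*v_Hθ + x.2.2 .Hz*v_Hz))
  have v_c : pd eT (cY X .v) x + x.2.2 .u * pd (eY .r) (cY X .v) x + x.2.2 .v * (x.2.2 .r)⁻¹ * pd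
    (eY .θ) (cY X .v) x - x.2.2 .u * x.2.2 .v * (x.2.2 .r)⁻¹ * pd (eY .v) (cY X .v) x + (γ - 1) *
    σ (x.2.2 .ρ) (x.2.2 .p) * (x.2.2 .Eθ ^ 2 + x.2.2 .Ez ^ 2) * pd (eY .p) (cY X .v) x + x.2.2 .u
    * x.2.2 .v * (x.2.2 .r)⁻¹ * pd eT (cT X) x + (cY X .u x * x.2.2 .v + x.2.2 .u * cY X .v x) *
    (x.2.2 .r)⁻¹ - x.2.2 .u * x.2.2 .v * cY X .r x * (x.2.2 .r)⁻¹ ^ 2 = 0 := by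
    linear_combination L3 0 0 0 0 0 0 0 0 0 0 - ((x.2.2 .v ^ 2 * (x.2.2 .r)⁻¹ - (x.2.2 .Hθ * x.2.2
      .Ez - x.2.2 .Hz * x.2.2 .Eθ) * (σ (x.2.2 .ρ) (x.2.2 .p) * (x.2.2 .ρ)⁻¹)) * v_u)
  have ρ_ps : -x.2.2 .r * pd (eY .u) (cY X .ρ) x + x.2.2 .ρ ^ 2 * (x.2.2 .u * pd (eY .p) (cY X .r)
    x + x.2.2 .r * pd (eY .p) (cY X .u) x) = 0 := by
    linear_combination (L0 0 0 0 0 0 0 0 1 0 0 - L0 0 0 0 0 0 0 0 0 0 0)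
  have ρ_Hθ : pd (eY .Hθ) (cY X .ρ) x = 0 := by
    refine cancel (c := (x.2.2 .r * x.2.2 .ρ)) hrρ ?_
    linear_combination (L0 0 0 0 0 0 0 0 0 0 1 - L0 0 0 0 0 0 0 0 0 0 0)
  have ρ_Hz : pd (eY .Hz) (cY X .ρ) x = 0 := by
    refine cancel (c := -(x.2.2 .r * x.2.2 .ρ)) (neg_ne_zero.2 hrρ) ?_
    linear_combination (L0 0 0 0 0 0 0 0 0 1 0 - L0 0 0 0 0 0 0 0 0 0 0)
  have ρ_θs : x.2.2 .u * pd (eY .θ) (cY X .r) x + x.2.2 .r * pd (eY .θ) (cY X .u) x = 0 := by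
    refine cancel (c := x.2.2 .ρ ^ 2) (pow_ne_zero 2 hρ) ?_
    linear_combination (L0 0 0 0 1 0 0 0 0 0 0 - L0 0 0 0 0 0 0 0 0 0 0)
  have ρ_vs : x.2.2 .u * pd (eY .v) (cY X .r) x + x.2.2 .r * pd (eY .v) (cY X .u) x = 0 := by
    refine cancel (c := x.2.2 .ρ ^ 2) (pow_ne_zero 2 hρ) ?_
    linear_combination (L0 0 0 0 0 0 1 0 0 0 0 - L0 0 0 0 0 0 0 0 0 0 0)
  have ρ_rs : -x.2.2 .ρ * x.2.2 .u * pd (eY .ρ) (cY X .ρ) x - γ * x.2.2 .p * x.2.2 .u * pd (eY .p)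
    (cY X .ρ) x + x.2.2 .ρ * x.2.2 .u * pd eT (cT X) x + 2 * x.2.2 .u * cY X .ρ x + x.2.2 .ρ *
    (x.2.2 .u * pd (eY .r) (cY X .r) x - x.2.2 .u * pd eS (cS X) x + cY X .u x + x.2.2 .r * pd (eY
    .r) (cY X .u) x - x.2.2 .r * (x.2.2 .r)⁻¹ * x.2.2 .Hθ * pd (eY .Hθ) (cY X .u) x) = 0 := by
    refine cancel (c := x.2.2 .ρ) hρ ?_
    linear_combination (L0 0 0 1 0 0 0 0 0 0 0 - L0 0 0 0 0 0 0 0 0 0 0) - (- x.2.2 .ρ*(x.2.2 .Eθ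
      + x.2.2 .Hz*x.2.2 .u)*ρ_Hz - x.2.2 .ρ^2*x.2.2 .u*(x.2.2 .r)⁻¹*x.2.2 .Hθ*r_Hθ)
  have ρ_c : pd eT (cY X .ρ) x + x.2.2 .u * pd (eY .r) (cY X .ρ) x + x.2.2 .v * (x.2.2 .r)⁻¹ * pd
    (eY .θ) (cY X .ρ) x + (x.2.2 .v ^ 2 * (x.2.2 .r)⁻¹ - (x.2.2 .Hθ * x.2.2 .Ez - x.2.2 .Hz *
    x.2.2 .Eθ) * (σ (x.2.2 .ρ) (x.2.2 .p) * (x.2.2 .ρ)⁻¹)) * pd (eY .u) (cY X .ρ) x - x.2.2 .u *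
    x.2.2 .v * (x.2.2 .r)⁻¹ * pd (eY .v) (cY X .ρ) x + (γ - 1) * σ (x.2.2 .ρ) (x.2.2 .p) * (x.2.2
    .Eθ ^ 2 + x.2.2 .Ez ^ 2) * pd (eY .p) (cY X .ρ) x + x.2.2 .ρ ^ 2 * (x.2.2 .u * pd eS (cY X .r)
    x + x.2.2 .r * (pd eS (cY X .u) x + x.2.2 .Ez * (σ (x.2.2 .ρ) (x.2.2 .p) * (x.2.2 .ρ)⁻¹) *
    (x.2.2 .r)⁻¹ * pd (eY .Hθ) (cY X .u) x - x.2.2 .Eθ * (σ (x.2.2 .ρ) (x.2.2 .p) * (x.2.2 .ρ)⁻¹)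
    * (x.2.2 .r)⁻¹ * pd (eY .Hz) (cY X .u) x)) = 0 := by
    linear_combination L0 0 0 0 0 0 0 0 0 0 0 - (x.2.2 .ρ^2*x.2.2 .u*(σ (x.2.2 .ρ) (x.2.2 .p) *
      (x.2.2 .ρ)⁻¹)*(x.2.2 .r)⁻¹*(x.2.2 .Ez*r_Hθ - x.2.2 .Eθ*r_Hz))
  have p_ps : -x.2.2 .r * pd (eY .u) (cY X .p) x + γ * x.2.2 .ρ * x.2.2 .p * (x.2.2 .u * pd (eY
    .p) (cY X .r) x + x.2.2 .r * pd (eY .p) (cY X .u) x) = 0 := by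
    linear_combination (L5 0 0 0 0 0 0 0 1 0 0 - L5 0 0 0 0 0 0 0 0 0 0)
  have p_Hθ : pd (eY .Hθ) (cY X .p) x = 0 := by
    refine cancel (c := (x.2.2 .r * x.2.2 .ρ)) hrρ ?_
    linear_combination (L5 0 0 0 0 0 0 0 0 0 1 - L5 0 0 0 0 0 0 0 0 0 0)
  have p_Hz : pd (eY .Hz) (cY X .p) x = 0 := by
    refine cancel (c := -(x.2.2 .r * x.2.2 .ρ)) (neg_ne_zero.2 hrρ) ?_
    linear_combination (L5 0 0 0 0 0 0 0 0 1 0 - L5 0 0 0 0 0 0 0 0 0 0)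
  have p_us : -x.2.2 .ρ * x.2.2 .r * pd (eY .ρ) (cY X .p) x - γ * x.2.2 .p * x.2.2 .r * pd (eY .p)
    (cY X .p) x + γ * x.2.2 .p * x.2.2 .r * pd eT (cT X) x + γ * (cY X .ρ x * x.2.2 .p * (x.2.2
    .ρ)⁻¹ + cY X .p x) * x.2.2 .r + γ * x.2.2 .p * (cY X .r x + x.2.2 .r * pd (eY .u) (cY X .u) x
    - x.2.2 .r * pd eS (cS X) x) = 0 := by
    refine cancel (c := x.2.2 .ρ) hρ ?_
    linear_combination (L5 0 0 0 0 1 0 0 0 0 0 - L5 0 0 0 0 0 0 0 0 0 0) - (- x.2.2 .r*x.2.2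
      .ρ*(x.2.2 .Hθ*p_Hθ + x.2.2 .Hz*p_Hz) + γ*x.2.2 .ρ*x.2.2 .p*x.2.2 .u*r_u - γ*cY X .ρ x*x.2.2
      .p*x.2.2 .r*hρw)
  have p_c : pd eT (cY X .p) x + x.2.2 .u * pd (eY .r) (cY X .p) x + x.2.2 .v * (x.2.2 .r)⁻¹ * pd
    (eY .θ) (cY X .p) x + (x.2.2 .v ^ 2 * (x.2.2 .r)⁻¹ - (x.2.2 .Hθ * x.2.2 .Ez - x.2.2 .Hz *
    x.2.2 .Eθ) * (σ (x.2.2 .ρ) (x.2.2 .p) * (x.2.2 .ρ)⁻¹)) * pd (eY .u) (cY X .p) x - x.2.2 .u *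
    x.2.2 .v * (x.2.2 .r)⁻¹ * pd (eY .v) (cY X .p) x + (γ - 1) * σ (x.2.2 .ρ) (x.2.2 .p) * (x.2.2
    .Eθ ^ 2 + x.2.2 .Ez ^ 2) * (pd (eY .p) (cY X .p) x - pd eT (cT X) x) + γ * x.2.2 .ρ * x.2.2 .p
    * (x.2.2 .u * pd eS (cY X .r) x + x.2.2 .r * (pd eS (cY X .u) x + x.2.2 .Ez * (σ (x.2.2 .ρ)
    (x.2.2 .p) * (x.2.2 .ρ)⁻¹) * (x.2.2 .r)⁻¹ * pd (eY .Hθ) (cY X .u) x - x.2.2 .Eθ * (σ (x.2.2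
    .ρ) (x.2.2 .p) * (x.2.2 .ρ)⁻¹) * (x.2.2 .r)⁻¹ * pd (eY .Hz) (cY X .u) x)) - (γ - 1) * ((sρ σ
    (x.2.2 .ρ) (x.2.2 .p) * cY X .ρ x + sp σ (x.2.2 .ρ) (x.2.2 .p) * cY X .p x) * (x.2.2 .Eθ ^ 2 +
    x.2.2 .Ez ^ 2) + 2 * σ (x.2.2 .ρ) (x.2.2 .p) * (x.2.2 .Eθ * cY X .Eθ x + x.2.2 .Ez * cY X .Ez
    x)) = 0 := by
    linear_combination L5 0 0 0 0 0 0 0 0 0 0 - (γ*x.2.2 .ρ*x.2.2 .p*x.2.2 .u*(σ (x.2.2 .ρ) (x.2.2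
      .p) * (x.2.2 .ρ)⁻¹)*(x.2.2 .r)⁻¹*(x.2.2 .Ez*r_Hθ - x.2.2 .Eθ*r_Hz))
  have Hz_p : pd (eY .p) (cY X .Hz) x = 0 := by
    refine cancel (c := (x.2.2 .r * x.2.2 .ρ)) hrρ ?_
    linear_combination (L8 0 0 0 0 0 0 0 1 0 0 - L8 0 0 0 0 0 0 0 0 0 0)
  have Hz_ρ : pd (eY .ρ) (cY X .Hz) x = 0 := by
    refine cancel (c := (x.2.2 .r * x.2.2 .ρ)) hrρ ?_
    linear_combination (L8 0 0 0 0 0 0 1 0 0 0 - L8 0 0 0 0 0 0 0 0 0 0)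
  have Hz_θ : pd (eY .θ) (cY X .Hz) x = 0 := by
    refine cancel (c := (x.2.2 .r * x.2.2 .ρ)) hrρ ?_
    linear_combination (L8 0 0 0 1 0 0 0 0 0 0 - L8 0 0 0 0 0 0 0 0 0 0)
  have Hz_v : pd (eY .v) (cY X .Hz) x = 0 := by
    refine cancel (c := (x.2.2 .r * x.2.2 .ρ)) hrρ ?_
    linear_combination (L8 0 0 0 0 0 1 0 0 0 0 - L8 0 0 0 0 0 0 0 0 0 0)
  have Hz_rs : pd (eY .r) (cY X .Hz) x - x.2.2 .Hθ * (x.2.2 .r)⁻¹ * pd (eY .Hθ) (cY X .Hz) x = 0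
    := by
    refine cancel (c := (x.2.2 .r * x.2.2 .ρ)) hrρ ?_
    linear_combination (L8 0 0 1 0 0 0 0 0 0 0 - L8 0 0 0 0 0 0 0 0 0 0)
  have Eθ_c : (sρ σ (x.2.2 .ρ) (x.2.2 .p) * cY X .ρ x + sp σ (x.2.2 .ρ) (x.2.2 .p) * cY X .p x) *
    x.2.2 .Eθ + σ (x.2.2 .ρ) (x.2.2 .p) * cY X .Eθ x - (cY X .r x * x.2.2 .ρ + x.2.2 .r * cY X .ρ
    x) * (x.2.2 .Eθ * (σ (x.2.2 .ρ) (x.2.2 .p) * (x.2.2 .ρ)⁻¹) * (x.2.2 .r)⁻¹) + x.2.2 .r * x.2.2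
    .ρ * (pd eS (cY X .Hz) x + x.2.2 .Ez * (σ (x.2.2 .ρ) (x.2.2 .p) * (x.2.2 .ρ)⁻¹) * (x.2.2 .r)⁻¹
    * pd (eY .Hθ) (cY X .Hz) x - x.2.2 .Eθ * (σ (x.2.2 .ρ) (x.2.2 .p) * (x.2.2 .ρ)⁻¹) * (x.2.2
    .r)⁻¹ * pd (eY .Hz) (cY X .Hz) x + x.2.2 .Eθ * (σ (x.2.2 .ρ) (x.2.2 .p) * (x.2.2 .ρ)⁻¹) *
    (x.2.2 .r)⁻¹ * pd eS (cS X) x) = 0 := by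
    linear_combination L8 0 0 0 0 0 0 0 0 0 0
  have Hθ_p : x.2.2 .Hθ * pd (eY .p) (cY X .r) x + x.2.2 .r * pd (eY .p) (cY X .Hθ) x = 0 := by
    refine cancel (c := -x.2.2 .ρ) (neg_ne_zero.2 hρ) ?_
    linear_combination (L9 0 0 0 0 0 0 0 1 0 0 - L9 0 0 0 0 0 0 0 0 0 0)
  have Hθ_ρ : x.2.2 .Hθ * pd (eY .ρ) (cY X .r) x + x.2.2 .r * pd (eY .ρ) (cY X .Hθ) x = 0 := by
    refine cancel (c := -x.2.2 .ρ) (neg_ne_zero.2 hρ) ?_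
    linear_combination (L9 0 0 0 0 0 0 1 0 0 0 - L9 0 0 0 0 0 0 0 0 0 0)
  have Hθ_u : x.2.2 .Hθ * pd (eY .u) (cY X .r) x + x.2.2 .r * pd (eY .u) (cY X .Hθ) x = 0 := by
    refine cancel (c := -x.2.2 .ρ) (neg_ne_zero.2 hρ) ?_
    linear_combination (L9 0 0 0 0 1 0 0 0 0 0 - L9 0 0 0 0 0 0 0 0 0 0)
  have Hθ_θ : x.2.2 .Hθ * pd (eY .θ) (cY X .r) x + x.2.2 .r * pd (eY .θ) (cY X .Hθ) x = 0 := by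
    refine cancel (c := -x.2.2 .ρ) (neg_ne_zero.2 hρ) ?_
    linear_combination (L9 0 0 0 1 0 0 0 0 0 0 - L9 0 0 0 0 0 0 0 0 0 0)
  have Hθ_v : x.2.2 .Hθ * pd (eY .v) (cY X .r) x + x.2.2 .r * pd (eY .v) (cY X .Hθ) x = 0 := by
    refine cancel (c := -x.2.2 .ρ) (neg_ne_zero.2 hρ) ?_
    linear_combination (L9 0 0 0 0 0 1 0 0 0 0 - L9 0 0 0 0 0 0 0 0 0 0)
  have Hθ_rs : x.2.2 .Hθ * pd (eY .r) (cY X .r) x + cY X .Hθ x - x.2.2 .Hθ * (x.2.2 .r)⁻¹ * cY X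
    .r x + x.2.2 .r * (pd (eY .r) (cY X .Hθ) x - x.2.2 .Hθ * (x.2.2 .r)⁻¹ * pd (eY .Hθ) (cY X .Hθ)
    x) + (x.2.2 .r * (x.2.2 .r)⁻¹ - 1) * x.2.2 .Hθ * pd eS (cS X) x = 0 := by
    refine cancel (c := -x.2.2 .ρ) (neg_ne_zero.2 hρ) ?_
    linear_combination (L9 0 0 1 0 0 0 0 0 0 0 - L9 0 0 0 0 0 0 0 0 0 0) - (cY X .ρ x*x.2.2 .Hθ*hw
      + x.2.2 .ρ*x.2.2 .Hθ^2*(x.2.2 .r)⁻¹*r_Hθ)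
  have Ez_c : (sρ σ (x.2.2 .ρ) (x.2.2 .p) * cY X .ρ x + sp σ (x.2.2 .ρ) (x.2.2 .p) * cY X .p x) *
    x.2.2 .Ez + σ (x.2.2 .ρ) (x.2.2 .p) * cY X .Ez x - cY X .ρ x * (x.2.2 .r * (x.2.2 .Ez * (σ
    (x.2.2 .ρ) (x.2.2 .p) * (x.2.2 .ρ)⁻¹) * (x.2.2 .r)⁻¹)) - x.2.2 .ρ * (x.2.2 .Hθ * pd eS (cY X
    .r) x + cY X .r x * (x.2.2 .Ez * (σ (x.2.2 .ρ) (x.2.2 .p) * (x.2.2 .ρ)⁻¹) * (x.2.2 .r)⁻¹) +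
    x.2.2 .r * (pd eS (cY X .Hθ) x + x.2.2 .Ez * (σ (x.2.2 .ρ) (x.2.2 .p) * (x.2.2 .ρ)⁻¹) * (x.2.2
    .r)⁻¹ * pd (eY .Hθ) (cY X .Hθ) x - x.2.2 .Eθ * (σ (x.2.2 .ρ) (x.2.2 .p) * (x.2.2 .ρ)⁻¹) *
    (x.2.2 .r)⁻¹ * pd (eY .Hz) (cY X .Hθ) x - x.2.2 .Ez * (σ (x.2.2 .ρ) (x.2.2 .p) * (x.2.2 .ρ)⁻¹)
    * (x.2.2 .r)⁻¹ * pd eS (cS X) x)) = 0 := by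
    linear_combination L9 0 0 0 0 0 0 0 0 0 0 - (-x.2.2 .ρ*x.2.2 .Hθ*(σ (x.2.2 .ρ) (x.2.2 .p) *
      (x.2.2 .ρ)⁻¹)*(x.2.2 .r)⁻¹*(x.2.2 .Ez*r_Hθ - x.2.2 .Eθ*r_Hz))
  have u_ρs : x.2.2 .r * pd (eY .ρ) (cY X .p) x + x.2.2 .Hθ * (x.2.2 .Hθ * pd (eY .ρ) (cY X .r) x
    + x.2.2 .r * pd (eY .ρ) (cY X .Hθ) x) + x.2.2 .r * x.2.2 .Hz * pd (eY .ρ) (cY X .Hz) x = 0 :=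
    by
    linear_combination (L1 0 0 0 0 0 0 1 0 0 0 - L1 0 0 0 0 0 0 0 0 0 0)
  have u_θs : x.2.2 .r * pd (eY .θ) (cY X .p) x + x.2.2 .Hθ * (x.2.2 .Hθ * pd (eY .θ) (cY X .r) x
    + x.2.2 .r * pd (eY .θ) (cY X .Hθ) x) + x.2.2 .r * x.2.2 .Hz * pd (eY .θ) (cY X .Hz) x = 0 :=
    by
    linear_combination (L1 0 0 0 1 0 0 0 0 0 0 - L1 0 0 0 0 0 0 0 0 0 0)
  have u_vs : x.2.2 .r * pd (eY .v) (cY X .p) x + x.2.2 .Hθ * (x.2.2 .Hθ * pd (eY .v) (cY X .r) x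
    + x.2.2 .r * pd (eY .v) (cY X .Hθ) x) + x.2.2 .r * x.2.2 .Hz * pd (eY .v) (cY X .Hz) x = 0 :=
    by
    linear_combination (L1 0 0 0 0 0 1 0 0 0 0 - L1 0 0 0 0 0 0 0 0 0 0)
  have u_rs : -x.2.2 .ρ ^ 2 * x.2.2 .u * pd (eY .ρ) (cY X .u) x - γ * x.2.2 .ρ * x.2.2 .p * x.2.2
    .u * pd (eY .p) (cY X .u) x - x.2.2 .ρ * (x.2.2 .Eθ + x.2.2 .Hz * x.2.2 .u) * pd (eY .Hz) (cY
    X .u) x + x.2.2 .r * pd (eY .r) (cY X .p) x = 0 := by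
    linear_combination (L1 0 0 1 0 0 0 0 0 0 0 - L1 0 0 0 0 0 0 0 0 0 0) - (-cY X .Hθ x*x.2.2
      .Hθ*hw - x.2.2 .r*x.2.2 .Hθ*(x.2.2 .r)⁻¹*p_Hθ + x.2.2 .Hθ*(Hθ_rs) - x.2.2 .Hθ^3*(x.2.2
      .r)⁻¹*r_Hθ + x.2.2 .r*x.2.2 .Hz*Hz_rs)
  have u_ps : -x.2.2 .r * pd (eY .u) (cY X .u) x + x.2.2 .r * pd eT (cT X) x + cY X .r x + x.2.2
    .r * pd (eY .p) (cY X .p) x - x.2.2 .r * pd eS (cS X) x + x.2.2 .Hθ * (x.2.2 .Hθ * pd (eY .p)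
    (cY X .r) x + x.2.2 .r * pd (eY .p) (cY X .Hθ) x) + x.2.2 .r * x.2.2 .Hz * pd (eY .p) (cY X
    .Hz) x = 0 := by
    linear_combination (L1 0 0 0 0 0 0 0 1 0 0 - L1 0 0 0 0 0 0 0 0 0 0)
  have u_c : pd eT (cY X .u) x + x.2.2 .u * pd (eY .r) (cY X .u) x + x.2.2 .v * (x.2.2 .r)⁻¹ * pd
    (eY .θ) (cY X .u) x + (x.2.2 .v ^ 2 * (x.2.2 .r)⁻¹ - (x.2.2 .Hθ * x.2.2 .Ez - x.2.2 .Hz *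
    x.2.2 .Eθ) * (σ (x.2.2 .ρ) (x.2.2 .p) * (x.2.2 .ρ)⁻¹)) * (pd (eY .u) (cY X .u) x - pd eT (cT
    X) x) - x.2.2 .u * x.2.2 .v * (x.2.2 .r)⁻¹ * pd (eY .v) (cY X .u) x + (γ - 1) * σ (x.2.2 .ρ)
    (x.2.2 .p) * (x.2.2 .Eθ ^ 2 + x.2.2 .Ez ^ 2) * pd (eY .p) (cY X .u) x - 2 * x.2.2 .v * cY X .v
    x * (x.2.2 .r)⁻¹ + x.2.2 .v ^ 2 * cY X .r x * (x.2.2 .r)⁻¹ ^ 2 + x.2.2 .r * pd eS (cY X .p) x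
    + cY X .Hθ x * (x.2.2 .r * (x.2.2 .Ez * (σ (x.2.2 .ρ) (x.2.2 .p) * (x.2.2 .ρ)⁻¹) * (x.2.2
    .r)⁻¹)) + x.2.2 .Hθ * (x.2.2 .Hθ * pd eS (cY X .r) x + cY X .r x * (x.2.2 .Ez * (σ (x.2.2 .ρ)
    (x.2.2 .p) * (x.2.2 .ρ)⁻¹) * (x.2.2 .r)⁻¹) + x.2.2 .r * (pd eS (cY X .Hθ) x + x.2.2 .Ez * (σ
    (x.2.2 .ρ) (x.2.2 .p) * (x.2.2 .ρ)⁻¹) * (x.2.2 .r)⁻¹ * pd (eY .Hθ) (cY X .Hθ) x - x.2.2 .Eθ *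
    (σ (x.2.2 .ρ) (x.2.2 .p) * (x.2.2 .ρ)⁻¹) * (x.2.2 .r)⁻¹ * pd (eY .Hz) (cY X .Hθ) x - x.2.2 .Ez
    * (σ (x.2.2 .ρ) (x.2.2 .p) * (x.2.2 .ρ)⁻¹) * (x.2.2 .r)⁻¹ * pd eS (cS X) x)) - (cY X .r x *
    x.2.2 .Hz + x.2.2 .r * cY X .Hz x) * (x.2.2 .Eθ * (σ (x.2.2 .ρ) (x.2.2 .p) * (x.2.2 .ρ)⁻¹) *
    (x.2.2 .r)⁻¹) + x.2.2 .r * x.2.2 .Hz * (pd eS (cY X .Hz) x + x.2.2 .Ez * (σ (x.2.2 .ρ) (x.2.2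
    .p) * (x.2.2 .ρ)⁻¹) * (x.2.2 .r)⁻¹ * pd (eY .Hθ) (cY X .Hz) x - x.2.2 .Eθ * (σ (x.2.2 .ρ)
    (x.2.2 .p) * (x.2.2 .ρ)⁻¹) * (x.2.2 .r)⁻¹ * pd (eY .Hz) (cY X .Hz) x + x.2.2 .Eθ * (σ (x.2.2
    .ρ) (x.2.2 .p) * (x.2.2 .ρ)⁻¹) * (x.2.2 .r)⁻¹ * pd eS (cS X) x) = 0 := by
    linear_combination L1 0 0 0 0 0 0 0 0 0 0 - (x.2.2 .Hθ^2*(σ (x.2.2 .ρ) (x.2.2 .p) * (x.2.2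
      .ρ)⁻¹)*(x.2.2 .r)⁻¹*(x.2.2 .Ez*r_Hθ - x.2.2 .Eθ*r_Hz) + x.2.2 .r*(σ (x.2.2 .ρ) (x.2.2 .p) *
      (x.2.2 .ρ)⁻¹)*(x.2.2 .r)⁻¹*(x.2.2 .Ez*p_Hθ-x.2.2 .Eθ*p_Hz))
  have Hθ_us : -x.2.2 .ρ * x.2.2 .r * pd (eY .ρ) (cY X .Hθ) x - γ * x.2.2 .p * x.2.2 .r * pd (eY
    .p) (cY X .Hθ) x - x.2.2 .r * x.2.2 .Hθ * pd (eY .Hθ) (cY X .Hθ) x - x.2.2 .r * x.2.2 .Hz * pd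
    (eY .Hz) (cY X .Hθ) x + x.2.2 .r * x.2.2 .Hθ * pd eT (cT X) x + (cY X .r x + x.2.2 .r * (cY X
    .ρ x * (x.2.2 .ρ)⁻¹)) * x.2.2 .Hθ - x.2.2 .r * (pd (eY .u) (cY X .Ez) x - cY X .Hθ x - x.2.2
    .Hθ * (pd (eY .u) (cY X .u) x - pd eS (cS X) x)) = 0 := by
    refine cancel (c := x.2.2 .ρ) hρ ?_
    linear_combination (L6 0 0 0 0 1 0 0 0 0 0 - L6 0 0 0 0 0 0 0 0 0 0) - (-x.2.2 .r*cY X .ρ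
      x*x.2.2 .Hθ*hρw)
  have Hθ_gs : x.2.2 .r * pd (eY .Hθ) (cY X .Hθ) x - x.2.2 .r * pd eT (cT X) x - (cY X .r x +
    x.2.2 .r * (cY X .ρ x * (x.2.2 .ρ)⁻¹)) - x.2.2 .r * (pd (eY .Ez) (cY X .Ez) x - pd eS (cS X)
    x) = 0 := by
    refine cancel (c := x.2.2 .ρ) hρ ?_
    linear_combination (L6 0 0 0 0 0 0 0 0 0 1 - L6 0 0 0 0 0 0 0 0 0 0) - (x.2.2 .r*cY X .ρ
      x*hρw)
  have Hθ_fs : pd (eY .Hz) (cY X .Hθ) x + pd (eY .Eθ) (cY X .Ez) x = 0 := by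
    refine cancel (c := -(x.2.2 .r * x.2.2 .ρ)) (neg_ne_zero.2 hrρ) ?_
    linear_combination (L6 0 0 0 0 0 0 0 0 1 0 - L6 0 0 0 0 0 0 0 0 0 0)
  have Hz_us : -x.2.2 .r * x.2.2 .Hθ * pd (eY .Hθ) (cY X .Hz) x - x.2.2 .r * x.2.2 .Hz * pd (eY
    .Hz) (cY X .Hz) x + x.2.2 .r * x.2.2 .Hz * pd eT (cT X) x + cY X .ρ x * (x.2.2 .ρ)⁻¹ * x.2.2
    .Hz * x.2.2 .r + (x.2.2 .r * pd (eY .u) (cY X .Eθ) x + cY X .Hz x * x.2.2 .r + x.2.2 .Hz * (cY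
    X .r x + x.2.2 .r * pd (eY .u) (cY X .u) x - x.2.2 .r * pd eS (cS X) x)) = 0 := by
    refine cancel (c := x.2.2 .ρ) hρ ?_
    linear_combination (L7 0 0 0 0 1 0 0 0 0 0 - L7 0 0 0 0 0 0 0 0 0 0) - (-x.2.2 .ρ^2*x.2.2
      .r*Hz_ρ - γ*x.2.2 .ρ*x.2.2 .p*x.2.2 .r*Hz_p + x.2.2 .ρ*(x.2.2 .Eθ+x.2.2 .Hz*x.2.2
      .u)*r_u-x.2.2 .r*cY X .ρ x*x.2.2 .Hz*hρw)
  have Hz_fs : -x.2.2 .r * pd (eY .Hz) (cY X .Hz) x + x.2.2 .r * pd eT (cT X) x + cY X .ρ x *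
    (x.2.2 .ρ)⁻¹ * x.2.2 .r + (cY X .r x + x.2.2 .r * pd (eY .Eθ) (cY X .Eθ) x - x.2.2 .r * pd eS
    (cS X) x) = 0 := by
    refine cancel (c := x.2.2 .ρ) hρ ?_
    linear_combination (L7 0 0 0 0 0 0 0 0 1 0 - L7 0 0 0 0 0 0 0 0 0 0) - (-x.2.2 .r*cY X .ρ
      x*hρw)
  have Hz_gs : pd (eY .Hθ) (cY X .Hz) x + pd (eY .Ez) (cY X .Eθ) x = 0 := by
    refine cancel (c := (x.2.2 .r * x.2.2 .ρ)) hrρ ?_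
    linear_combination (L7 0 0 0 0 0 0 0 0 0 1 - L7 0 0 0 0 0 0 0 0 0 0)
  exact ⟨r_u, r_Hθ, r_Hz, r_us, r_c, θ_u, θ_Hθ, θ_Hz, θ_us, θ_c, v_u, v_Hθ, v_Hz, v_us, v_c, ρ_ps,
    ρ_Hθ, ρ_Hz, ρ_θs, ρ_vs, ρ_rs, ρ_c, p_ps, p_Hθ, p_Hz, p_us, p_c, Hz_p, Hz_ρ, Hz_θ,
    Hz_v, Hz_rs, Eθ_c, Hθ_p, Hθ_ρ, Hθ_u, Hθ_θ, Hθ_v, Hθ_rs, Ez_c, u_ρs, u_θs, u_vs, u_rs, u_ps,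
    u_c, Hθ_us, Hθ_gs, Hθ_fs, Hz_us, Hz_fs, Hz_gs⟩

/-! ### Calculus of functions independent of a coordinate, and cancellation. -/

/-- `f'` is the derivative of `f` at `x` in the direction `e`. -/
def HasPd (e : Phase) (f : Phase → ℝ) (f' : ℝ) (x : Phase) : Prop :=
  HasLineDerivAt ℝ f f' x e

theorem Smooth.hasPd {f : Phase → ℝ} (hf : Smooth f) (e : Phase) {x : Phase} (hx : x ∈ region) :
    HasPd e f (MHD.pd e f x) x :=
  (hf.differentiableAt hx).hasFDerivAt.hasLineDerivAt e

theorem HasPd.add {e x : Phase} {f g : Phase → ℝ} {f' g' : ℝ} (hf : HasPd e f f' x)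
    (hg : HasPd e g g' x) : HasPd e (fun z => f z + g z) (f' + g') x :=
  HasDerivAt.add hf hg

theorem HasPd.sub {e x : Phase} {f g : Phase → ℝ} {f' g' : ℝ} (hf : HasPd e f f' x)
    (hg : HasPd e g g' x) : HasPd e (fun z => f z - g z) (f' - g') x :=
  HasDerivAt.sub hf hg

theorem HasPd.mul {e x : Phase} {f g : Phase → ℝ} {f' g' : ℝ} (hf : HasPd e f f' x)
    (hg : HasPd e g g' x) : HasPd e (fun z => f z * g z) (f' * g x + f x * g') x := by
  have h := HasDerivAt.mul hf hg
  simp only [zero_smul, add_zero] at h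
  exact h

theorem hasPd_const (e x : Phase) (c : ℝ) : HasPd e (fun _ => c) 0 x :=
  hasDerivAt_const _ _

theorem HasPd.const_mul {e x : Phase} {f : Phase → ℝ} {f' : ℝ} (c : ℝ) (hf : HasPd e f f' x) :
    HasPd e (fun z => c * f z) (c * f') x :=
  HasDerivAt.const_mul c hf

theorem hasPd_coord (e x : Phase) (i : Dep) : HasPd e (fun z => z.2.2 i) (e.2.2 i) x := by
  have h := ((hasDerivAt_id (0 : ℝ)).mul_const (e.2.2 i)).const_add (x.2.2 i)
  simpa [HasPd, HasLineDerivAt] using h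

theorem hasPd_self (x : Phase) (i : Dep) : HasPd (eY i) (fun z => z.2.2 i) 1 x := by
  simpa [eY] using hasPd_coord (eY i) x i

theorem hasPd_other {i j : Dep} (h : j ≠ i) (x : Phase) :
    HasPd (eY i) (fun z => z.2.2 j) 0 x := by
  simpa [eY, h] using hasPd_coord (eY i) x j

theorem HasPd.congr {e x : Phase} {f g : Phase → ℝ} {f' : ℝ} (hf : HasPd e f f' x)
    (hx : x ∈ region) (h : ∀ z ∈ region, f z = g z) : HasPd e g f' x :=
  HasLineDerivAt.congr_of_eventuallyEq hf
    (Filter.eventuallyEq_of_mem (isOpen_region.mem_nhds hx) fun z hz => (h z hz).symm)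

theorem HasPd.unique {e x : Phase} {f : Phase → ℝ} {f' g' : ℝ} (hf : HasPd e f f' x)
    (hg : HasPd e f g' x) : f' = g' :=
  HasDerivAt.unique hf hg

/-- Differentiation of an identity `f = 0`. -/
theorem HasPd.eq_zero {e x : Phase} {f : Phase → ℝ} {f' : ℝ} (hf : HasPd e f f' x)
    (hx : x ∈ region) (h : ∀ z ∈ region, f z = 0) : f' = 0 :=
  (hf.congr hx h).unique (hasPd_const e x 0)

theorem HasPd.pd_eq {e x : Phase} {f g : Phase → ℝ} {f' : ℝ} (hf : HasPd e f f' x)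
    (hg : Smooth g) (hx : x ∈ region) (h : ∀ z ∈ region, g z = f z) : pd e g x = f' :=
  (hg.hasPd e hx).unique (hf.congr hx fun z hz => (h z hz).symm)

/-- `f` is smooth on the region and does not vary in the direction `e`. -/
structure Ind (e : Phase) (f : Phase → ℝ) : Prop where
  smooth : Smooth f
  zero : ∀ x ∈ region, pd e f x = 0

theorem Ind.hasPd {e : Phase} {f : Phase → ℝ} (hf : Ind e f) {x : Phase} (hx : x ∈ region) :
    HasPd e f 0 x :=
  hf.zero x hx ▸ hf.smooth.hasPd e hx

theorem Ind.add {e : Phase} {f g : Phase → ℝ} (hf : Ind e f) (hg : Ind e g) :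
    Ind e (fun z => f z + g z) :=
  ⟨hf.smooth.add hg.smooth, fun x hx => by
    simpa using ((hf.hasPd hx).add (hg.hasPd hx)).pd_eq (hf.smooth.add hg.smooth) hx
      fun _ _ => rfl⟩

theorem Ind.sub {e : Phase} {f g : Phase → ℝ} (hf : Ind e f) (hg : Ind e g) :
    Ind e (fun z => f z - g z) :=
  ⟨hf.smooth.sub hg.smooth, fun x hx => by
    simpa using ((hf.hasPd hx).sub (hg.hasPd hx)).pd_eq (hf.smooth.sub hg.smooth) hx
      fun _ _ => rfl⟩

theorem Ind.mul {e : Phase} {f g : Phase → ℝ} (hf : Ind e f) (hg : Ind e g) :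
    Ind e (fun z => f z * g z) :=
  ⟨hf.smooth.mul hg.smooth, fun x hx => by
    simpa using ((hf.hasPd hx).mul (hg.hasPd hx)).pd_eq (hf.smooth.mul hg.smooth) hx
      fun _ _ => rfl⟩

theorem Ind.const (e : Phase) (c : ℝ) : Ind e (fun _ => c) :=
  ⟨contDiffOn_const, fun x _ => pd_const e c x⟩

theorem Ind.coord {i j : Dep} (h : j ≠ i) : Ind (eY i) (fun z => z.2.2 j) :=
  ⟨smooth_coord j, fun x hx => (hasPd_other h x).pd_eq (smooth_coord j) hx fun _ _ => rfl⟩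

theorem Ind.pd {e : Phase} {f : Phase → ℝ} (hf : Ind e f) (e' : Phase) : Ind e (MHD.pd e' f) :=
  ⟨hf.smooth.pd e', fun _ hx => pd_pd_eq_zero hf.smooth hf.zero e' hx⟩

theorem Ind.congr {e : Phase} {f g : Phase → ℝ} (hf : Ind e f) (h : ∀ x ∈ region, g x = f x) :
    Ind e g :=
  ⟨hf.smooth.congr h, fun x hx => by rw [pd_congr h e hx, hf.zero x hx]⟩

theorem smooth_inv_r : Smooth (fun x => (x.2.2 .r)⁻¹) :=
  (smooth_coord .r).inv fun _ hx => (region_r_pos hx).ne'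

theorem hasPd_inv_r (e : Phase) {x : Phase} (hx : x ∈ region) :
    HasPd e (fun z => (z.2.2 .r)⁻¹) (-(e.2.2 .r) * (x.2.2 .r)⁻¹ ^ 2) x := by
  have h := HasDerivAt.inv (hasPd_coord e x .r) (by simpa using (region_r_pos hx).ne')
  simp only [zero_smul, add_zero] at h
  refine HasDerivAt.congr_deriv h ?_
  rw [inv_pow]; rfl

theorem Ind.inv_r {i : Dep} (h : .r ≠ i) : Ind (eY i) (fun z => (z.2.2 .r)⁻¹) :=
  ⟨smooth_inv_r, fun x hx => by
    simpa [eY, h] using (hasPd_inv_r (eY i) hx).pd_eq smooth_inv_r hx fun _ _ => rfl⟩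

theorem smooth_sigma {σ : ℝ → ℝ → ℝ} (hσ : SmoothOnQuadrant σ) :
    Smooth (fun x => σ (x.2.2 .ρ) (x.2.2 .p)) :=
  ContDiffOn.comp (g := fun q : ℝ × ℝ => σ q.1 q.2) (f := fun x : Phase => (x.2.2 .ρ, x.2.2 .p))
    hσ ((smooth_coord .ρ).prodMk (smooth_coord .p)) fun _ hx => ⟨region_ρ_pos hx, region_p_pos hx⟩

theorem hasPd_sigma {σ : ℝ → ℝ → ℝ} (hσ : SmoothOnQuadrant σ) {i : Dep} (h1 : .ρ ≠ i)
    (h2 : .p ≠ i) {x : Phase} (hx : x ∈ region) :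
    HasPd (eY i) (fun x => σ (x.2.2 .ρ) (x.2.2 .p)) 0 x := by
  have h := hσ.hasDerivAt_comp (hasPd_other h1 x) (hasPd_other h2 x)
    (by simpa using region_ρ_pos hx) (by simpa using region_p_pos hx)
  simpa [HasPd, HasLineDerivAt] using h

theorem Ind.sigma {σ : ℝ → ℝ → ℝ} (hσ : SmoothOnQuadrant σ) {i : Dep} (h1 : .ρ ≠ i)
    (h2 : .p ≠ i) : Ind (eY i) (fun x => σ (x.2.2 .ρ) (x.2.2 .p)) :=
  ⟨smooth_sigma hσ, fun _ hx =>
    (hasPd_sigma hσ h1 h2 hx).pd_eq (smooth_sigma hσ) hx fun _ _ => rfl⟩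

/-- A conductivity can be cancelled. -/
theorem IsConductivity.cancel {σ : ℝ → ℝ → ℝ} (hσ : IsConductivity σ) {f : Phase → ℝ}
    (hf : Smooth f) (h : ∀ x ∈ region, σ (x.2.2 .ρ) (x.2.2 .p) * f x = 0) {x : Phase}
    (hx : x ∈ region) : f x = 0 := by
  by_contra hne
  -- The slice through `x` on which only `ρ` and `p` vary. There `f ≠ 0` is an open condition on the
  -- quadrant, so it meets the set where `σ ≠ 0`.
  let c : ℝ × ℝ → Phase := fun q =>
    (x.1, x.2.1, Function.update (Function.update x.2.2 .ρ q.1) .p q.2)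
  have hc : Continuous c := by
    refine continuous_const.prodMk (continuous_const.prodMk ?_)
    exact ((continuous_const (y := x.2.2)).update _ continuous_fst).update _ continuous_snd
  have hcx : c (x.2.2 .ρ, x.2.2 .p) = x := by simp [c]
  have hmem : ∀ q ∈ quadrant, c q ∈ region := fun q hq => by
    refine ⟨?_, ?_, ?_⟩
    · simpa [c] using region_r_pos hx
    · simpa [c] using hq.1
    · simpa [c] using hq.2
  have hfc : ContinuousOn (fun q => f (c q)) quadrant :=
    hf.continuousOn.comp hc.continuousOn hmem
  obtain ⟨q, ⟨hq, hfq⟩, hσq⟩ := hσ.2 (quadrant ∩ (fun q => f (c q)) ⁻¹' {0}ᶜ)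
    (hfc.isOpen_inter_preimage isOpen_quadrant isOpen_compl_singleton) inter_subset_left
    ⟨(x.2.2 .ρ, x.2.2 .p), ⟨region_ρ_pos hx, region_p_pos hx⟩, by simpa [hcx] using hne⟩
  have := h (c q) (hmem q hq)
  simp only [c, Function.update_self, ne_eq, reduceCtorEq, not_false_eq_true,
    Function.update_of_ne] at this
  exact (mul_ne_zero hσq hfq) this

/-- Splitting of an identity that is quadratic in the electric field. -/
theorem eq_zero_of_add_mul_sq {f g : Phase → ℝ} (hf : Ind (eY .Eθ) f) (hg : Ind (eY .Eθ) g)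
    (h : ∀ x ∈ region, f x + g x * (x.2.2 .Eθ ^ 2 + x.2.2 .Ez ^ 2) = 0) :
    ∀ x ∈ region, g x = 0 := by
  have h1 : ∀ x ∈ region, g x * x.2.2 .Eθ = 0 := fun x hx => by
    have hE := hasPd_self x .Eθ
    have hz := hasPd_other (i := .Eθ) (j := .Ez) (by decide) x
    have := ((hf.hasPd hx).add ((hg.hasPd hx).mul ((hE.mul hE).add (hz.mul hz)))).eq_zero hx
      fun z hz => by rw [← h z hz]; ring
    linear_combination this / 2
  intro x hx
  have := ((hg.hasPd hx).mul (hasPd_self x .Eθ)).eq_zero hx h1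
  linear_combination this

/-- Cancellation of a coordinate in an identity. -/
theorem eq_zero_of_coord_mul {f : Phase → ℝ} (hf : Smooth f) (i : Dep)
    (h : ∀ x ∈ region, x.2.2 i * f x = 0) : ∀ x ∈ region, f x = 0 := by
  intro x hx
  -- On the hyperplane where the coordinate vanishes, the derivative of the identity in that
  -- coordinate is `f` itself.
  by_cases h0 : x.2.2 i = 0
  · have := ((hasPd_self x i).mul (hf.hasPd (eY i) hx)).eq_zero hx h
    rw [h0] at this
    linear_combination this
  · exact (mul_eq_zero.1 (h x hx)).resolve_left h0

/-- A function with vanishing derivatives in the dependent variables is constant on the fibres. -/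
theorem eq_of_ind {f : Phase → ℝ} (hf : ∀ i, Ind (eY i) f) {t s : ℝ} {y y' : Dep → ℝ}
    (hy : (t, s, y) ∈ region) (hy' : (t, s, y') ∈ region) : f (t, s, y) = f (t, s, y') := by
  let c : ℝ → Phase := fun l => (t, s, fun i => y i + l * (y' i - y i))
  have hc : ∀ l, HasDerivAt c (0, 0, fun i => y' i - y i) l := fun l => by
    refine (hasDerivAt_const l t).prodMk ((hasDerivAt_const l s).prodMk (hasDerivAt_pi.2 fun i => ?_))
    simpa using ((hasDerivAt_id l).mul_const (y' i - y i)).const_add (y i)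
  have hmem : ∀ l ∈ Icc (0 : ℝ) 1, c l ∈ region := fun l hl => by
    have key : ∀ i, 0 < y i → 0 < y' i → 0 < y i + l * (y' i - y i) := fun i h h' => by
      rcases eq_or_lt_of_le hl.1 with h0 | h0
      · simpa [← h0] using h
      · nlinarith [mul_pos h0 h', mul_nonneg (sub_nonneg.2 hl.2) h.le]
    exact ⟨key _ hy.1 hy'.1, key _ hy.2.1 hy'.2.1, key _ hy.2.2 hy'.2.2⟩
  have hd : ∀ l ∈ Icc (0 : ℝ) 1, HasDerivAt (fun l => f (c l)) 0 l := fun l hl => by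
    have := ((hf .r).smooth.differentiableAt (hmem l hl)).hasFDerivAt.comp_hasDerivAt l (hc l)
    refine this.congr_deriv ?_
    rw [fderiv_apply_eq]
    simp [(hf _).zero _ (hmem l hl)]
  have := constant_of_has_deriv_right_zero (f := fun l => f (c l)) (a := 0) (b := 1)
    (fun l hl => (hd l hl).continuousAt.continuousWithinAt)
    (fun l hl => (hd l ⟨hl.1, hl.2.le⟩).hasDerivWithinAt) 1 (by simp)
  simpa [c] using this.symm

theorem Ind.pow {e : Phase} {f : Phase → ℝ} (hf : Ind e f) : ∀ n : ℕ, Ind e (fun z => f z ^ n)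
  | 0 => by simpa using Ind.const e 1
  | n + 1 => by simpa [pow_succ] using (hf.pow n).mul hf

/-! ### The coefficients at `r`, `u`, `ρ`, `p` are scalings. -/

theorem Admitted.ind_cT {γ : ℝ} {σ : ℝ → ℝ → ℝ} (hσ : IsConductivity σ) {X : Phase → Phase}
    (hX : Admitted γ σ X) (i : Dep) : Ind (eY i) (pd eT (cT X)) :=
  Ind.pd ⟨hX.smooth_cT, fun _ hx => (hX.projectable hσ.1 hx).1.2 i⟩ eT

theorem Admitted.ind_cS {γ : ℝ} {σ : ℝ → ℝ → ℝ} (hσ : IsConductivity σ) {X : Phase → Phase}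
    (hX : Admitted γ σ X) (i : Dep) : Ind (eY i) (pd eS (cS X)) :=
  Ind.pd ⟨hX.smooth_cS, fun _ hx => (hX.projectable hσ.1 hx).2.1.2 i⟩ eS

theorem Admitted.ind_Eθ {γ : ℝ} {σ : ℝ → ℝ → ℝ} (hσ : IsConductivity σ) {X : Phase → Phase}
    (hX : Admitted γ σ X) {i : Dep} (h1 : i ≠ .Eθ) (h2 : i ≠ .Ez) : Ind (eY .Eθ) (cY X i) :=
  ⟨hX.smooth_cY i, fun _ hx => ((hX.projectable hσ.1 hx).2.2 i h1 h2).1⟩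

theorem Admitted.ind_Ez {γ : ℝ} {σ : ℝ → ℝ → ℝ} (hσ : IsConductivity σ) {X : Phase → Phase}
    (hX : Admitted γ σ X) {i : Dep} (h1 : i ≠ .Eθ) (h2 : i ≠ .Ez) : Ind (eY .Ez) (cY X i) :=
  ⟨hX.smooth_cY i, fun _ hx => ((hX.projectable hσ.1 hx).2.2 i h1 h2).2⟩

/-- Independence of the pressure, from the terms with the Joule heating. -/
theorem Admitted.ind_p {γ : ℝ} (hγ : 1 < γ) {σ : ℝ → ℝ → ℝ} (hσ : IsConductivity σ)
    {X : Phase → Phase} (hX : Admitted γ σ X) {i : Dep} (h1 : i ≠ .Eθ) (h2 : i ≠ .Ez)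
    {f : Phase → ℝ} (hf : Ind (eY .Eθ) f)
    (h : ∀ x ∈ region, f x + (γ - 1) * σ (x.2.2 .ρ) (x.2.2 .p) * (x.2.2 .Eθ ^ 2 + x.2.2 .Ez ^ 2)
      * pd (eY .p) (cY X i) x = 0) : Ind (eY .p) (cY X i) := by
  refine ⟨hX.smooth_cY i, fun x hx => hσ.cancel ((hX.smooth_cY i).pd _) (fun z hz => ?_) hx⟩
  have hg : Ind (eY .Eθ) (fun x => σ (x.2.2 .ρ) (x.2.2 .p) * pd (eY .p) (cY X i) x) :=
    (Ind.sigma hσ.1 (by decide) (by decide)).mul ((hX.ind_Eθ hσ h1 h2).pd _)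
  have := eq_zero_of_add_mul_sq hf ((Ind.const _ (γ - 1)).mul hg)
    (fun x hx => by rw [← h x hx]; ring) z hz
  exact (mul_eq_zero.1 this).resolve_left (by linarith)

/-- The equations for `r_t`, `θ_t`, `v_t` contain no electric field, so in the linearization `E`
enters only through `p_t`, as `(γ - 1) σ |E|²` times the `p`-derivative. This kills the
`p`-derivative, and then the coefficient of `u_s` kills the `ρ`-derivative. The remaining
derivatives vanish by `Determining` and `Admitted.projectable`. -/
theorem Admitted.ind_kinematic {γ : ℝ} (hγ : 1 < γ) {σ : ℝ → ℝ → ℝ} (hσ : IsConductivity σ)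
    {X : Phase → Phase} (hX : Admitted γ σ X) {i : Dep} (hi : i = .r ∨ i = .θ ∨ i = .v)
    {z : Dep} (hr : z ≠ .r) (hθ : z ≠ .θ) (hv : z ≠ .v) : Ind (eY z) (cY X i) := by
  have D := fun x hx => hX.determining (x := x) hσ.1 hx
  have hT := hX.ind_cT hσ .Eθ
  have h1 : i ≠ .Eθ := by rcases hi with rfl | rfl | rfl <;> decide
  have h2 : i ≠ .Ez := by rcases hi with rfl | rfl | rfl <;> decide
  have er := hX.ind_Eθ hσ (i := .r) (by decide) (by decide)
  have eθ := hX.ind_Eθ hσ (i := .θ) (by decide) (by decide)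
  have eu := hX.ind_Eθ hσ (i := .u) (by decide) (by decide)
  have ev := hX.ind_Eθ hσ (i := .v) (by decide) (by decide)
  have hw : Ind (eY .Eθ) (fun z => (z.2.2 .r)⁻¹) := Ind.inv_r (by decide)
  have cu : Ind (eY .Eθ) (fun z => z.2.2 .u) := Ind.coord (by decide)
  have cv : Ind (eY .Eθ) (fun z => z.2.2 .v) := Ind.coord (by decide)
  have transport : ∀ j, Ind (eY .Eθ) (cY X j) → Ind (eY .Eθ) (fun x => pd eT (cY X j) x
      + x.2.2 .u * pd (eY .r) (cY X j) x + x.2.2 .v * (x.2.2 .r)⁻¹ * pd (eY .θ) (cY X j) x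
      - x.2.2 .u * x.2.2 .v * (x.2.2 .r)⁻¹ * pd (eY .v) (cY X j) x) := fun j hj =>
    (((hj.pd eT).add (cu.mul (hj.pd _))).add ((cv.mul hw).mul (hj.pd _))).sub
      (((cu.mul cv).mul hw).mul (hj.pd _))
  have hp : Ind (eY .p) (cY X i) := by
    rcases hi with rfl | rfl | rfl
    · exact hX.ind_p hγ hσ h1 h2 (((transport .r er).sub (cu.mul hT)).sub eu)
        fun x hx => by linear_combination (D x hx).r_c_eq
    · exact hX.ind_p hγ hσ h1 h2 ((((transport .θ eθ).sub ((cv.mul hw).mul hT)).sub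
        (ev.mul hw)).add ((cv.mul er).mul (hw.pow 2)))
        fun x hx => by linear_combination (D x hx).θ_c_eq
    · exact hX.ind_p hγ hσ h1 h2 ((((transport .v ev).add (((cu.mul cv).mul hw).mul hT)).add
        (((eu.mul cv).add (cu.mul ev)).mul hw)).sub (((cu.mul cv).mul er).mul (hw.pow 2)))
        fun x hx => by linear_combination (D x hx).v_c_eq
  have hρ : ∀ x ∈ region, x.2.2 .ρ * pd (eY .ρ) (cY X i) x + γ * x.2.2 .p
      * pd (eY .p) (cY X i) x = 0 → pd (eY .ρ) (cY X i) x = 0 := fun x hx h => by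
    rw [hp.zero x hx, mul_zero, add_zero] at h
    exact (mul_eq_zero.1 h).resolve_left (region_ρ_pos hx).ne'
  cases z with
  | r => exact absurd rfl hr
  | θ => exact absurd rfl hθ
  | v => exact absurd rfl hv
  | p => exact hp
  | Eθ => exact hX.ind_Eθ hσ h1 h2
  | Ez => exact hX.ind_Ez hσ h1 h2
  | u =>
    refine ⟨hX.smooth_cY i, fun x hx => ?_⟩
    rcases hi with rfl | rfl | rfl
    exacts [(D x hx).r_u_eq, (D x hx).θ_u_eq, (D x hx).v_u_eq]
  | ρ =>
    refine ⟨hX.smooth_cY i, fun x hx => hρ x hx ?_⟩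
    rcases hi with rfl | rfl | rfl
    exacts [(D x hx).r_us_eq, (D x hx).θ_us_eq, (D x hx).v_us_eq]
  | Hθ =>
    refine ⟨hX.smooth_cY i, fun x hx => ?_⟩
    rcases hi with rfl | rfl | rfl
    exacts [(D x hx).r_Hθ_eq, (D x hx).θ_Hθ_eq, (D x hx).v_Hθ_eq]
  | Hz =>
    refine ⟨hX.smooth_cY i, fun x hx => ?_⟩
    rcases hi with rfl | rfl | rfl
    exacts [(D x hx).r_Hz_eq, (D x hx).θ_Hz_eq, (D x hx).v_Hz_eq]

/-- The coefficient at `∂_u` is determined by the one at `∂_r`. -/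
theorem Admitted.cY_u_eq {γ : ℝ} (hγ : 1 < γ) {σ : ℝ → ℝ → ℝ} (hσ : IsConductivity σ)
    {X : Phase → Phase} (hX : Admitted γ σ X) {x : Phase} (hx : x ∈ region) :
    cY X .u x = pd eT (cY X .r) x + x.2.2 .u * pd (eY .r) (cY X .r) x
      + x.2.2 .v * (x.2.2 .r)⁻¹ * pd (eY .θ) (cY X .r) x
      - x.2.2 .u * x.2.2 .v * (x.2.2 .r)⁻¹ * pd (eY .v) (cY X .r) x
      - x.2.2 .u * pd eT (cT X) x := by
  have hp := (hX.ind_kinematic hγ hσ (i := .r) (z := .p) (by decide) (by decide) (by decide)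
    (by decide)).zero x hx
  have := (hX.determining hσ.1 hx).r_c_eq
  rw [hp] at this
  linear_combination -this

theorem Admitted.ind_u {γ : ℝ} (hγ : 1 < γ) {σ : ℝ → ℝ → ℝ} (hσ : IsConductivity σ)
    {X : Phase → Phase} (hX : Admitted γ σ X) {z : Dep} (hr : z ≠ .r) (hθ : z ≠ .θ) (hu : z ≠ .u)
    (hv : z ≠ .v) : Ind (eY z) (cY X .u) := by
  have h := hX.ind_kinematic hγ hσ (i := .r) (by decide) hr hθ hv
  have hw : Ind (eY z) (fun z => (z.2.2 .r)⁻¹) := Ind.inv_r hr.symm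
  have cu : Ind (eY z) (fun z => z.2.2 .u) := Ind.coord hu.symm
  have cv : Ind (eY z) (fun z => z.2.2 .v) := Ind.coord hv.symm
  exact Ind.congr (((((h.pd eT).add (cu.mul (h.pd _))).add ((cv.mul hw).mul (h.pd _))).sub
      (((cu.mul cv).mul hw).mul (h.pd _))).sub (cu.mul (hX.ind_cT hσ z)))
    fun x hx => hX.cY_u_eq hγ hσ hx

/-- The source is the continuity equation: its `p_s`-coefficient removes `u`, and the Joule term in
its free part then removes `p`. -/
theorem Admitted.ind_ρ {γ : ℝ} (hγ : 1 < γ) {σ : ℝ → ℝ → ℝ} (hσ : IsConductivity σ)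
    {X : Phase → Phase} (hX : Admitted γ σ X) {z : Dep} (hr : z ≠ .r) (hθ : z ≠ .θ)
    (hv : z ≠ .v) (hρ : z ≠ .ρ) : Ind (eY z) (cY X .ρ) := by
  have D := fun x hx => hX.determining (x := x) hσ.1 hx
  have rp := hX.ind_kinematic hγ hσ (i := .r) (z := .p) (by decide) (by decide) (by decide)
    (by decide)
  have up := hX.ind_u hγ hσ (z := .p) (by decide) (by decide) (by decide) (by decide)
  have uHθ := hX.ind_u hγ hσ (z := .Hθ) (by decide) (by decide) (by decide) (by decide)
  have uHz := hX.ind_u hγ hσ (z := .Hz) (by decide) (by decide) (by decide) (by decide)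
  have hu : Ind (eY .u) (cY X .ρ) := ⟨hX.smooth_cY _, fun x hx => by
    have := (D x hx).ρ_ps_eq
    rw [rp.zero x hx, up.zero x hx] at this
    refine (mul_eq_zero.1 (?_ : x.2.2 .r * _ = 0)).resolve_left (region_r_pos hx).ne'
    linear_combination -this⟩
  cases z with
  | r => exact absurd rfl hr
  | θ => exact absurd rfl hθ
  | v => exact absurd rfl hv
  | ρ => exact absurd rfl hρ
  | u => exact hu
  | Hθ => exact ⟨hX.smooth_cY _, fun x hx => (D x hx).ρ_Hθ_eq⟩
  | Hz => exact ⟨hX.smooth_cY _, fun x hx => (D x hx).ρ_Hz_eq⟩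
  | Eθ => exact hX.ind_Eθ hσ (by decide) (by decide)
  | Ez => exact hX.ind_Ez hσ (by decide) (by decide)
  | p =>
    have er := hX.ind_Eθ hσ (i := .r) (by decide) (by decide)
    have eu := hX.ind_Eθ hσ (i := .u) (by decide) (by decide)
    have eρ := hX.ind_Eθ hσ (i := .ρ) (by decide) (by decide)
    have hw : Ind (eY .Eθ) (fun z => (z.2.2 .r)⁻¹) := Ind.inv_r (by decide)
    have cr : Ind (eY .Eθ) (fun z => z.2.2 .r) := Ind.coord (by decide)
    have cu : Ind (eY .Eθ) (fun z => z.2.2 .u) := Ind.coord (by decide)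
    have cv : Ind (eY .Eθ) (fun z => z.2.2 .v) := Ind.coord (by decide)
    have cρ : Ind (eY .Eθ) (fun z => z.2.2 .ρ) := Ind.coord (by decide)
    refine hX.ind_p hγ hσ (by decide) (by decide) (f := fun x => pd eT (cY X .ρ) x
      + x.2.2 .u * pd (eY .r) (cY X .ρ) x + x.2.2 .v * (x.2.2 .r)⁻¹ * pd (eY .θ) (cY X .ρ) x
      - x.2.2 .u * x.2.2 .v * (x.2.2 .r)⁻¹ * pd (eY .v) (cY X .ρ) x
      + x.2.2 .ρ ^ 2 * (x.2.2 .u * pd eS (cY X .r) x + x.2.2 .r * pd eS (cY X .u) x)) ?_ ?_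
    · exact ((((eρ.pd eT).add (cu.mul (eρ.pd _))).add ((cv.mul hw).mul (eρ.pd _))).sub
        (((cu.mul cv).mul hw).mul (eρ.pd _))).add
        ((cρ.pow 2).mul ((cu.mul (er.pd _)).add (cr.mul (eu.pd _))))
    · intro x hx
      have := (D x hx).ρ_c_eq
      rw [uHθ.zero x hx, uHz.zero x hx, hu.zero x hx] at this
      linear_combination this

/-- The coefficient at `∂_p` depends on `t`, `s` and `p` only. -/
theorem Admitted.ind_cY_p {γ : ℝ} (hγ : 1 < γ) {σ : ℝ → ℝ → ℝ} (hσ : IsConductivity σ)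
    {X : Phase → Phase} (hX : Admitted γ σ X) {z : Dep} (hp : z ≠ .p) :
    Ind (eY z) (cY X .p) := by
  have D := fun x hx => hX.determining (x := x) hσ.1 hx
  have rp := hX.ind_kinematic hγ hσ (i := .r) (z := .p) (by decide) (by decide) (by decide)
    (by decide)
  have up := hX.ind_u hγ hσ (z := .p) (by decide) (by decide) (by decide) (by decide)
  have uρ := hX.ind_u hγ hσ (z := .ρ) (by decide) (by decide) (by decide) (by decide)
  have uHz := hX.ind_u hγ hσ (z := .Hz) (by decide) (by decide) (by decide) (by decide)
  have cancel : ∀ x ∈ region, ∀ e : ℝ, x.2.2 .r * e = 0 → e = 0 := fun x hx e h =>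
    (mul_eq_zero.1 h).resolve_left (region_r_pos hx).ne'
  refine ⟨hX.smooth_cY _, fun x hx => ?_⟩
  have d := D x hx
  cases z with
  | p => exact absurd rfl hp
  | Eθ => exact (hX.ind_Eθ hσ (by decide) (by decide)).zero x hx
  | Ez => exact (hX.ind_Ez hσ (by decide) (by decide)).zero x hx
  | Hθ => exact d.p_Hθ_eq
  | Hz => exact d.p_Hz_eq
  | u =>
    have := d.p_ps_eq
    rw [rp.zero x hx, up.zero x hx] at this
    exact cancel x hx _ (by linear_combination -this)
  -- The `ρ_s`-coefficients of the two Ohm laws cancel the magnetic part of the `ρ_s`-coefficient of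
  -- the momentum equation; the same holds for `θ` and `v`.
  | ρ =>
    exact cancel x hx _ (by
      linear_combination d.u_ρs_eq - x.2.2 .Hθ * d.Hθ_ρ_eq - x.2.2 .r * x.2.2 .Hz * d.Hz_ρ_eq)
  | θ =>
    exact cancel x hx _ (by
      linear_combination d.u_θs_eq - x.2.2 .Hθ * d.Hθ_θ_eq - x.2.2 .r * x.2.2 .Hz * d.Hz_θ_eq)
  | v =>
    exact cancel x hx _ (by
      linear_combination d.u_vs_eq - x.2.2 .Hθ * d.Hθ_v_eq - x.2.2 .r * x.2.2 .Hz * d.Hz_v_eq)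
  | r =>
    have := d.u_rs_eq
    rw [uρ.zero x hx, up.zero x hx, uHz.zero x hx] at this
    exact cancel x hx _ (by linear_combination this)

/-- The derivative of the coefficient at `∂_u` in `u`. -/
theorem Admitted.pd_u_cY_u {γ : ℝ} {σ : ℝ → ℝ → ℝ} (hσ : IsConductivity σ)
    {X : Phase → Phase} (hX : Admitted γ σ X) {x : Phase} (hx : x ∈ region) :
    pd (eY .u) (cY X .u) x = pd eT (cT X) x + cY X .r x * (x.2.2 .r)⁻¹
      + pd (eY .p) (cY X .p) x - pd eS (cS X) x := by
  have d := hX.determining hσ.1 hx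
  have hw := mul_inv_cancel₀ (region_r_pos hx).ne'
  have h : x.2.2 .r * (pd eT (cT X) x + cY X .r x * (x.2.2 .r)⁻¹
      + pd (eY .p) (cY X .p) x - pd eS (cS X) x - pd (eY .u) (cY X .u) x) = 0 := by
    linear_combination d.u_ps_eq - x.2.2 .Hθ * d.Hθ_p_eq - x.2.2 .r * x.2.2 .Hz * d.Hz_p_eq
      + cY X .r x * hw
  have := (mul_eq_zero.1 h).resolve_left (region_r_pos hx).ne'
  linear_combination -this

/-- The coefficient at `∂_ρ` is linear in `ρ`, the coefficient at `∂_p` is linear in `p`. -/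
theorem Admitted.cY_ρ_p {γ : ℝ} (hγ : 1 < γ) {σ : ℝ → ℝ → ℝ} (hσ : IsConductivity σ)
    {X : Phase → Phase} (hX : Admitted γ σ X) {x : Phase} (hx : x ∈ region) :
    cY X .p x = x.2.2 .p * pd (eY .p) (cY X .p) x ∧
    cY X .ρ x = x.2.2 .ρ * (2 * pd eS (cS X) x - 2 * pd eT (cT X) x
      - 2 * (cY X .r x * (x.2.2 .r)⁻¹) - pd (eY .p) (cY X .p) x) ∧
    x.2.2 .ρ * pd (eY .ρ) (cY X .ρ) x = cY X .ρ x := by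
  -- The `u_s`-coefficient of the energy equation with denominators cleared. The coefficient at `p`
  -- is free of `ρ` and the one at `ρ` is free of `p`, so comparing `V` with its derivatives in `p`
  -- and `ρ` yields Euler's relations for both.
  have V : ∀ x ∈ region, x.2.2 .ρ * (x.2.2 .p * (2 * (x.2.2 .r * pd eT (cT X) x)
      + 2 * cY X .r x - 2 * (x.2.2 .r * pd eS (cS X) x)) + cY X .p x * x.2.2 .r)
      + cY X .ρ x * (x.2.2 .p * x.2.2 .r) = 0 := fun x hx => by
    have d := (hX.determining hσ.1 hx).p_us_eq
    rw [hX.pd_u_cY_u hσ hx, (hX.ind_cY_p hγ hσ (z := .ρ) (by decide)).zero x hx] at d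
    have hw := mul_inv_cancel₀ (region_r_pos hx).ne'
    have hρ := mul_inv_cancel₀ (region_ρ_pos hx).ne'
    refine (mul_eq_zero.1 (?_ : γ * _ = 0)).resolve_left (by linarith)
    linear_combination x.2.2 .ρ * d - γ * x.2.2 .p * x.2.2 .ρ * cY X .r x * hw
      - γ * cY X .ρ x * x.2.2 .p * x.2.2 .r * hρ
  have rρ := hX.ind_kinematic hγ hσ (i := .r) (z := .ρ) (by decide) (by decide) (by decide)
    (by decide)
  have rp := hX.ind_kinematic hγ hσ (i := .r) (z := .p) (by decide) (by decide) (by decide)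
    (by decide)
  have pρ := hX.ind_cY_p hγ hσ (z := .ρ) (by decide)
  have ρp := hX.ind_ρ hγ hσ (z := .p) (by decide) (by decide) (by decide) (by decide)
  have hr := (region_r_pos hx).ne'
  have hρ := (region_ρ_pos hx).ne'
  have hp := (region_p_pos hx).ne'
  have hw := mul_inv_cancel₀ hr
  have v := V x hx
  have B : ∀ z : Dep, z ≠ .r → Ind (eY z) (cY X .r) → Ind (eY z) (fun x =>
      2 * (x.2.2 .r * pd eT (cT X) x) + 2 * cY X .r x - 2 * (x.2.2 .r * pd eS (cS X) x)) :=
    fun z hz h => (((Ind.const _ 2).mul ((Ind.coord hz.symm).mul (hX.ind_cT hσ z))).add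
      ((Ind.const _ 2).mul h)).sub
      ((Ind.const _ 2).mul ((Ind.coord hz.symm).mul (hX.ind_cS hσ z)))
  have vρ := ((hasPd_self x .ρ).mul (((((Ind.coord (by decide)).mul (B .ρ (by decide) rρ)).add
    (pρ.mul (Ind.coord (by decide)))).hasPd hx))).add
    (((hX.smooth_cY .ρ).hasPd (eY .ρ) hx).mul
      (((Ind.coord (by decide)).mul (Ind.coord (by decide))).hasPd hx)) |>.eq_zero hx V
  have vp := (((hasPd_other (i := .p) (j := .ρ) (by decide) x).mul
    (((hasPd_self x .p).mul ((B .p (by decide) rp).hasPd hx)).add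
      (((hX.smooth_cY .p).hasPd (eY .p) hx).mul (hasPd_other (i := .p) (by decide) x)))).add
    ((ρp.hasPd hx).mul ((hasPd_self x .p).mul (hasPd_other (i := .p) (by decide) x))))
    |>.eq_zero hx V
  have e1 : x.2.2 .ρ * x.2.2 .r * (cY X .p x - x.2.2 .p * pd (eY .p) (cY X .p) x) = 0 := by
    linear_combination v - x.2.2 .p * vp
  have h1 : cY X .p x = x.2.2 .p * pd (eY .p) (cY X .p) x :=
    sub_eq_zero.1 ((mul_eq_zero.1 e1).resolve_left (mul_ne_zero hρ hr))
  refine ⟨h1, ?_, ?_⟩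
  · rw [← sub_eq_zero]
    refine (mul_eq_zero.1 (?_ : (x.2.2 .p * x.2.2 .r) * _ = 0)).resolve_left (mul_ne_zero hp hr)
    linear_combination v - x.2.2 .ρ * x.2.2 .r * h1 + 2 * x.2.2 .p * x.2.2 .ρ * cY X .r x * hw
  · rw [← sub_eq_zero]
    refine (mul_eq_zero.1 (?_ : (x.2.2 .p * x.2.2 .r) * _ = 0)).resolve_left (mul_ne_zero hp hr)
    linear_combination x.2.2 .ρ * vρ - v

/-- In the formula of `Admitted.pd_u_cY_u` only the summand `η^r / r` can depend on a variable other
than `p`. -/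
theorem Admitted.hasPd_pd_u_cY_u {γ : ℝ} (hγ : 1 < γ) {σ : ℝ → ℝ → ℝ} (hσ : IsConductivity σ)
    {X : Phase → Phase} (hX : Admitted γ σ X) {x : Phase} (hx : x ∈ region) {z : Dep}
    (hz : z ≠ .p) : pd (eY .u) (pd (eY z) (cY X .u)) x = pd (eY z) (cY X .r) x * (x.2.2 .r)⁻¹
      + cY X .r x * (-((eY z).2.2 .r) * (x.2.2 .r)⁻¹ ^ 2) := by
  rw [pd_comm (hX.smooth_cY .u) _ _ hx]
  have := (((((hX.ind_cT hσ z).hasPd hx).add (((hX.smooth_cY .r).hasPd (eY z) hx).mul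
    (hasPd_inv_r (eY z) hx))).add (((hX.ind_cY_p hγ hσ hz).pd (eY .p)).hasPd hx)).sub
    ((hX.ind_cS hσ z).hasPd hx)).pd_eq ((hX.smooth_cY .u).pd (eY .u)) hx
    fun z hz => hX.pd_u_cY_u hσ hz
  linear_combination this

/-- The coefficient at `∂_r` is homogeneous in `r` and does not depend on `θ`, `v`. -/
theorem Admitted.pd_cY_r {γ : ℝ} (hγ : 1 < γ) {σ : ℝ → ℝ → ℝ} (hσ : IsConductivity σ)
    {X : Phase → Phase} (hX : Admitted γ σ X) :
    (∀ x ∈ region, pd (eY .r) (cY X .r) x = cY X .r x * (x.2.2 .r)⁻¹) ∧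
    Ind (eY .θ) (cY X .r) ∧ Ind (eY .v) (cY X .r) := by
  have ru := hX.ind_kinematic hγ hσ (i := .r) (z := .u) (by decide) (by decide) (by decide)
    (by decide)
  have pu := hX.ind_cY_p hγ hσ (z := .u) (by decide)
  have cr : Ind (eY .u) (fun z => z.2.2 .r) := Ind.coord (by decide)
  have hw' : Ind (eY .u) (fun z => (z.2.2 .r)⁻¹) := Ind.inv_r (by decide)
  refine ⟨fun x hx => ?_, ⟨hX.smooth_cY _, fun x hx => ?_⟩, ⟨hX.smooth_cY _, fun x hx => ?_⟩⟩
  -- The `r_s`-coefficient of the continuity equation. Differentiation in `u` brings in the known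
  -- derivatives of `η^u`, and everything collapses to `2 (∂_r η^r - η^r / r) = 0`.
  · have W : ∀ x ∈ region, x.2.2 .u * (pd eS (cS X) x - pd eT (cT X) x
        - 2 * (cY X .r x * (x.2.2 .r)⁻¹) - pd (eY .p) (cY X .p) x + pd (eY .r) (cY X .r) x)
        + cY X .u x + x.2.2 .r * pd (eY .r) (cY X .u) x = 0 := fun x hx => by
      have d := (hX.determining hσ.1 hx).ρ_rs_eq
      obtain ⟨-, h1, h2⟩ := hX.cY_ρ_p hγ hσ hx
      rw [(hX.ind_ρ hγ hσ (z := .p) (by decide) (by decide) (by decide) (by decide)).zero x hx,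
        (hX.ind_u hγ hσ (z := .Hθ) (by decide) (by decide) (by decide) (by decide)).zero x hx] at d
      refine (mul_eq_zero.1 (?_ : x.2.2 .ρ * _ = 0)).resolve_left (region_ρ_pos hx).ne'
      linear_combination d - x.2.2 .u * h1 + x.2.2 .u * h2
    have := ((((hasPd_self x .u).mul ((((((hX.ind_cS hσ .u).sub (hX.ind_cT hσ .u)).sub
      ((Ind.const _ 2).mul (ru.mul hw'))).sub (pu.pd (eY .p))).add
      (ru.pd (eY .r))).hasPd hx)).add ((hX.smooth_cY .u).hasPd (eY .u) hx)).add
      ((cr.hasPd hx).mul (((hX.smooth_cY .u).pd (eY .r)).hasPd (eY .u) hx))).eq_zero hx W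
    rw [hX.hasPd_pd_u_cY_u hγ hσ hx (by decide), hX.pd_u_cY_u hσ hx] at this
    have hw := mul_inv_cancel₀ (region_r_pos hx).ne'
    have h1 : (eY .r).2.2 .r = 1 := by simp [eY]
    rw [h1] at this
    linear_combination this / 2 + (cY X .r x * (x.2.2 .r)⁻¹ - pd (eY .r) (cY X .r) x) / 2 * hw
  · have := (((hasPd_self x .u).mul ((ru.pd (eY .θ)).hasPd hx)).add ((cr.hasPd hx).mul
      (((hX.smooth_cY .u).pd (eY .θ)).hasPd (eY .u) hx))).eq_zero hx
      fun z hz => (hX.determining hσ.1 hz).ρ_θs_eq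
    rw [hX.hasPd_pd_u_cY_u hγ hσ hx (by decide)] at this
    have hw := mul_inv_cancel₀ (region_r_pos hx).ne'
    have h1 : (eY .θ).2.2 .r = 0 := by simp [eY]
    rw [h1] at this
    linear_combination this / 2 - pd (eY .θ) (cY X .r) x / 2 * hw
  · have := (((hasPd_self x .u).mul ((ru.pd (eY .v)).hasPd hx)).add ((cr.hasPd hx).mul
      (((hX.smooth_cY .u).pd (eY .v)).hasPd (eY .u) hx))).eq_zero hx
      fun z hz => (hX.determining hσ.1 hz).ρ_vs_eq
    rw [hX.hasPd_pd_u_cY_u hγ hσ hx (by decide)] at this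
    have hw := mul_inv_cancel₀ (region_r_pos hx).ne'
    have h1 : (eY .v).2.2 .r = 0 := by simp [eY]
    rw [h1] at this
    linear_combination this / 2 - pd (eY .v) (cY X .r) x / 2 * hw

/-- Homogeneity of degree one in `r` makes the quotient independent of `r`; the other variables are
excluded by `Admitted.pd_cY_r` and `Admitted.ind_kinematic`. -/
theorem Ind.cY_r_mul_inv_r {γ : ℝ} (hγ : 1 < γ) {σ : ℝ → ℝ → ℝ} (hσ : IsConductivity σ)
    {X : Phase → Phase} (hX : Admitted γ σ X) (z : Dep) :
    Ind (eY z) (fun x => cY X .r x * (x.2.2 .r)⁻¹) := by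
  obtain ⟨hr, hθ, hv⟩ := hX.pd_cY_r hγ hσ
  by_cases h : z = .r
  · subst h
    have hs : Smooth (fun x => cY X .r x * (x.2.2 .r)⁻¹) := (hX.smooth_cY .r).mul smooth_inv_r
    refine ⟨hs, fun x hx => ?_⟩
    rw [(((hX.smooth_cY .r).hasPd (eY .r) hx).mul (hasPd_inv_r (eY .r) hx)).pd_eq hs hx
      fun _ _ => rfl, hr x hx]
    simp [eY]
    ring
  · refine Ind.mul ?_ (Ind.inv_r (Ne.symm h))
    by_cases h1 : z = .θ
    · exact h1 ▸ hθ
    · by_cases h2 : z = .v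
      · exact h2 ▸ hv
      · exact hX.ind_kinematic hγ hσ (by decide) h h1 h2

/-- The prolongation formula for `η^u` is now affine in `u`. Its slope, compared with
`Admitted.pd_u_cY_u`, determines `∂_p η^p`; its constant term `∂_t η^r` is killed by the
`r_s`-coefficient of the continuity equation. -/
theorem Admitted.cY_u_pd_p {γ : ℝ} (hγ : 1 < γ) {σ : ℝ → ℝ → ℝ} (hσ : IsConductivity σ)
    {X : Phase → Phase} (hX : Admitted γ σ X) {x : Phase} (hx : x ∈ region) :
    cY X .u x = x.2.2 .u * (cY X .r x * (x.2.2 .r)⁻¹ - pd eT (cT X) x) ∧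
    pd eT (cY X .r) x = 0 ∧
    pd (eY .p) (cY X .p) x = pd eS (cS X) x - 2 * pd eT (cT X) x := by
  obtain ⟨hr, hθ, hv⟩ := hX.pd_cY_r hγ hσ
  have ru := hX.ind_kinematic hγ hσ (i := .r) (z := .u) (by decide) (by decide) (by decide)
    (by decide)
  have K : ∀ x ∈ region, cY X .u x = pd eT (cY X .r) x
      + x.2.2 .u * (cY X .r x * (x.2.2 .r)⁻¹ - pd eT (cT X) x) := fun x hx => by
    rw [hX.cY_u_eq hγ hσ hx, hr x hx, hθ.zero x hx, hv.zero x hx]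
    ring
  have R := Ind.cY_r_mul_inv_r hγ hσ hX
  have uu := ((((ru.pd eT).hasPd hx).add ((hasPd_self x .u).mul (((R .u).sub
    (hX.ind_cT hσ .u)).hasPd hx)))).pd_eq (hX.smooth_cY .u) hx K
  have hpp : pd (eY .p) (cY X .p) x = pd eS (cS X) x - 2 * pd eT (cT X) x := by
    rw [hX.pd_u_cY_u hσ hx] at uu
    linear_combination uu
  have ht : pd (eY .r) (pd eT (cY X .r)) x = pd eT (cY X .r) x * (x.2.2 .r)⁻¹ := by
    rw [pd_comm (hX.smooth_cY .r) _ _ hx]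
    have := (((hX.smooth_cY .r).hasPd eT hx).mul (hasPd_inv_r eT hx)).pd_eq
      ((hX.smooth_cY .r).pd (eY .r)) hx hr
    rw [this]
    simp [eT]
  have u_r := ((((hX.smooth_cY .r).pd eT).hasPd (eY .r) hx).add
    ((hasPd_other (i := .r) (j := .u) (by decide) x).mul (((R .r).sub
    (hX.ind_cT hσ .r)).hasPd hx))).pd_eq (hX.smooth_cY .u) hx K
  have d := (hX.determining hσ.1 hx).ρ_rs_eq
  obtain ⟨-, h1, h2⟩ := hX.cY_ρ_p hγ hσ hx
  rw [(hX.ind_ρ hγ hσ (z := .p) (by decide) (by decide) (by decide) (by decide)).zero x hx,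
    (hX.ind_u hγ hσ (z := .Hθ) (by decide) (by decide) (by decide) (by decide)).zero x hx,
    hr x hx, u_r, K x hx, ht] at d
  have hw := mul_inv_cancel₀ (region_r_pos hx).ne'
  have t0 : pd eT (cY X .r) x = 0 := by
    refine (mul_eq_zero.1 (?_ : (2 * x.2.2 .ρ) * _ = 0)).resolve_left
      (mul_ne_zero two_ne_zero (region_ρ_pos hx).ne')
    linear_combination d - x.2.2 .u * h1 + x.2.2 .u * h2 + x.2.2 .ρ * x.2.2 .u * hpp
      - x.2.2 .ρ * pd eT (cY X .r) x * hw
  refine ⟨?_, t0, hpp⟩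
  rw [K x hx, t0, zero_add]

theorem Admitted.ind_eS_cT {γ : ℝ} {σ : ℝ → ℝ → ℝ} (hσ : IsConductivity σ) {X : Phase → Phase}
    (hX : Admitted γ σ X) : Ind eS (pd eT (cT X)) :=
  Ind.pd ⟨hX.smooth_cT, fun _ hx => (hX.projectable hσ.1 hx).1.1⟩ eT

theorem Admitted.ind_eT_cS {γ : ℝ} {σ : ℝ → ℝ → ℝ} (hσ : IsConductivity σ) {X : Phase → Phase}
    (hX : Admitted γ σ X) : Ind eT (pd eS (cS X)) :=
  Ind.pd ⟨hX.smooth_cS, fun _ hx => (hX.projectable hσ.1 hx).2.1.1⟩ eS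

theorem hasPd_coord_eT (i : Dep) (x : Phase) : HasPd eT (fun z => z.2.2 i) 0 x := by
  simpa [eT] using hasPd_coord eT x i

theorem hasPd_coord_eS (i : Dep) (x : Phase) : HasPd eS (fun z => z.2.2 i) 0 x := by
  simpa [eS] using hasPd_coord eS x i

theorem Admitted.cY_ρ_eq {γ : ℝ} (hγ : 1 < γ) {σ : ℝ → ℝ → ℝ} (hσ : IsConductivity σ)
    {X : Phase → Phase} (hX : Admitted γ σ X) {x : Phase} (hx : x ∈ region) :
    cY X .ρ x = x.2.2 .ρ * (pd eS (cS X) x - 2 * (cY X .r x * (x.2.2 .r)⁻¹)) := by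
  rw [(hX.cY_ρ_p hγ hσ hx).2.1, (hX.cY_u_pd_p hγ hσ hx).2.2]
  ring

theorem Admitted.cY_p_eq {γ : ℝ} (hγ : 1 < γ) {σ : ℝ → ℝ → ℝ} (hσ : IsConductivity σ)
    {X : Phase → Phase} (hX : Admitted γ σ X) {x : Phase} (hx : x ∈ region) :
    cY X .p x = x.2.2 .p * (pd eS (cS X) x - 2 * pd eT (cT X) x) := by
  rw [(hX.cY_ρ_p hγ hσ hx).1, (hX.cY_u_pd_p hγ hσ hx).2.2]

theorem Admitted.pd_eS_cY_u {γ : ℝ} (hγ : 1 < γ) {σ : ℝ → ℝ → ℝ} (hσ : IsConductivity σ)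
    {X : Phase → Phase} (hX : Admitted γ σ X) {x : Phase} (hx : x ∈ region) :
    pd eS (cY X .u) x = x.2.2 .u * (pd eS (cY X .r) x * (x.2.2 .r)⁻¹) := by
  have := ((hasPd_coord_eS .u x).mul ((((hX.smooth_cY .r).hasPd eS hx).mul
    (hasPd_inv_r eS hx)).sub ((hX.ind_eS_cT hσ).hasPd hx))).pd_eq (hX.smooth_cY .u) hx
    fun z hz => (hX.cY_u_pd_p hγ hσ hz).1
  rw [this]
  simp [eS]

/-- The free term of the continuity equation reduces to `2 ρ² u ∂_s η^r`, and the coordinate `u` can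
be cancelled. -/
theorem Admitted.pd_eS_cY_r {γ : ℝ} (hγ : 1 < γ) {σ : ℝ → ℝ → ℝ} (hσ : IsConductivity σ)
    {X : Phase → Phase} (hX : Admitted γ σ X) : ∀ x ∈ region, pd eS (cY X .r) x = 0 := by
  refine eq_zero_of_coord_mul ((hX.smooth_cY .r).pd eS) .u fun x hx => ?_
  have hz : ∀ z, z ≠ .ρ → pd (eY z) (cY X .ρ) x = 0 := fun z hz =>
    (((Ind.coord hz.symm).mul ((hX.ind_cS hσ z).sub ((Ind.const _ 2).mul
      (Ind.cY_r_mul_inv_r hγ hσ hX z)))).congr fun x hx => hX.cY_ρ_eq hγ hσ hx).zero x hx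
  have ht := ((hasPd_coord_eT .ρ x).mul (((hX.ind_eT_cS hσ).hasPd hx).sub
    ((hasPd_const _ _ 2).mul (((hX.smooth_cY .r).hasPd eT hx).mul
    (hasPd_inv_r eT hx))))).pd_eq (hX.smooth_cY .ρ) hx fun z hz => hX.cY_ρ_eq hγ hσ hz
  rw [(hX.cY_u_pd_p hγ hσ hx).2.1] at ht
  have d := (hX.determining hσ.1 hx).ρ_c_eq
  rw [ht, hz .r (by decide), hz .θ (by decide), hz .u (by decide), hz .v (by decide),
    hz .p (by decide),
    (hX.ind_u hγ hσ (z := .Hθ) (by decide) (by decide) (by decide) (by decide)).zero x hx,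
    (hX.ind_u hγ hσ (z := .Hz) (by decide) (by decide) (by decide) (by decide)).zero x hx,
    hX.pd_eS_cY_u hγ hσ hx] at d
  have hw := mul_inv_cancel₀ (region_r_pos hx).ne'
  have h0 : (eT : Phase).2.2 .r = 0 := rfl
  rw [h0] at d
  refine (mul_eq_zero.1 (?_ : (2 * x.2.2 .ρ ^ 2) * _ = 0)).resolve_left
    (mul_ne_zero two_ne_zero (pow_ne_zero 2 (region_ρ_pos hx).ne'))
  linear_combination d - x.2.2 .ρ ^ 2 * x.2.2 .u * pd eS (cY X .r) x * hw

theorem Admitted.exists_cY_r_eq {γ : ℝ} (hγ : 1 < γ) {σ : ℝ → ℝ → ℝ} (hσ : IsConductivity σ)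
    {X : Phase → Phase} (hX : Admitted γ σ X) :
    ∃ R : ℝ, ∀ x ∈ region, cY X .r x * (x.2.2 .r)⁻¹ = R := by
  have hs : Smooth (fun x => cY X .r x * (x.2.2 .r)⁻¹) := (hX.smooth_cY .r).mul smooth_inv_r
  refine ⟨_, fun x hx => const_of_pd_eq_zero hs (fun x hx => ?_) (fun x hx => ?_)
    (fun i => (Ind.cY_r_mul_inv_r hγ hσ hX i).zero) hx⟩
  · rw [(((hX.smooth_cY .r).hasPd eT hx).mul (hasPd_inv_r eT hx)).pd_eq hs hx fun _ _ => rfl,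
      (hX.cY_u_pd_p hγ hσ hx).2.1]
    simp [eT]
  · rw [(((hX.smooth_cY .r).hasPd eS hx).mul (hasPd_inv_r eS hx)).pd_eq hs hx fun _ _ => rfl,
      hX.pd_eS_cY_r hγ hσ x hx]
    simp [eS]

theorem Admitted.pd_eT_cY_p {γ : ℝ} (hγ : 1 < γ) {σ : ℝ → ℝ → ℝ} (hσ : IsConductivity σ)
    {X : Phase → Phase} (hX : Admitted γ σ X) {x : Phase} (hx : x ∈ region) :
    pd eT (cY X .p) x = -2 * x.2.2 .p * pd eT (pd eT (cT X)) x := by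
  rw [((hasPd_coord_eT .p x).mul (((hX.ind_eT_cS hσ).hasPd hx).sub
    ((hasPd_const _ _ 2).mul ((hX.smooth_cT.pd eT).hasPd eT hx)))).pd_eq (hX.smooth_cY .p) hx
    fun z hz => hX.cY_p_eq hγ hσ hz]
  ring

/-- The remaining form of the energy equation. -/
theorem Admitted.energy_eq {γ : ℝ} (hγ : 1 < γ) {σ : ℝ → ℝ → ℝ} (hσ : IsConductivity σ)
    {X : Phase → Phase} (hX : Admitted γ σ X) {x : Phase} (hx : x ∈ region) :
    pd eT (cY X .p) x + (γ - 1) * (σ (x.2.2 .ρ) (x.2.2 .p) * (x.2.2 .Eθ ^ 2 + x.2.2 .Ez ^ 2)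
      * (pd eS (cS X) x - 3 * pd eT (cT X) x) - ((sρ σ (x.2.2 .ρ) (x.2.2 .p) * cY X .ρ x
        + sp σ (x.2.2 .ρ) (x.2.2 .p) * cY X .p x) * (x.2.2 .Eθ ^ 2 + x.2.2 .Ez ^ 2)
        + 2 * σ (x.2.2 .ρ) (x.2.2 .p) * (x.2.2 .Eθ * cY X .Eθ x + x.2.2 .Ez * cY X .Ez x))) = 0 := by
  have d := (hX.determining hσ.1 hx).p_c_eq
  have hz : ∀ z, z ≠ .p → pd (eY z) (cY X .p) x = 0 := fun z hz => (hX.ind_cY_p hγ hσ hz).zero x hx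
  rw [hz .r (by decide), hz .θ (by decide), hz .u (by decide), hz .v (by decide),
    (hX.cY_u_pd_p hγ hσ hx).2.2,
    (hX.ind_u hγ hσ (z := .Hθ) (by decide) (by decide) (by decide) (by decide)).zero x hx,
    (hX.ind_u hγ hσ (z := .Hz) (by decide) (by decide) (by decide) (by decide)).zero x hx,
    hX.pd_eS_cY_u hγ hσ hx, hX.pd_eS_cY_r hγ hσ x hx] at d
  linear_combination d

theorem Admitted.exists_pd_cT_eq {γ : ℝ} (hγ : 1 < γ) {σ : ℝ → ℝ → ℝ} (hσ : IsConductivity σ)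
    {X : Phase → Phase} (hX : Admitted γ σ X) :
    ∃ T : ℝ, ∀ x ∈ region, pd eT (cT X) x = T := by
  refine ⟨_, fun x hx => const_of_pd_eq_zero (hX.smooth_cT.pd eT) (fun x hx => ?_)
    (hX.ind_eS_cT hσ).zero (fun i => (hX.ind_cT hσ i).zero) hx⟩
  obtain ⟨t, s, y⟩ := x
  -- The second derivative of `ξ^t` is constant on the fibre, so it may be computed at `E = 0`.
  -- There the energy equation reduces to `∂_t η^p = 0`, and this is `-2 p` times that second
  -- derivative.
  have hx' : (t, s, Function.update (Function.update y .Eθ 0) .Ez 0) ∈ region := by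
    simpa [region] using hx
  rw [eq_of_ind (fun i => (hX.ind_cT hσ i).pd eT) hx hx']
  have d := hX.energy_eq hγ hσ hx'
  rw [hX.pd_eT_cY_p hγ hσ hx'] at d
  have hp := (region_p_pos hx').ne'
  simp only [Function.update_self, ne_eq, reduceCtorEq, not_false_eq_true,
    Function.update_of_ne] at d hp
  refine (mul_eq_zero.1 (?_ : (2 * y .p) * _ = 0)).resolve_left (mul_ne_zero two_ne_zero hp)
  linear_combination -d

/-- The function is constant along the line, so `F` needs no regularity. This lets it be applied to
`sρ σ` and `sp σ`. -/
theorem hasPd_of_ρ_p (F : ℝ → ℝ → ℝ) {i : Dep} (h1 : .ρ ≠ i) (h2 : .p ≠ i) (x : Phase) :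
    HasPd (eY i) (fun z => F (z.2.2 .ρ) (z.2.2 .p)) 0 x := by
  have : (fun ε : ℝ => F ((x + ε • eY i).2.2 .ρ) ((x + ε • eY i).2.2 .p))
      = fun _ => F (x.2.2 .ρ) (x.2.2 .p) := by
    funext ε
    simp [eY, h1, h2]
  simp only [HasPd, HasLineDerivAt, this]
  exact hasDerivAt_const _ _

/-- The coefficients at `∂_r`, `∂_t` and `∂_s` are scalings, up to constants for `∂_t`, and up
to a function of `s` for `∂_s`. -/
structure Scaling (X : Phase → Phase) (R T : ℝ) : Prop where
  r : ∀ x ∈ region, cY X .r x = R * x.2.2 .r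
  t : ∀ x ∈ region, pd eT (cT X) x = T
  u : ∀ x ∈ region, cY X .u x = x.2.2 .u * (R - T)
  ρ : ∀ x ∈ region, cY X .ρ x = x.2.2 .ρ * (pd eS (cS X) x - 2 * R)
  p : ∀ x ∈ region, cY X .p x = x.2.2 .p * (pd eS (cS X) x - 2 * T)

theorem Admitted.exists_scaling {γ : ℝ} (hγ : 1 < γ) {σ : ℝ → ℝ → ℝ} (hσ : IsConductivity σ)
    {X : Phase → Phase} (hX : Admitted γ σ X) : ∃ R T, Scaling X R T := by
  obtain ⟨R, hR⟩ := hX.exists_cY_r_eq hγ hσ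
  obtain ⟨T, hT⟩ := hX.exists_pd_cT_eq hγ hσ
  refine ⟨R, T, fun x hx => ?_, hT, fun x hx => ?_, fun x hx => ?_, fun x hx => ?_⟩
  · have hw := mul_inv_cancel₀ (region_r_pos hx).ne'
    linear_combination x.2.2 .r * hR x hx - cY X .r x * hw
  · rw [(hX.cY_u_pd_p hγ hσ hx).1, hR x hx, hT x hx]
  · rw [hX.cY_ρ_eq hγ hσ hx, hR x hx]
  · rw [hX.cY_p_eq hγ hσ hx, hT x hx]

/-! ### The electric and magnetic coefficients and the equation for `σ`. -/

/-- The gradient of the electric coefficients in the electric field. -/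
theorem Scaling.pd_E {γ : ℝ} {σ : ℝ → ℝ → ℝ} (hσ : IsConductivity σ)
    {X : Phase → Phase} (hX : Admitted γ σ X) {R T : ℝ} (h : Scaling X R T)
    {x : Phase} (hx : x ∈ region) :
    pd (eY .Ez) (cY X .Ez) x = pd (eY .Hθ) (cY X .Hθ) x - T + R ∧
    pd (eY .Eθ) (cY X .Eθ) x = pd (eY .Hz) (cY X .Hz) x - T + R ∧
    pd (eY .Eθ) (cY X .Ez) x = -pd (eY .Hz) (cY X .Hθ) x ∧
    pd (eY .Ez) (cY X .Eθ) x = -pd (eY .Hθ) (cY X .Hz) x := by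
  have d := hX.determining hσ.1 hx
  have hr := (region_r_pos hx).ne'
  have hρ := mul_inv_cancel₀ (region_ρ_pos hx).ne'
  have cancel : ∀ {a b : ℝ}, x.2.2 .r * (a - b) = 0 → a = b := fun h =>
    sub_eq_zero.1 ((mul_eq_zero.1 h).resolve_left hr)
  refine ⟨cancel ?_, cancel ?_, by linear_combination d.Hθ_fs_eq, by linear_combination d.Hz_gs_eq⟩
  · have e := d.Hθ_gs_eq
    rw [h.ρ x hx, h.t x hx, h.r x hx] at e
    linear_combination -e - x.2.2 .r * (pd eS (cS X) x - 2 * R) * hρ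
  · have e := d.Hz_fs_eq
    rw [h.ρ x hx, h.t x hx, h.r x hx] at e
    linear_combination e - x.2.2 .r * (pd eS (cS X) x - 2 * R) * hρ

/-- Ohm's law. -/
theorem Scaling.ohm {γ : ℝ} {σ : ℝ → ℝ → ℝ} (hσ : IsConductivity σ)
    {X : Phase → Phase} (hX : Admitted γ σ X) {R T : ℝ} (h : Scaling X R T)
    {x : Phase} (hx : x ∈ region) :
    (sρ σ (x.2.2 .ρ) (x.2.2 .p) * cY X .ρ x + sp σ (x.2.2 .ρ) (x.2.2 .p) * cY X .p x) * x.2.2 .Ez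
      + σ (x.2.2 .ρ) (x.2.2 .p) * (cY X .Ez x + R * x.2.2 .Ez
        - x.2.2 .Ez * pd (eY .Hθ) (cY X .Hθ) x + x.2.2 .Eθ * pd (eY .Hz) (cY X .Hθ) x)
      - x.2.2 .r * x.2.2 .ρ * pd eS (cY X .Hθ) x = 0 ∧
    (sρ σ (x.2.2 .ρ) (x.2.2 .p) * cY X .ρ x + sp σ (x.2.2 .ρ) (x.2.2 .p) * cY X .p x) * x.2.2 .Eθ
      + σ (x.2.2 .ρ) (x.2.2 .p) * (cY X .Eθ x + R * x.2.2 .Eθ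
        + x.2.2 .Ez * pd (eY .Hθ) (cY X .Hz) x - x.2.2 .Eθ * pd (eY .Hz) (cY X .Hz) x)
      + x.2.2 .r * x.2.2 .ρ * pd eS (cY X .Hz) x = 0 := by
  have d := hX.determining hσ.1 hx
  have hw := mul_inv_cancel₀ (region_r_pos hx).ne'
  have hρ := mul_inv_cancel₀ (region_ρ_pos hx).ne'
  have hrw : x.2.2 .ρ * (σ (x.2.2 .ρ) (x.2.2 .p) * (x.2.2 .ρ)⁻¹) * (x.2.2 .r * (x.2.2 .r)⁻¹)
      = σ (x.2.2 .ρ) (x.2.2 .p) := by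
    rw [hw, mul_one, mul_comm, mul_assoc, inv_mul_cancel₀ (region_ρ_pos hx).ne', mul_one]
  have rs : pd eS (cY X .r) x = 0 := by
    rw [((hasPd_const eS x R).mul (hasPd_coord_eS .r x)).pd_eq (hX.smooth_cY .r) hx h.r]
    ring
  constructor
  · have e := d.Ez_c_eq
    rw [h.r x hx, rs] at e
    linear_combination e + x.2.2 .Ez * ((σ (x.2.2 .ρ) (x.2.2 .p) * (x.2.2 .ρ)⁻¹) * (x.2.2 .r * (x.2.2 .r)⁻¹)) * h.ρ x hx
      - (R * x.2.2 .Ez - x.2.2 .Ez * pd (eY .Hθ) (cY X .Hθ) x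
        + x.2.2 .Eθ * pd (eY .Hz) (cY X .Hθ) x) * hrw
  · have e := d.Eθ_c_eq
    rw [h.r x hx] at e
    linear_combination e + x.2.2 .Eθ * ((σ (x.2.2 .ρ) (x.2.2 .p) * (x.2.2 .ρ)⁻¹) * (x.2.2 .r * (x.2.2 .r)⁻¹)) * h.ρ x hx
      - (R * x.2.2 .Eθ + x.2.2 .Ez * pd (eY .Hθ) (cY X .Hz) x
        - x.2.2 .Eθ * pd (eY .Hz) (cY X .Hz) x) * hrw

/-- The conductivity is a relative invariant. -/
theorem Scaling.sigma_eq {γ : ℝ} {σ : ℝ → ℝ → ℝ} (hσ : IsConductivity σ)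
    {X : Phase → Phase} (hX : Admitted γ σ X) {R T : ℝ} (h : Scaling X R T)
    {x : Phase} (hx : x ∈ region) :
    sρ σ (x.2.2 .ρ) (x.2.2 .p) * cY X .ρ x + sp σ (x.2.2 .ρ) (x.2.2 .p) * cY X .p x
      = σ (x.2.2 .ρ) (x.2.2 .p) * (T - 2 * R) := by
  have ez : ∀ {i : Dep}, i ≠ .Eθ → i ≠ .Ez → Ind (eY .Ez) (cY X i) := hX.ind_Ez hσ
  have cE : HasPd (eY .Ez) (fun z => z.2.2 .Eθ) 0 x := hasPd_other (by decide) x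
  have cr : HasPd (eY .Ez) (fun z => z.2.2 .r) 0 x := hasPd_other (by decide) x
  have cρ : HasPd (eY .Ez) (fun z => z.2.2 .ρ) 0 x := hasPd_other (by decide) x
  have hz := hasPd_self x .Ez
  have F : ∀ F : ℝ → ℝ → ℝ, HasPd (eY .Ez) (fun z => F (z.2.2 .ρ) (z.2.2 .p)) 0 x := fun F =>
    hasPd_of_ρ_p F (by decide) (by decide) x
  -- Ohm's law for `E^z` is differentiated in `E^z`. By `Scaling.pd_E` the magnetic derivative drops
  -- out, and only `σ` and its gradient remain.
  have e := (((((F (sρ σ)).mul ((ez (i := .ρ) (by decide) (by decide)).hasPd hx)).add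
    ((F (sp σ)).mul ((ez (i := .p) (by decide) (by decide)).hasPd hx))).mul hz).add
    ((F σ).mul (((((hX.smooth_cY .Ez).hasPd (eY .Ez) hx).add (hz.const_mul R)).sub
      (hz.mul (((ez (i := .Hθ) (by decide) (by decide)).pd (eY .Hθ)).hasPd hx))).add
      (cE.mul (((ez (i := .Hθ) (by decide) (by decide)).pd (eY .Hz)).hasPd hx))))).sub
    ((cr.mul cρ).mul (((ez (i := .Hθ) (by decide) (by decide)).pd eS).hasPd hx)) |>.eq_zero hx
    fun z hz => (h.ohm hσ hX hz).1
  rw [(h.pd_E hσ hX hx).1] at e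
  linear_combination e

/-- Once the gradient of `σ` is eliminated by `Scaling.sigma_eq`, the energy equation is a multiple
of `σ`, which is cancelled. What remains is the law by which `|E|²` scales. -/
theorem Scaling.joule {γ : ℝ} (hγ : 1 < γ) {σ : ℝ → ℝ → ℝ} (hσ : IsConductivity σ)
    {X : Phase → Phase} (hX : Admitted γ σ X) {R T : ℝ} (h : Scaling X R T)
    {x : Phase} (hx : x ∈ region) :
    (x.2.2 .Eθ * x.2.2 .Eθ + x.2.2 .Ez * x.2.2 .Ez) * (pd eS (cS X) x - (4 * T - 2 * R))
      - 2 * (x.2.2 .Eθ * cY X .Eθ x + x.2.2 .Ez * cY X .Ez x) = 0 := by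
  have sm : Smooth (fun x => (x.2.2 .Eθ * x.2.2 .Eθ + x.2.2 .Ez * x.2.2 .Ez)
      * (pd eS (cS X) x - (4 * T - 2 * R))
      - 2 * (x.2.2 .Eθ * cY X .Eθ x + x.2.2 .Ez * cY X .Ez x)) := by
    have c1 := smooth_coord .Eθ
    have c2 := smooth_coord .Ez
    exact (((c1.mul c1).add (c2.mul c2)).mul ((hX.smooth_cS.pd eS).sub contDiffOn_const)).sub
      (contDiffOn_const.mul ((c1.mul (hX.smooth_cY .Eθ)).add (c2.mul (hX.smooth_cY .Ez))))
  refine hσ.cancel sm (fun x hx => ?_) hx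
  have e := hX.energy_eq hγ hσ hx
  rw [h.sigma_eq hσ hX hx, hX.pd_eT_cY_p hγ hσ hx, pd_eq_zero_of_const h.t eT hx,
    h.t x hx] at e
  refine (mul_eq_zero.1 (?_ : (γ - 1) * _ = 0)).resolve_left (by linarith)
  linear_combination e

/-- The coefficients at the electric field and the gradient of the magnetic ones. -/
theorem Scaling.electric {γ : ℝ} (hγ : 1 < γ) {σ : ℝ → ℝ → ℝ} (hσ : IsConductivity σ)
    {X : Phase → Phase} (hX : Admitted γ σ X) {R T : ℝ} (h : Scaling X R T)
    {x : Phase} (hx : x ∈ region) :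
    pd (eY .Hz) (cY X .Hz) x = pd eS (cS X) x / 2 - T ∧
    pd (eY .Hθ) (cY X .Hθ) x = pd eS (cS X) x / 2 - T ∧
    pd (eY .Hθ) (cY X .Hz) x = -pd (eY .Hz) (cY X .Hθ) x ∧
    cY X .Eθ x = x.2.2 .Eθ * (pd eS (cS X) x / 2 - 2 * T + R)
      + x.2.2 .Ez * pd (eY .Hz) (cY X .Hθ) x ∧
    cY X .Ez x = x.2.2 .Ez * (pd eS (cS X) x / 2 - 2 * T + R)
      - x.2.2 .Eθ * pd (eY .Hz) (cY X .Hθ) x := by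
  have cE : ∀ x, HasPd (eY .Ez) (fun z => z.2.2 .Eθ) 0 x := hasPd_other (by decide)
  have cZ : ∀ x, HasPd (eY .Eθ) (fun z => z.2.2 .Ez) 0 x := hasPd_other (by decide)
  -- `G1` and `G2` are half the `E`-gradient of `Scaling.joule`, with the `E`-derivatives of the
  -- electric coefficients replaced by magnetic ones. Solving them gives the electric coefficients;
  -- differentiating them once more in `E` gives the magnetic gradient.
  have G1 : ∀ x ∈ region, x.2.2 .Eθ * (pd eS (cS X) x - (4 * T - 2 * R)) - cY X .Eθ x
      - x.2.2 .Eθ * (pd (eY .Hz) (cY X .Hz) x - (T - R))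
      + x.2.2 .Ez * pd (eY .Hz) (cY X .Hθ) x = 0 := fun x hx => by
    have s := hasPd_self x .Eθ
    have e := ((((s.mul s).add ((cZ x).mul (cZ x))).mul (((hX.ind_cS hσ .Eθ).hasPd hx).sub
      (hasPd_const _ _ (4 * T - 2 * R)))).sub (((s.mul ((hX.smooth_cY .Eθ).hasPd (eY .Eθ) hx)).add
      ((cZ x).mul ((hX.smooth_cY .Ez).hasPd (eY .Eθ) hx))).const_mul 2)).eq_zero hx
      fun z hz => h.joule hγ hσ hX hz
    obtain ⟨-, h2, h3, -⟩ := h.pd_E hσ hX hx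
    rw [h2, h3] at e
    linear_combination e / 2
  have G2 : ∀ x ∈ region, x.2.2 .Ez * (pd eS (cS X) x - (4 * T - 2 * R)) - cY X .Ez x
      - x.2.2 .Ez * (pd (eY .Hθ) (cY X .Hθ) x - (T - R))
      + x.2.2 .Eθ * pd (eY .Hθ) (cY X .Hz) x = 0 := fun x hx => by
    have s := hasPd_self x .Ez
    have e := (((((cE x).mul (cE x)).add (s.mul s)).mul (((hX.ind_cS hσ .Ez).hasPd hx).sub
      (hasPd_const _ _ (4 * T - 2 * R)))).sub (((((cE x).mul
      ((hX.smooth_cY .Eθ).hasPd (eY .Ez) hx))).add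
      (s.mul ((hX.smooth_cY .Ez).hasPd (eY .Ez) hx))).const_mul 2)).eq_zero hx
      fun z hz => h.joule hγ hσ hX hz
    obtain ⟨h1, -, -, h4⟩ := h.pd_E hσ hX hx
    rw [h1, h4] at e
    linear_combination e / 2
  obtain ⟨h1, h2, h3, h4⟩ := h.pd_E hσ hX hx
  have eθ : ∀ {i : Dep}, i ≠ .Eθ → i ≠ .Ez → Ind (eY .Eθ) (cY X i) := hX.ind_Eθ hσ
  have ez : ∀ {i : Dep}, i ≠ .Eθ → i ≠ .Ez → Ind (eY .Ez) (cY X i) := hX.ind_Ez hσ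
  have zz : pd (eY .Hz) (cY X .Hz) x = pd eS (cS X) x / 2 - T := by
    have s := hasPd_self x .Eθ
    have e := ((((s.mul (((hX.ind_cS hσ .Eθ).hasPd hx).sub (hasPd_const _ _ (4 * T - 2 * R)))).sub
      ((hX.smooth_cY .Eθ).hasPd (eY .Eθ) hx)).sub (s.mul
      ((((eθ (i := .Hz) (by decide) (by decide)).pd (eY .Hz)).hasPd hx).sub
      (hasPd_const _ _ (T - R))))).add ((cZ x).mul
      (((eθ (i := .Hθ) (by decide) (by decide)).pd (eY .Hz)).hasPd hx))).eq_zero hx G1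
    rw [h2] at e
    linear_combination -e / 2
  have θθ : pd (eY .Hθ) (cY X .Hθ) x = pd eS (cS X) x / 2 - T := by
    have s := hasPd_self x .Ez
    have e := ((((s.mul (((hX.ind_cS hσ .Ez).hasPd hx).sub (hasPd_const _ _ (4 * T - 2 * R)))).sub
      ((hX.smooth_cY .Ez).hasPd (eY .Ez) hx)).sub (s.mul
      ((((ez (i := .Hθ) (by decide) (by decide)).pd (eY .Hθ)).hasPd hx).sub
      (hasPd_const _ _ (T - R))))).add ((cE x).mul
      (((ez (i := .Hz) (by decide) (by decide)).pd (eY .Hθ)).hasPd hx))).eq_zero hx G2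
    rw [h1] at e
    linear_combination -e / 2
  have θz : pd (eY .Hθ) (cY X .Hz) x = -pd (eY .Hz) (cY X .Hθ) x := by
    have s := hasPd_self x .Ez
    have e := (((((cE x).mul (((hX.ind_cS hσ .Ez).hasPd hx).sub
      (hasPd_const _ _ (4 * T - 2 * R)))).sub
      ((hX.smooth_cY .Eθ).hasPd (eY .Ez) hx)).sub ((cE x).mul
      ((((ez (i := .Hz) (by decide) (by decide)).pd (eY .Hz)).hasPd hx).sub
      (hasPd_const _ _ (T - R))))).add (s.mul
      (((ez (i := .Hθ) (by decide) (by decide)).pd (eY .Hz)).hasPd hx))).eq_zero hx G1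
    rw [h4] at e
    linear_combination e
  refine ⟨zz, θθ, θz, ?_, ?_⟩
  · linear_combination -G1 x hx - x.2.2 .Eθ * zz
  · linear_combination -G2 x hx - x.2.2 .Ez * θθ + x.2.2 .Eθ * θz

/-- The magnetic coefficients do not depend on `s`. -/
theorem Scaling.pd_eS_H {γ : ℝ} (hγ : 1 < γ) {σ : ℝ → ℝ → ℝ} (hσ : IsConductivity σ)
    {X : Phase → Phase} (hX : Admitted γ σ X) {R T : ℝ} (h : Scaling X R T)
    {x : Phase} (hx : x ∈ region) : pd eS (cY X .Hθ) x = 0 ∧ pd eS (cY X .Hz) x = 0 := by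
  obtain ⟨e1, e2⟩ := h.ohm hσ hX hx
  obtain ⟨zz, θθ, θz, hE, hZ⟩ := h.electric hγ hσ hX hx
  -- After these substitutions all terms with the factor `σ` cancel, and only the `s`-derivatives
  -- remain in Ohm's law.
  rw [h.sigma_eq hσ hX hx, hE, zz, θz] at e2
  rw [h.sigma_eq hσ hX hx, hZ, θθ] at e1
  have hrρ : x.2.2 .r * x.2.2 .ρ ≠ 0 := mul_ne_zero (region_r_pos hx).ne' (region_ρ_pos hx).ne'
  exact ⟨(mul_eq_zero.1 (by linear_combination -e1 : (x.2.2 .r * x.2.2 .ρ) * _ = 0)).resolve_left hrρ,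
    (mul_eq_zero.1 (by linear_combination e2 : (x.2.2 .r * x.2.2 .ρ) * _ = 0)).resolve_left hrρ⟩

/-- Ohm's law involves `H^θ` only through `(r H^θ)_s`, so its `s`-coefficients give `H^θ ∂η^r + r
∂η^{Hθ} = 0`, where `η^r = R r` contributes nothing. -/
theorem Scaling.ind_u_Hθ {γ : ℝ} {σ : ℝ → ℝ → ℝ} (hσ : IsConductivity σ)
    {X : Phase → Phase} (hX : Admitted γ σ X) {R T : ℝ} (h : Scaling X R T) {z : Dep}
    (hr : z ≠ .r) (hHθ : z ≠ .Hθ) (hHz : z ≠ .Hz) : Ind (eY z) (cY X .Hθ) := by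
  refine ⟨hX.smooth_cY _, fun x hx => ?_⟩
  have d := hX.determining hσ.1 hx
  have r0 : pd (eY z) (cY X .r) x = 0 :=
    (Ind.congr ((Ind.const _ R).mul (Ind.coord hr.symm)) h.r).zero x hx
  have cancel : ∀ e : ℝ, x.2.2 .Hθ * pd (eY z) (cY X .r) x + x.2.2 .r * e = 0 → e = 0 :=
    fun e he => by
      rw [r0, mul_zero, zero_add] at he
      exact (mul_eq_zero.1 he).resolve_left (region_r_pos hx).ne'
  cases z with
  | r => exact absurd rfl hr
  | Hθ => exact absurd rfl hHθ
  | Hz => exact absurd rfl hHz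
  | Eθ => exact (hX.ind_Eθ hσ (by decide) (by decide)).zero x hx
  | Ez => exact (hX.ind_Ez hσ (by decide) (by decide)).zero x hx
  | θ => exact cancel _ d.Hθ_θ_eq
  | u => exact cancel _ d.Hθ_u_eq
  | v => exact cancel _ d.Hθ_v_eq
  | ρ => exact cancel _ d.Hθ_ρ_eq
  | p => exact cancel _ d.Hθ_p_eq

/-- The magnetic coefficients are linear in the magnetic field. -/
theorem Scaling.magnetic {γ : ℝ} (hγ : 1 < γ) {σ : ℝ → ℝ → ℝ} (hσ : IsConductivity σ)
    {X : Phase → Phase} (hX : Admitted γ σ X) {R T : ℝ} (h : Scaling X R T)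
    {x : Phase} (hx : x ∈ region) :
    cY X .Hθ x = x.2.2 .Hθ * (pd eS (cS X) x / 2 - T) + x.2.2 .Hz * pd (eY .Hz) (cY X .Hθ) x ∧
    cY X .Hz x = x.2.2 .Hz * (pd eS (cS X) x / 2 - T) - x.2.2 .Hθ * pd (eY .Hz) (cY X .Hθ) x := by
  have d := hX.determining hσ.1 hx
  obtain ⟨zz, θθ, θz, -, -⟩ := h.electric hγ hσ hX hx
  have hr := (region_r_pos hx).ne'
  have hρ := mul_inv_cancel₀ (region_ρ_pos hx).ne'
  have uu : pd (eY .u) (cY X .u) x = R - T := by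
    rw [((hasPd_self x .u).mul (hasPd_const _ _ (R - T))).pd_eq (hX.smooth_cY .u) hx h.u]
    ring
  have q := (h.ind_u_Hθ hσ hX (z := .u) (by decide) (by decide) (by decide)).pd (eY .Hz)
  have K : Ind (eY .u) (fun x => pd eS (cS X) x / 2 - 2 * T + R) :=
    (((hX.ind_cS hσ .u).mul (Ind.const _ 2⁻¹)).sub (Ind.const _ (2 * T))).add (Ind.const _ R)
  -- As the electric coefficients do not involve `u`, the `u_s`-coefficients of the induction
  -- equations become algebraic equations for the magnetic coefficients.
  have Eu : pd (eY .u) (cY X .Eθ) x = 0 :=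
    ((((Ind.coord (by decide)).mul K).add ((Ind.coord (by decide)).mul q)).congr
      fun x hx => (h.electric hγ hσ hX hx).2.2.2.1).zero x hx
  have Zu : pd (eY .u) (cY X .Ez) x = 0 :=
    ((((Ind.coord (by decide)).mul K).sub ((Ind.coord (by decide)).mul q)).congr
      fun x hx => (h.electric hγ hσ hX hx).2.2.2.2).zero x hx
  have cancel : ∀ {a b : ℝ}, x.2.2 .r * (a - b) = 0 → a = b := fun h =>
    sub_eq_zero.1 ((mul_eq_zero.1 h).resolve_left hr)
  constructor
  · have e := d.Hθ_us_eq
    rw [(h.ind_u_Hθ hσ hX (z := .ρ) (by decide) (by decide) (by decide)).zero x hx,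
      (h.ind_u_Hθ hσ hX (z := .p) (by decide) (by decide) (by decide)).zero x hx,
      Zu, uu, θθ, h.ρ x hx, h.r x hx, h.t x hx] at e
    refine cancel ?_
    linear_combination e - x.2.2 .r * (pd eS (cS X) x - 2 * R) * x.2.2 .Hθ * hρ
  · have e := d.Hz_us_eq
    rw [Eu, uu, zz, θz, h.ρ x hx, h.r x hx, h.t x hx] at e
    refine cancel ?_
    linear_combination e - x.2.2 .r * (pd eS (cS X) x - 2 * R) * x.2.2 .Hz * hρ

/-! ### The momentum equation, the magnetic rotation and the angle. -/

/-- In the free term of the momentum equation the Lorentz force scales consistently and drops out;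
only the centrifugal term and the `s`-dependence of the pressure coefficient are left. -/
theorem Scaling.momentum {γ : ℝ} (hγ : 1 < γ) {σ : ℝ → ℝ → ℝ} (hσ : IsConductivity σ)
    {X : Phase → Phase} (hX : Admitted γ σ X) {R T : ℝ} (h : Scaling X R T)
    {x : Phase} (hx : x ∈ region) :
    2 * (x.2.2 .v * (x.2.2 .r)⁻¹) * (x.2.2 .v * (R - T) - cY X .v x)
      + x.2.2 .p * (x.2.2 .r * pd eS (pd eS (cS X)) x) = 0 := by
  have e := (hX.determining hσ.1 hx).u_c_eq
  obtain ⟨zz, θθ, θz, -, -⟩ := h.electric hγ hσ hX hx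
  obtain ⟨m1, m2⟩ := h.magnetic hγ hσ hX hx
  obtain ⟨s1, s2⟩ := h.pd_eS_H hγ hσ hX hx
  have u0 : ∀ z, z ≠ .u → pd (eY z) (cY X .u) x = 0 := fun z hz =>
    (Ind.congr ((Ind.coord hz.symm).mul (Ind.const _ (R - T))) h.u).zero x hx
  have ut : pd eT (cY X .u) x = 0 := by
    rw [((hasPd_coord_eT .u x).mul (hasPd_const _ _ (R - T))).pd_eq (hX.smooth_cY .u) hx h.u]
    ring
  have uu : pd (eY .u) (cY X .u) x = R - T := by
    rw [((hasPd_self x .u).mul (hasPd_const _ _ (R - T))).pd_eq (hX.smooth_cY .u) hx h.u]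
    ring
  have rs : pd eS (cY X .r) x = 0 := by
    rw [((hasPd_const eS x R).mul (hasPd_coord_eS .r x)).pd_eq (hX.smooth_cY .r) hx h.r]
    ring
  have ps : pd eS (cY X .p) x = x.2.2 .p * pd eS (pd eS (cS X)) x := by
    rw [((hasPd_coord_eS .p x).mul (((hX.smooth_cS.pd eS).hasPd eS hx).sub
      (hasPd_const _ _ (2 * T)))).pd_eq (hX.smooth_cY .p) hx h.p]
    ring
  rw [ut, u0 .r (by decide), u0 .θ (by decide), u0 .v (by decide), u0 .p (by decide), uu, rs, ps,
    h.t x hx, h.r x hx, s1, s2, zz, θθ, θz, m1, m2] at e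
  have hw := mul_inv_cancel₀ (region_r_pos hx).ne'
  linear_combination e - x.2.2 .v ^ 2 * R * (x.2.2 .r)⁻¹ * hw
    - (R - 2 * T) * (x.2.2 .Hθ * x.2.2 .Ez - x.2.2 .Hz * x.2.2 .Eθ)
      * (σ (x.2.2 .ρ) (x.2.2 .p) * (x.2.2 .ρ)⁻¹) * hw

/-- `Scaling.momentum` is affine in `p`, since the coefficient at `v` does not depend on `p`; its
slope is `r` times the second derivative of `ξ^s`. -/
theorem Scaling.exists_pd_cS_eq {γ : ℝ} (hγ : 1 < γ) {σ : ℝ → ℝ → ℝ} (hσ : IsConductivity σ)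
    {X : Phase → Phase} (hX : Admitted γ σ X) {R T : ℝ} (h : Scaling X R T) :
    ∃ S : ℝ, ∀ x ∈ region, pd eS (cS X) x = S := by
  refine ⟨_, fun x hx => const_of_pd_eq_zero (hX.smooth_cS.pd eS) (hX.ind_eT_cS hσ).zero
    (fun x hx => ?_) (fun i => (hX.ind_cS hσ i).zero) hx⟩
  have cv : Ind (eY .p) (fun x => x.2.2 .v) := Ind.coord (by decide)
  have cw : Ind (eY .p) (fun x => (x.2.2 .r)⁻¹) := Ind.inv_r (by decide)
  have hv := hX.ind_kinematic hγ hσ (i := .v) (z := .p) (by decide) (by decide) (by decide)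
    (by decide)
  have cr : Ind (eY .p) (fun x => x.2.2 .r) := Ind.coord (by decide)
  have e := ((((Ind.const _ 2).mul (cv.mul cw)).mul ((cv.mul (Ind.const _ (R - T))).sub
    hv)).hasPd hx).add ((hasPd_self x .p).mul ((cr.mul ((hX.ind_cS hσ .p).pd eS)).hasPd hx))
    |>.eq_zero hx fun z hz => h.momentum hγ hσ hX hz
  refine (mul_eq_zero.1 (?_ : x.2.2 .r * _ = 0)).resolve_left (region_r_pos hx).ne'
  linear_combination e

/-- With constant `∂_s ξ^s` the momentum identity becomes `v (v (R - T) - η^v) = 0`, and `v` is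
cancelled, also where it vanishes. -/
theorem Scaling.cY_v_eq {γ : ℝ} (hγ : 1 < γ) {σ : ℝ → ℝ → ℝ} (hσ : IsConductivity σ)
    {X : Phase → Phase} (hX : Admitted γ σ X) {R T S : ℝ} (h : Scaling X R T)
    (hS : ∀ x ∈ region, pd eS (cS X) x = S) : ∀ x ∈ region, cY X .v x = x.2.2 .v * (R - T) := by
  have sm : Smooth (fun x => x.2.2 .v * (R - T) - cY X .v x) :=
    ((smooth_coord .v).mul contDiffOn_const).sub (hX.smooth_cY .v)
  intro x hx
  refine (sub_eq_zero.1 (eq_zero_of_coord_mul sm .v (fun x hx => ?_) x hx)).symm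
  have e := h.momentum hγ hσ hX hx
  rw [pd_eq_zero_of_const hS eS hx] at e
  have hw := mul_inv_cancel₀ (region_r_pos hx).ne'
  linear_combination x.2.2 .r / 2 * e - x.2.2 .v * (x.2.2 .v * (R - T) - cY X .v x) * hw

/-- There is no rotation of the magnetic field. -/
theorem Scaling.pd_Hz_Hθ {γ : ℝ} (hγ : 1 < γ) {σ : ℝ → ℝ → ℝ} (hσ : IsConductivity σ)
    {X : Phase → Phase} (hX : Admitted γ σ X) {R T S : ℝ} (h : Scaling X R T)
    (hS : ∀ x ∈ region, pd eS (cS X) x = S) : ∀ x ∈ region, pd (eY .Hz) (cY X .Hθ) x = 0 := by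
  have qHθ : Ind (eY .Hθ) (pd (eY .Hz) (cY X .Hθ)) :=
    ⟨(hX.smooth_cY .Hθ).pd _, fun x hx => by
      rw [pd_comm (hX.smooth_cY .Hθ) _ _ hx]
      refine pd_eq_zero_of_const (c := S / 2 - T) (fun x hx => ?_) _ hx
      rw [(h.electric hγ hσ hX hx).2.1, hS x hx]⟩
  have qHz : Ind (eY .Hz) (pd (eY .Hz) (cY X .Hθ)) :=
    ⟨(hX.smooth_cY .Hθ).pd _, fun x hx => by
      have h1 : ∀ x ∈ region, pd (eY .Hz) (cY X .Hθ) x = 0 - pd (eY .Hθ) (cY X .Hz) x :=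
        fun x hx => by rw [(h.electric hγ hσ hX hx).2.2.1]; ring
      rw [((hasPd_const _ _ 0).sub (((hX.smooth_cY .Hz).pd (eY .Hθ)).hasPd (eY .Hz) hx)).pd_eq
        ((hX.smooth_cY .Hθ).pd _) hx h1, pd_comm (hX.smooth_cY .Hz) _ _ hx,
        pd_eq_zero_of_const (c := S / 2 - T) (fun x hx => ?_) _ hx, sub_zero]
      rw [(h.electric hγ hσ hX hx).1, hS x hx]⟩
  -- For the rotation rate `q = ∂_{H^z} η^{Hθ}` the `r_s`-coefficients of the two Ohm laws give `q +
  -- r q_r = 0` here and `r q_r - q = 0` in `hr2`, because one law contains `r H^θ` and the other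
  -- `H^z`. Together they force `q = 0`.
  have hr1 : ∀ x ∈ region, x.2.2 .Hz * (pd (eY .Hz) (cY X .Hθ) x
      + x.2.2 .r * pd (eY .r) (pd (eY .Hz) (cY X .Hθ)) x) = 0 := fun x hx => by
    have e := (hX.determining hσ.1 hx).Hθ_rs_eq
    have m := fun x hx => hS x hx ▸ (h.magnetic hγ hσ hX hx).1
    have e1 := (((hasPd_other (i := .r) (j := .Hθ) (by decide) x).mul
      (hasPd_const _ _ (S / 2 - T))).add ((hasPd_other (i := .r) (j := .Hz) (by decide) x).mul
      (((hX.smooth_cY .Hθ).pd (eY .Hz)).hasPd (eY .r) hx))).pd_eq (hX.smooth_cY .Hθ) hx m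
    have rr : pd (eY .r) (cY X .r) x = R := by
      rw [((hasPd_const _ _ R).mul (hasPd_self x .r)).pd_eq (hX.smooth_cY .r) hx h.r]
      ring
    rw [e1, rr, h.r x hx, m x hx, hS x hx, (h.electric hγ hσ hX hx).2.1, hS x hx] at e
    have hw := mul_inv_cancel₀ (region_r_pos hx).ne'
    linear_combination e + x.2.2 .Hθ * (R - S + (S / 2 - T)) * hw
  have hr2 : ∀ x ∈ region, x.2.2 .Hθ * (pd (eY .r) (pd (eY .Hz) (cY X .Hθ)) x
      - (x.2.2 .r)⁻¹ * pd (eY .Hz) (cY X .Hθ) x) = 0 := fun x hx => by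
    have e := (hX.determining hσ.1 hx).Hz_rs_eq
    have m := fun x hx => hS x hx ▸ (h.magnetic hγ hσ hX hx).2
    have e1 := (((hasPd_other (i := .r) (j := .Hz) (by decide) x).mul
      (hasPd_const _ _ (S / 2 - T))).sub ((hasPd_other (i := .r) (j := .Hθ) (by decide) x).mul
      (((hX.smooth_cY .Hθ).pd (eY .Hz)).hasPd (eY .r) hx))).pd_eq (hX.smooth_cY .Hz) hx m
    rw [e1, (h.electric hγ hσ hX hx).2.2.1] at e
    linear_combination -e
  intro x hx
  have q0 := (hX.smooth_cY .Hθ).pd (eY .Hz)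
  have a := eq_zero_of_coord_mul (q0.add ((smooth_coord .r).mul (q0.pd (eY .r)))) .Hz hr1 x hx
  have b := eq_zero_of_coord_mul ((q0.pd (eY .r)).sub (smooth_inv_r.mul q0)) .Hθ hr2 x hx
  have hw := mul_inv_cancel₀ (region_r_pos hx).ne'
  linear_combination a / 2 - x.2.2 .r / 2 * b - pd (eY .Hz) (cY X .Hθ) x / 2 * hw

/-- The coefficient at `∂_θ` is constant along the trajectories. -/
theorem Scaling.transport_θ {γ : ℝ} (hγ : 1 < γ) {σ : ℝ → ℝ → ℝ} (hσ : IsConductivity σ)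
    {X : Phase → Phase} (hX : Admitted γ σ X) {R T S : ℝ} (h : Scaling X R T)
    (hS : ∀ x ∈ region, pd eS (cS X) x = S) {x : Phase} (hx : x ∈ region) :
    pd eT (cY X .θ) x = 0 ∧ pd (eY .θ) (cY X .θ) x = 0 ∧
    x.2.2 .r * pd (eY .r) (cY X .θ) x = x.2.2 .v * pd (eY .v) (cY X .θ) x := by
  have ind : ∀ z, z ≠ .r → z ≠ .θ → z ≠ .v → Ind (eY z) (cY X .θ) := fun z h1 h2 h3 =>
    hX.ind_kinematic hγ hσ (by decide) h1 h2 h3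
  have sm := hX.smooth_cY .θ
  have e : ∀ x ∈ region, pd eT (cY X .θ) x + x.2.2 .v * (x.2.2 .r)⁻¹ * pd (eY .θ) (cY X .θ) x
      + x.2.2 .u * (pd (eY .r) (cY X .θ) x
      - x.2.2 .v * (x.2.2 .r)⁻¹ * pd (eY .v) (cY X .θ) x) = 0 := fun x hx => by
    have e := (hX.determining hσ.1 hx).θ_c_eq
    rw [(ind .p (by decide) (by decide) (by decide)).zero x hx, h.t x hx, h.r x hx,
      h.cY_v_eq hγ hσ hX hS x hx] at e
    have hw := mul_inv_cancel₀ (region_r_pos hx).ne'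
    linear_combination e - x.2.2 .v * R * (x.2.2 .r)⁻¹ * hw
  have iu := ind .u (by decide) (by decide) (by decide)
  have cvw : Ind (eY .u) (fun x => x.2.2 .v * (x.2.2 .r)⁻¹) :=
    (Ind.coord (by decide)).mul (Ind.inv_r (by decide))
  -- The identity `e` is affine in `u`: its slope gives `er`, the rest gives `et`.
  have er : ∀ x ∈ region, x.2.2 .r * pd (eY .r) (cY X .θ) x
      - x.2.2 .v * pd (eY .v) (cY X .θ) x = 0 := fun x hx => by
    have := ((((iu.pd eT).add (cvw.mul (iu.pd (eY .θ)))).hasPd hx).add ((hasPd_self x .u).mul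
      (((iu.pd (eY .r)).sub (cvw.mul (iu.pd (eY .v)))).hasPd hx))).eq_zero hx e
    have hw := mul_inv_cancel₀ (region_r_pos hx).ne'
    linear_combination x.2.2 .r * this + x.2.2 .v * pd (eY .v) (cY X .θ) x * hw
  have et : ∀ x ∈ region, x.2.2 .r * pd eT (cY X .θ) x
      + x.2.2 .v * pd (eY .θ) (cY X .θ) x = 0 := fun x hx => by
    have hw := mul_inv_cancel₀ (region_r_pos hx).ne'
    linear_combination x.2.2 .r * e x hx - x.2.2 .u * er x hx
      + (x.2.2 .u * x.2.2 .v * pd (eY .v) (cY X .θ) x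
        - x.2.2 .v * pd (eY .θ) (cY X .θ) x) * hw
  have comm : ∀ e' : Phase, e'.2.2 .r = 0 → e'.2.2 .v = 0 → ∀ x ∈ region,
      x.2.2 .r * pd (eY .r) (pd e' (cY X .θ)) x = x.2.2 .v * pd (eY .v) (pd e' (cY X .θ)) x := by
    intro e' hr hv x hx
    have := (((hasPd_coord e' x .r).mul ((sm.pd (eY .r)).hasPd e' hx)).sub
      ((hasPd_coord e' x .v).mul ((sm.pd (eY .v)).hasPd e' hx))).eq_zero hx er
    rw [hr, hv, pd_comm sm e' _ hx, pd_comm sm e' _ hx] at this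
    linear_combination this
  -- The operator `r ∂_r - v ∂_v` annihilates the coefficient `η` at `∂_θ` and commutes with `∂_t`
  -- and `∂_θ`. Applied to `r η_t + v η_θ = 0` it gives `r η_t - v η_θ = 0`, and the difference is
  -- `2 v η_θ = 0`.
  have hθ : ∀ x ∈ region, pd (eY .θ) (cY X .θ) x = 0 := by
    refine eq_zero_of_coord_mul (sm.pd _) .v fun x hx => ?_
    have dr := (((hasPd_self x .r).mul ((sm.pd eT).hasPd (eY .r) hx)).add
      ((hasPd_other (i := .r) (j := .v) (by decide) x).mul
        ((sm.pd (eY .θ)).hasPd (eY .r) hx))).eq_zero hx et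
    have dv := (((hasPd_other (i := .v) (j := .r) (by decide) x).mul
      ((sm.pd eT).hasPd (eY .v) hx)).add ((hasPd_self x .v).mul
        ((sm.pd (eY .θ)).hasPd (eY .v) hx))).eq_zero hx et
    have c1 := comm eT rfl rfl x hx
    have c2 := comm (eY .θ) (by simp [eY]) (by simp [eY]) x hx
    linear_combination (et x hx) / 2 - x.2.2 .r / 2 * dr + x.2.2 .v / 2 * dv
      + x.2.2 .r / 2 * c1 + x.2.2 .v / 2 * c2
  refine ⟨?_, hθ x hx, sub_eq_zero.1 (er x hx)⟩
  have := et x hx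
  rw [hθ x hx, mul_zero, add_zero] at this
  exact (mul_eq_zero.1 this).resolve_left (region_r_pos hx).ne'

theorem hasPd_fst (e x : Phase) : HasPd e (fun z => z.1) e.1 x := by
  have h := ((hasDerivAt_id (0 : ℝ)).mul_const e.1).const_add x.1
  simpa [HasPd, HasLineDerivAt] using h

theorem hasPd_snd_fst (e x : Phase) : HasPd e (fun z => z.2.1) e.2.1 x := by
  have h := ((hasDerivAt_id (0 : ℝ)).mul_const e.2.1).const_add x.2.1
  simpa [HasPd, HasLineDerivAt] using h

/-- The point of the region with `r = ρ = p = 1` and given `s`, `v`. -/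
def anglePoint (q : ℝ × ℝ) : Phase := (0, q.1, fun
  | .r => 1
  | .v => q.2
  | .ρ => 1
  | .p => 1
  | _ => 0)

theorem anglePoint_mem (q : ℝ × ℝ) : anglePoint q ∈ region := by
  simp [anglePoint, region]

theorem contDiff_anglePoint : ContDiff ℝ ∞ anglePoint := by
  refine contDiff_const.prodMk (contDiff_fst.prodMk (contDiff_pi.2 fun i => ?_))
  cases i
  all_goals first | exact contDiff_const | exact contDiff_snd

/-- A function of `s`, `r`, `v` that is invariant under the flow `r ∂_r - v ∂_v` depends on `s`
and `r v` only. -/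
theorem eq_anglePoint {f : Phase → ℝ} (hf : Smooth f) (ht : ∀ x ∈ region, pd eT f x = 0)
    (hz : ∀ z, z ≠ .r → z ≠ .v → ∀ x ∈ region, pd (eY z) f x = 0)
    (hr : ∀ x ∈ region, x.2.2 .r * pd (eY .r) f x = x.2.2 .v * pd (eY .v) f x)
    {x : Phase} (hx : x ∈ region) :
    f x = f (anglePoint (x.2.1, x.2.2 .r * x.2.2 .v)) := by
  obtain ⟨t, s, y⟩ := x
  have h1 := region_r_pos hx
  have h2 := region_ρ_pos hx
  have h3 := region_p_pos hx
  dsimp only at h1 h2 h3 ⊢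
  -- A path inside the region from the given point to `anglePoint`: `r` moves linearly to 1 while
  -- `v` is adjusted to keep `r v` fixed. So its `(r, v)`-velocity is proportional to `r ∂_r - v
  -- ∂_v`.
  let b : ℝ → Dep → ℝ := fun l i => match i with
    | .r => y .r + l * (1 - y .r)
    | .v => y .r * y .v / (y .r + l * (1 - y .r))
    | .ρ => y .ρ + l * (1 - y .ρ)
    | .p => y .p + l * (1 - y .p)
    | i => y i + l * (0 - y i)
  let b' : ℝ → Dep → ℝ := fun l i => match i with
    | .r => 1 - y .r
    | .v => -(y .r * y .v * (1 - y .r)) / (y .r + l * (1 - y .r)) ^ 2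
    | .ρ => 1 - y .ρ
    | .p => 1 - y .p
    | i => 0 - y i
  let c : ℝ → Phase := fun l => (t + l * (0 - t), s, b l)
  have line : ∀ a d l : ℝ, HasDerivAt (fun l : ℝ => a + l * d) d l := fun a d l => by
    simpa using ((hasDerivAt_id l).mul_const d).const_add a
  have pos : ∀ a : ℝ, 0 < a → ∀ l ∈ Icc (0 : ℝ) 1, 0 < a + l * (1 - a) := fun a ha l hl => by
    rcases eq_or_lt_of_le hl.1 with h0 | h0
    · simpa [← h0] using ha
    · nlinarith [mul_nonneg (sub_nonneg.2 hl.2) ha.le]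
  have hmem : ∀ l ∈ Icc (0 : ℝ) 1, c l ∈ region := fun l hl =>
    ⟨pos _ h1 l hl, pos _ h2 l hl, pos _ h3 l hl⟩
  have hc : ∀ l ∈ Icc (0 : ℝ) 1, HasDerivAt c (0 - t, 0, b' l) l := fun l hl => by
    refine (line t (0 - t) l).prodMk ((hasDerivAt_const l s).prodMk (hasDerivAt_pi.2 fun i => ?_))
    cases i
    case v =>
      refine ((hasDerivAt_const l (y .r * y .v)).div (line (y .r) (1 - y .r) l)
        (pos _ h1 l hl).ne').congr_deriv ?_
      simp only [b']
      ring
    all_goals exact line _ _ l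
  have hd : ∀ l ∈ Icc (0 : ℝ) 1, HasDerivAt (fun l => f (c l)) 0 l := fun l hl => by
    have hm := hmem l hl
    refine ((hf.differentiableAt hm).hasFDerivAt.comp_hasDerivAt l (hc l hl)).congr_deriv ?_
    rw [fderiv_apply_eq, ht _ hm, hz .θ (by decide) (by decide) _ hm,
      hz .u (by decide) (by decide) _ hm, hz .ρ (by decide) (by decide) _ hm,
      hz .p (by decide) (by decide) _ hm, hz .Eθ (by decide) (by decide) _ hm,
      hz .Ez (by decide) (by decide) _ hm, hz .Hθ (by decide) (by decide) _ hm,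
      hz .Hz (by decide) (by decide) _ hm]
    have hp := (pos _ h1 l hl).ne'
    have e := hr _ hm
    generalize pd (eY .r) f (c l) = A at e ⊢
    generalize pd (eY .v) f (c l) = B at e ⊢
    change (y .r + l * (1 - y .r)) * A = y .r * y .v / (y .r + l * (1 - y .r)) * B at e
    simp only [b']
    generalize y .r + l * (1 - y .r) = a at *
    field_simp at e ⊢
    linear_combination (1 - y .r) * e
  have := constant_of_has_deriv_right_zero (f := fun l => f (c l)) (a := 0) (b := 1)
    (fun l hl => (hd l hl).continuousAt.continuousWithinAt)
    (fun l hl => (hd l ⟨hl.1, hl.2.le⟩).hasDerivWithinAt) 1 (by simp)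
  have c1 : c 1 = anglePoint (s, y .r * y .v) := by
    refine Prod.ext (by simp [c, anglePoint]) (Prod.ext rfl (funext fun i => ?_))
    cases i <;> simp [c, b, anglePoint]
  have c0 : c 0 = (t, s, y) := by
    refine Prod.ext (by simp [c]) (Prod.ext rfl (funext fun i => ?_))
    cases i <;> simp [c, b, h1.ne']
  simp only [c0, c1] at this
  exact this.symm

/-! ### Scaling fields and the normal form of a generator. -/

/-- The combination `a₃ Y₃ + a₄ Y₄ + a₅ Y₅`. -/
def scalingField : (ℝ × ℝ × ℝ) →ₗ[ℝ] (Phase → Phase) where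
  toFun a := a.1 • Y3 + a.2.1 • Y4 + a.2.2 • Y5
  map_add' a b := by simp only [Prod.fst_add, Prod.snd_add]; module
  map_smul' c a := by simp only [Prod.smul_fst, Prod.smul_snd, smul_eq_mul, RingHom.id_apply]; module

/-- The weights of `ρ`, `p` and `σ` under a scaling. -/
def wρ (a : ℝ × ℝ × ℝ) : ℝ := 2 * a.1 - 4 * a.2.1 + 2 * a.2.2
def wp (a : ℝ × ℝ × ℝ) : ℝ := 2 * a.2.2 - 2 * a.2.1
def wσ (a : ℝ × ℝ × ℝ) : ℝ := a.1 - 2 * a.2.1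

/-- `σ` is a relative invariant of the scaling with the parameters `a`. -/
def Invariant (σ : ℝ → ℝ → ℝ) (a : ℝ × ℝ × ℝ) : Prop := ∀ ρ p : ℝ, 0 < ρ → 0 < p →
  wρ a * ρ * sρ σ ρ p + wp a * p * sp σ ρ p = wσ a * σ ρ p

/-- The general form of an admitted generator. -/
theorem Admitted.normal_form {γ : ℝ} (hγ : 1 < γ) {σ : ℝ → ℝ → ℝ} (hσ : IsConductivity σ)
    {X : Phase → Phase} (hX : Admitted γ σ X) :
    ∃ (a₁ a₂ : ℝ) (h : ℝ → ℝ → ℝ) (a : ℝ × ℝ × ℝ), ContDiff ℝ ∞ (fun q : ℝ × ℝ => h q.1 q.2) ∧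
      Invariant σ a ∧ EqOn X (a₁ • Y1 + a₂ • Y2 + Yθ h + scalingField a) region := by
  obtain ⟨R, T, h⟩ := hX.exists_scaling hγ hσ
  obtain ⟨S, hS⟩ := h.exists_pd_cS_eq hγ hσ hX
  have smt : Smooth (fun x : Phase => x.1) := contDiff_fst.contDiffOn
  have sms : Smooth (fun x : Phase => x.2.1) := contDiff_snd.fst.contDiffOn
  have st : Smooth (fun x => cT X x - T * x.1) := hX.smooth_cT.sub (contDiffOn_const.mul smt)
  have ss : Smooth (fun x => cS X x - S * x.2.1) := hX.smooth_cS.sub (contDiffOn_const.mul sms)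
  have dt : ∀ e, ∀ x ∈ region, pd e (fun x => cT X x - T * x.1) x = pd e (cT X) x - T * e.1 :=
    fun e x hx => ((hX.smooth_cT.hasPd e hx).sub ((hasPd_fst e x).const_mul T)).pd_eq st hx
      fun _ _ => rfl
  have ds : ∀ e, ∀ x ∈ region, pd e (fun x => cS X x - S * x.2.1) x = pd e (cS X) x - S * e.2.1 :=
    fun e x hx => ((hX.smooth_cS.hasPd e hx).sub ((hasPd_snd_fst e x).const_mul S)).pd_eq ss hx
      fun _ _ => rfl
  have hP := fun x hx => hX.projectable (x := x) hσ.1 hx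
  have ct := fun x hx => const_of_pd_eq_zero (x := x) st
    (fun x hx => by rw [dt _ x hx, h.t x hx]; simp [eT])
    (fun x hx => by rw [dt _ x hx, (hP x hx).1.1]; simp [eS])
    (fun i x hx => by rw [dt _ x hx, (hP x hx).1.2 i]; simp [eY]) hx
  have cs := fun x hx => const_of_pd_eq_zero (x := x) ss
    (fun x hx => by rw [ds _ x hx, (hP x hx).2.1.1]; simp [eT])
    (fun x hx => by rw [ds _ x hx, hS x hx]; simp [eS])
    (fun i x hx => by rw [ds _ x hx, (hP x hx).2.1.2 i]; simp [eY]) hx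
  -- The parameters are read off from the action on `t`, `r` and `s`: `a₃ = T`, `a₄ = R`, and `2 a₃
  -- - 2 a₄ + 2 a₅ = S`.
  refine ⟨cT X basePoint - T * basePoint.1, cS X basePoint - S * basePoint.2.1,
    fun s w => cY X .θ (anglePoint (s, w)), (T, R, S / 2 - T + R), ?_, ?_, ?_⟩
  · exact (hX.smooth_cY .θ).comp_contDiff contDiff_anglePoint anglePoint_mem
  · intro ρ p hρ hp
    have hx : ((0, 0, fun i => if i = .ρ then ρ else if i = .p then p else 1) : Phase) ∈ region := by
      simp [region, hρ, hp]
    have := h.sigma_eq hσ hX hx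
    rw [h.ρ _ hx, h.p _ hx, hS _ hx] at this
    simp only [reduceCtorEq, if_true, if_false] at this
    simp only [wρ, wp, wσ]
    linear_combination this
  · intro x hx
    obtain ⟨zz, θθ, θz, e1, e2⟩ := h.electric hγ hσ hX hx
    obtain ⟨m1, m2⟩ := h.magnetic hγ hσ hX hx
    have q := h.pd_Hz_Hθ hγ hσ hX hS x hx
    rw [q, hS x hx] at e1 e2 m1 m2
    refine Prod.ext ?_ (Prod.ext ?_ (funext fun i => ?_))
    · simp [scalingField, Y1, Y2, Yθ, Y3, Y4, Y5]
      have := ct x hx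
      simp only [cT] at this ⊢
      linear_combination this
    · simp [scalingField, Y1, Y2, Yθ, Y3, Y4, Y5]
      have := cs x hx
      simp only [cS] at this ⊢
      linear_combination this
    · change cY X i x = _
      have er := h.r x hx
      have eu := h.u x hx
      have eρ := h.ρ x hx
      have ep := h.p x hx
      have ev := h.cY_v_eq hγ hσ hX hS x hx
      rw [hS x hx] at eρ ep
      have eθ := eq_anglePoint (hX.smooth_cY .θ)
        (fun x hx => (h.transport_θ hγ hσ hX hS hx).1)
        (fun z h1 h2 x hx => by
          by_cases h3 : z = .θ
          · exact h3 ▸ (h.transport_θ hγ hσ hX hS hx).2.1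
          · exact (hX.ind_kinematic hγ hσ (by decide) h1 h3 h2).zero x hx)
        (fun x hx => (h.transport_θ hγ hσ hX hS hx).2.2) hx
      cases i <;> simp [scalingField, Y1, Y2, Yθ, Y3, Y4, Y5]
      · linear_combination er
      · exact eθ
      · linear_combination eu
      · linear_combination ev
      · linear_combination eρ
      · linear_combination ep
      · linear_combination e1
      · linear_combination e2
      · linear_combination m1
      · linear_combination m2

/-! ### Verification of the admitted fields. -/

theorem prolong_congr {X Y : Phase → Phase} (h : EqOn X Y region) {j : Jet} (hj : j.1 ∈ region) :
    prolong X j = prolong Y j := by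
  have h1 : fderiv ℝ X j.1 = fderiv ℝ Y j.1 :=
    (Filter.eventuallyEq_of_mem (isOpen_region.mem_nhds hj) h).fderiv_eq
  simp only [prolong, totalT, totalS, h1, h hj]

theorem Admitted.congr {γ : ℝ} {σ : ℝ → ℝ → ℝ} {X Y : Phase → Phase} (hX : Admitted γ σ X)
    (h : EqOn Y X region) : Admitted γ σ Y :=
  ⟨hX.1.congr h, fun j hj h0 k => by rw [prolong_congr h hj]; exact hX.2 j hj h0 k⟩

theorem contDiffOn_of_components {X : Phase → Phase} (hT : Smooth (cT X)) (hS : Smooth (cS X))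
    (hY : ∀ i, Smooth (cY X i)) : ContDiffOn ℝ ∞ X region :=
  hT.prodMk (hS.prodMk (contDiffOn_pi.2 hY))

theorem admitted_Y1 (γ : ℝ) {σ : ℝ → ℝ → ℝ} : Admitted γ σ Y1 := by
  refine ⟨contDiffOn_const, fun j hj _ k => ?_⟩
  have h : prolong Y1 j = ((1, 0, 0), 0, 0) := by
    have hf : fderiv ℝ Y1 j.1 = 0 := hasFDerivAt_const _ _ |>.fderiv
    refine Prod.ext rfl (Prod.ext ?_ ?_) <;> funext i <;>
      simp [prolong, totalT, totalS, hf]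
  have hres : ∀ c : ℝ, residual γ σ (j + c • (((1, 0, 0), 0, 0) : Jet)) k = residual γ σ j k :=
    fun c => by simp [residual]
  rw [h]
  by_cases hd : DifferentiableAt ℝ (fun j' => residual γ σ j' k) j
  · rw [← hd.lineDeriv_eq_fderiv, lineDeriv]
    simp only [hres]
    exact deriv_const _ _
  -- No smoothness of `σ` is assumed: where the residual is not differentiable, `fderiv` is zero by
  -- convention.
  · simp [fderiv_zero_of_not_differentiableAt hd]

theorem admitted_Y2 (γ : ℝ) {σ : ℝ → ℝ → ℝ} : Admitted γ σ Y2 := by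
  refine ⟨contDiffOn_const, fun j hj _ k => ?_⟩
  have h : prolong Y2 j = ((0, 1, 0), 0, 0) := by
    have hf : fderiv ℝ Y2 j.1 = 0 := hasFDerivAt_const _ _ |>.fderiv
    refine Prod.ext rfl (Prod.ext ?_ ?_) <;> funext i <;>
      simp [prolong, totalT, totalS, hf]
  have hres : ∀ c : ℝ, residual γ σ (j + c • (((0, 1, 0), 0, 0) : Jet)) k = residual γ σ j k :=
    fun c => by simp [residual]
  rw [h]
  by_cases hd : DifferentiableAt ℝ (fun j' => residual γ σ j' k) j
  · rw [← hd.lineDeriv_eq_fderiv, lineDeriv]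
    simp only [hres]
    exact deriv_const _ _
  · simp [fderiv_zero_of_not_differentiableAt hd]

/-- Only `θ_t` occurs in the system, so it suffices that `h(s, r v)` has zero total `t`-derivative
on solutions. Indeed `s` is Lagrangian, and `r_t = u` with `v_t = -u v / r` gives `(r v)_t = 0`. -/
theorem admitted_Yθ (γ : ℝ) {σ : ℝ → ℝ → ℝ} (hσ : SmoothOnQuadrant σ) {h : ℝ → ℝ → ℝ}
    (hh : ContDiff ℝ ∞ (fun q : ℝ × ℝ => h q.1 q.2)) : Admitted γ σ (Yθ h) := by
  have hs : ContDiff ℝ ∞ (cY (Yθ h) .θ) :=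
    hh.comp (f := fun x : Phase => (x.2.1, x.2.2 .r * x.2.2 .v)) (by fun_prop)
  have hY : ∀ i, i ≠ .θ → cY (Yθ h) i = fun _ => 0 := fun i hi => by
    funext x
    cases i <;> first | rfl | exact absurd rfl hi
  have hsm : ContDiffOn ℝ ∞ (Yθ h) region := by
    refine contDiffOn_of_components contDiffOn_const contDiffOn_const fun i => ?_
    by_cases hi : i = .θ
    · exact hi ▸ hs.contDiffOn
    · rw [hY i hi]; exact contDiffOn_const
  refine ⟨hsm, fun j hj h0 k => ?_⟩
  rw [fderiv_residual γ hσ hj, prolong_eq (differentiableAt_of_smooth hsm hj)]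
  have c1 : cT (Yθ h) = fun _ => 0 := rfl
  have c2 : cS (Yθ h) = fun _ => 0 := rfl
  have hθ : fderiv ℝ (cY (Yθ h) .θ) j.1 (1, 0, j.2.1) = 0 := by
    have hq : DifferentiableAt ℝ (fun q : ℝ × ℝ => h q.1 q.2)
        (j.1.2.1, j.1.2.2 .r * j.1.2.2 .v) := hh.differentiable (by simp) _
    rw [← (hs.differentiable (by simp) _).lineDeriv_eq_fderiv, lineDeriv]
    apply HasDerivAt.deriv
    have l : ∀ a d : ℝ, HasDerivAt (fun ε : ℝ => a + ε * d) d 0 := fun a d => by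
      simpa using ((hasDerivAt_id (0 : ℝ)).mul_const d).const_add a
    have hc := (hasDerivAt_const (0 : ℝ) j.1.2.1).prodMk
      ((l (j.1.2.2 .r) (j.2.1 .r)).mul (l (j.1.2.2 .v) (j.2.1 .v)))
    have := HasFDerivAt.comp_hasDerivAt (f := fun ε : ℝ => (j.1.2.1,
      (j.1.2.2 .r + ε * j.2.1 .r) * (j.1.2.2 .v + ε * j.2.1 .v)))
      (l := fun q : ℝ × ℝ => h q.1 q.2) (0 : ℝ) (by simpa using hq.hasFDerivAt) hc
    have h2 := h0 2
    have h3 := h0 3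
    simp only [residual, Matrix.cons_val] at h2 h3
    have hr := (region_r_pos hj).ne'
    have z : j.2.1 .r * j.1.2.2 .v + j.1.2.2 .r * j.2.1 .v = 0 := by
      field_simp at h3
      linear_combination h3 + j.1.2.2 .v * h2
    refine (this.congr_deriv (?_ : _ = (0 : ℝ))).congr_of_eventuallyEq
      (Filter.Eventually.of_forall fun ε => ?_)
    · simp only [zero_mul, add_zero, z]
      exact map_zero _
    · simp [cY, Yθ]
  rw [c1, c2]
  have f0 : ∀ i, i ≠ .θ → fderiv ℝ (cY (Yθ h) i) j.1 = 0 := fun i hi => by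
    rw [hY i hi]; simp
  fin_cases k <;> simp [linearized, f0, hθ, Yθ]

/-- The weights of the dependent variables under a scaling. -/
def weight (a : ℝ × ℝ × ℝ) : Dep → ℝ
  | .r => a.2.1
  | .θ => 0
  | .u => a.2.1 - a.1
  | .v => a.2.1 - a.1
  | .ρ => wρ a
  | .p => wp a
  | .Eθ => a.2.2 - a.1
  | .Ez => a.2.2 - a.1
  | .Hθ => a.2.2 - a.2.1
  | .Hz => a.2.2 - a.2.1

theorem scalingField_apply (a : ℝ × ℝ × ℝ) (x : Phase) : scalingField a x =
    (a.1 * x.1, (2 * a.1 - 2 * a.2.1 + 2 * a.2.2) * x.2.1, fun i => weight a i * x.2.2 i) := by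
  refine Prod.ext ?_ (Prod.ext ?_ (funext fun i => ?_))
  · simp [scalingField, Y3, Y4, Y5]
  · simp [scalingField, Y3, Y4, Y5]; ring
  · cases i <;> simp [scalingField, Y3, Y4, Y5, weight, wρ, wp] <;> ring

theorem contDiff_scalingField (a : ℝ × ℝ × ℝ) : ContDiff ℝ ∞ (scalingField a) := by
  rw [funext (scalingField_apply a)]
  fun_prop

theorem prolong_scalingField (a : ℝ × ℝ × ℝ) (j : Jet) : prolong (scalingField a) j =
    (scalingField a j.1, fun i => (weight a i - a.1) * j.2.1 i,
      fun i => (weight a i - (2 * a.1 - 2 * a.2.1 + 2 * a.2.2)) * j.2.2 i) := by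
  have hd : DifferentiableAt ℝ (scalingField a) j.1 :=
    (contDiff_scalingField a).differentiable (by simp) _
  have l : ∀ e : Phase, fderiv ℝ (scalingField a) j.1 e = scalingField a e := fun e => by
    rw [← hd.lineDeriv_eq_fderiv, lineDeriv]
    apply HasDerivAt.deriv
    have l : ∀ c y d : ℝ, HasDerivAt (fun ε : ℝ => c * (y + ε * d)) (c * d) 0 := fun c y d => by
      simpa using (((hasDerivAt_id (0 : ℝ)).mul_const d).const_add y).const_mul c
    simp only [scalingField_apply]
    exact (l _ _ _).prodMk ((l _ _ _).prodMk (hasDerivAt_pi.2 fun i => l _ _ _))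
  refine Prod.ext rfl (Prod.ext ?_ ?_) <;> funext i <;>
    simp [prolong, totalT, totalS, l, scalingField_apply] <;> ring

/-- Every equation is homogeneous under the scaling, so its linearization is its weight times its
residual. Only the energy equation and the two Ohm laws contain `σ`, and only there is the
invariance `hi` needed. -/
theorem Invariant.admitted {γ : ℝ} {σ : ℝ → ℝ → ℝ} (hσ : SmoothOnQuadrant σ) {a : ℝ × ℝ × ℝ}
    (ha : Invariant σ a) : Admitted γ σ (scalingField a) := by
  refine ⟨(contDiff_scalingField a).contDiffOn, fun j hj h0 k => ?_⟩
  rw [fderiv_residual γ hσ hj, prolong_scalingField]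
  have hr := (region_r_pos hj).ne'
  have hi := ha _ _ (region_ρ_pos hj) (region_p_pos hj)
  have hk := h0 k
  have hw := mul_inv_cancel₀ hr
  fin_cases k <;> simp only [residual, linearized, Fin.reduceFinMk, Fin.isValue, Fin.zero_eta,
    Fin.mk_one, Matrix.cons_val, scalingField_apply, weight, div_eq_mul_inv] at hk ⊢ <;>
    simp only [wρ, wp, wσ] at hi ⊢
  · linear_combination (a.1 - 4 * a.2.1 + 2 * a.2.2) * hk
  -- The factor `1 / (2 r)` of the magnetic pressure is cancelled first, to match the polynomial
  -- form of `linearized`.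
  · have hk' : j.2.1 .u - j.1.2.2 .v ^ 2 * (j.1.2.2 .r)⁻¹ + j.1.2.2 .r * j.2.2 .p + j.1.2.2 .Hθ
        * (j.2.2 .r * j.1.2.2 .Hθ + j.1.2.2 .r * j.2.2 .Hθ)
        + j.1.2.2 .r * j.1.2.2 .Hz * j.2.2 .Hz = 0 := by
      rw [← hk]; field_simp; ring
    linear_combination (a.2.1 - 2 * a.1) * hk' + j.1.2.2 .v ^ 2 * a.2.1 * (j.1.2.2 .r)⁻¹ * hw
  · linear_combination (a.2.1 - a.1) * hk
  · linear_combination (a.2.1 - 2 * a.1) * hk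
      - j.1.2.2 .u * j.1.2.2 .v * a.2.1 * (j.1.2.2 .r)⁻¹ * hw
  · linear_combination -a.1 * hk + j.1.2.2 .v * a.2.1 * (j.1.2.2 .r)⁻¹ * hw
  · linear_combination (2 * a.2.2 - 2 * a.2.1 - a.1) * hk
      - (γ - 1) * (j.1.2.2 .Eθ ^ 2 + j.1.2.2 .Ez ^ 2) * hi
  · linear_combination (a.2.2 - a.2.1 - a.1) * hk
  · linear_combination (a.2.2 - a.2.1 - a.1) * hk
  · linear_combination (a.2.2 - 2 * a.2.1) * hk + j.1.2.2 .Eθ * hi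
  · linear_combination (a.2.2 - 2 * a.2.1) * hk + j.1.2.2 .Ez * hi

/-- The linearized Ohm law for `E^θ` is evaluated where all free derivatives vanish and all
dependent variables except `ρ` and `p` equal 1; it is then the relation for `σ`. -/
theorem Admitted.invariant {γ : ℝ} {σ : ℝ → ℝ → ℝ} (hσ : SmoothOnQuadrant σ) {a : ℝ × ℝ × ℝ}
    (h : Admitted γ σ (scalingField a)) : Invariant σ a := by
  intro ρ p hρ hp
  let x : Phase := (0, 0, fun i => if i = .ρ then ρ else if i = .p then p else 1)
  have hx : x ∈ region := by simp [x, region, hρ, hp]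
  have e := h.linearized_eq_zero hσ hx 0 0 0 0 0 0 0 0 0 0 8
  rw [prolong_scalingField] at e
  simp only [linearized, Matrix.cons_val, scalingField_apply, weight, solutionJet, x, reduceCtorEq,
    if_true, if_false] at e
  have hw := mul_inv_cancel₀ hρ.ne'
  simp only [wρ, wp, wσ] at e ⊢
  linear_combination e + (a.2.2 - 2 * a.2.1) * σ ρ p * hw

/-! ### Relative invariants of the scaling groups. -/

/-- A relative invariant is multiplied by a power of the parameter along the orbits of the
scaling group. -/
theorem invariant_iff {σ : ℝ → ℝ → ℝ} (hσ : SmoothOnQuadrant σ) {a : ℝ × ℝ × ℝ} :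
    Invariant σ a ↔ ∀ l ρ p : ℝ, 0 < ρ → 0 < p →
      σ (Real.exp (l * wρ a) * ρ) (Real.exp (l * wp a) * p) = Real.exp (l * wσ a) * σ ρ p := by
  have he : ∀ c l : ℝ, HasDerivAt (fun l : ℝ => Real.exp (l * c)) (Real.exp (l * c) * c) l :=
    fun c l => by simpa using ((hasDerivAt_id l).mul_const c).exp
  have hd : ∀ ρ p : ℝ, 0 < ρ → 0 < p → ∀ l : ℝ, HasDerivAt
      (fun l => σ (Real.exp (l * wρ a) * ρ) (Real.exp (l * wp a) * p)) _ l :=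
    fun ρ p hρ hp l => hσ.hasDerivAt_comp ((he (wρ a) l).mul_const ρ) ((he (wp a) l).mul_const p)
      (by positivity) (by positivity)
  refine ⟨fun h l ρ p hρ hp => ?_, fun h ρ p hρ hp => ?_⟩
  -- The invariance equation at the moving point says that `σ`, corrected by its weight, is constant
  -- along the orbit. The converse is the derivative at `l = 0`.
  · have hc : ∀ l : ℝ, HasDerivAt (fun l => Real.exp (l * -wσ a) *
        σ (Real.exp (l * wρ a) * ρ) (Real.exp (l * wp a) * p)) 0 l := fun l => by
      refine ((he (-wσ a) l).mul (hd ρ p hρ hp l)).congr_deriv ?_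
      have := h (Real.exp (l * wρ a) * ρ) (Real.exp (l * wp a) * p) (by positivity) (by positivity)
      linear_combination Real.exp (l * -wσ a) * this
    have e := is_const_of_deriv_eq_zero (fun l => (hc l).differentiableAt)
      (fun l => (hc l).deriv) l 0
    simp only [zero_mul, Real.exp_zero, one_mul] at e
    rw [← e, ← mul_assoc, ← Real.exp_add]
    simp
  · have h1 := hd ρ p hρ hp 0
    have h2 := (he (wσ a) 0).mul_const (σ ρ p)
    rw [← funext fun l => h l ρ p hρ hp] at h2
    have := h1.unique h2
    simp only [zero_mul, Real.exp_zero, one_mul] at this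
    linear_combination this

theorem exp_mul_rpow (x m : ℝ) {ρ : ℝ} (hρ : 0 < ρ) :
    (Real.exp x * ρ) ^ m = Real.exp (x * m) * ρ ^ m := by
  rw [Real.mul_rpow (Real.exp_pos _).le hρ.le, Real.exp_mul]

theorem exp_mul_log_div {w ρ : ℝ} (c : ℝ) (hρ : 0 < ρ) :
    Real.exp (Real.log ρ / w * c) = ρ ^ (c / w) := by
  rw [Real.rpow_def_of_pos hρ]
  congr 1
  ring

/-- The hypothesis `hk` makes `p ρ^k` an absolute invariant, and `hm` gives `ρ^m` the weight of `σ`.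
No regularity of `F` is used. -/
theorem invariant_of_eq_rpow_mul {σ : ℝ → ℝ → ℝ} (hσ : SmoothOnQuadrant σ) {a : ℝ × ℝ × ℝ}
    {m k : ℝ} {F : ℝ → ℝ}
    (h : ∀ ρ p : ℝ, 0 < ρ → 0 < p → σ ρ p = ρ ^ m * F (p * ρ ^ k))
    (hm : wσ a = m * wρ a) (hk : wp a = -(k * wρ a)) : Invariant σ a := by
  refine (invariant_iff hσ).2 fun l ρ p hρ hp => ?_
  have e : Real.exp (l * wp a) * p * (Real.exp (l * wρ a * k) * ρ ^ k) = p * ρ ^ k := by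
    rw [show l * wp a = -(l * wρ a * k) by rw [hk]; ring, Real.exp_neg]
    field_simp
  rw [h _ _ (by positivity) (by positivity), h _ _ hρ hp, exp_mul_rpow _ _ hρ,
    exp_mul_rpow _ _ hρ, e, hm]
  ring_nf

theorem invariant_of_eq_mul_rpow {σ : ℝ → ℝ → ℝ} (hσ : SmoothOnQuadrant σ) {a : ℝ × ℝ × ℝ}
    {n : ℝ} {F : ℝ → ℝ} (h : ∀ ρ p : ℝ, 0 < ρ → 0 < p → σ ρ p = F ρ * p ^ n)
    (hρ0 : wρ a = 0) (hn : wσ a = n * wp a) : Invariant σ a := by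
  refine (invariant_iff hσ).2 fun l ρ p hρ hp => ?_
  rw [h _ _ (by positivity) (by positivity), h _ _ hρ hp, exp_mul_rpow _ _ hp, hn, hρ0]
  simp only [mul_zero, Real.exp_zero, one_mul]
  ring_nf

theorem invariant_of_eq_monomial {σ : ℝ → ℝ → ℝ} (hσ : SmoothOnQuadrant σ) {a : ℝ × ℝ × ℝ}
    {C m n : ℝ} (h : ∀ ρ p : ℝ, 0 < ρ → 0 < p → σ ρ p = C * ρ ^ m * p ^ n)
    (hw : wσ a = m * wρ a + n * wp a) : Invariant σ a := by
  refine (invariant_iff hσ).2 fun l ρ p hρ hp => ?_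
  rw [h _ _ (by positivity) (by positivity), h _ _ hρ hp, exp_mul_rpow _ _ hp,
    exp_mul_rpow _ _ hρ, hw, mul_add, Real.exp_add]
  ring_nf

theorem SmoothOnQuadrant.contDiffOn_right {σ : ℝ → ℝ → ℝ} (hσ : SmoothOnQuadrant σ) :
    ContDiffOn ℝ ∞ (fun w => σ 1 w) (Ioi 0) :=
  ContDiffOn.comp (g := fun q : ℝ × ℝ => σ q.1 q.2) (f := fun w : ℝ => ((1 : ℝ), w)) hσ
    (contDiff_const.prodMk contDiff_id).contDiffOn fun w hw => by
      simpa [quadrant] using hw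

theorem SmoothOnQuadrant.contDiffOn_left {σ : ℝ → ℝ → ℝ} (hσ : SmoothOnQuadrant σ) :
    ContDiffOn ℝ ∞ (fun w => σ w 1) (Ioi 0) :=
  ContDiffOn.comp (g := fun q : ℝ × ℝ => σ q.1 q.2) (f := fun w : ℝ => (w, (1 : ℝ))) hσ
    (contDiff_id.prodMk contDiff_const).contDiffOn fun w hw => by
      simpa [quadrant] using hw

theorem Invariant.eq_rpow_mul {σ : ℝ → ℝ → ℝ} (hσ : SmoothOnQuadrant σ) {a : ℝ × ℝ × ℝ}
    (ha : Invariant σ a) {m k : ℝ} (h0 : wρ a ≠ 0) (hm : wσ a = m * wρ a)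
    (hk : wp a = -(k * wρ a)) {ρ p : ℝ} (hρ : 0 < ρ) (hp : 0 < p) :
    σ ρ p = ρ ^ m * σ 1 (p * ρ ^ k) := by
  -- The parameter is chosen so that the orbit starting on the line `ρ = 1`, at `(1, p ρ^k)`,
  -- reaches `(ρ, p)`.
  have e := (invariant_iff hσ).1 ha (Real.log ρ / wρ a) 1 (p * ρ ^ k) one_pos (by positivity)
  rw [exp_mul_log_div _ hρ, exp_mul_log_div _ hρ, exp_mul_log_div _ hρ, div_self h0,
    show wp a / wρ a = -k by rw [hk]; field_simp, show wσ a / wρ a = m by rw [hm]; field_simp,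
    Real.rpow_one, mul_one, Real.rpow_neg hρ.le] at e
  rw [← e]
  congr 1
  field_simp

/-- The degenerate case: the orbits are the lines of constant `ρ`, and `p = 1` is the transversal.
-/
theorem Invariant.eq_mul_rpow {σ : ℝ → ℝ → ℝ} (hσ : SmoothOnQuadrant σ) {a : ℝ × ℝ × ℝ}
    (ha : Invariant σ a) {n : ℝ} (h0 : wρ a = 0) (h1 : wp a ≠ 0) (hn : wσ a = n * wp a)
    {ρ p : ℝ} (hρ : 0 < ρ) (hp : 0 < p) : σ ρ p = σ ρ 1 * p ^ n := by
  have e := (invariant_iff hσ).1 ha (Real.log p / wp a) ρ 1 hρ one_pos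
  rw [h0, mul_zero, Real.exp_zero, one_mul, exp_mul_log_div _ hp, exp_mul_log_div _ hp,
    div_self h1, show wσ a / wp a = n by rw [hn]; field_simp, Real.rpow_one, mul_one] at e
  rw [e, mul_comm]

/-- The field `Y3 + Y4 + Y5` has `wρ = wp = 0` but `wσ = -1`, so the equation reads `0 = -σ`. -/
theorem Invariant.eq_zero {σ : ℝ → ℝ → ℝ} (h : Invariant σ (1, 1, 1)) {ρ p : ℝ} (hρ : 0 < ρ)
    (hp : 0 < p) : σ ρ p = 0 := by
  have := h ρ p hρ hp
  simp only [wρ, wp, wσ] at this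
  linarith

theorem IsConductivity.not_invariant {σ : ℝ → ℝ → ℝ} (hσ : IsConductivity σ) :
    ¬ Invariant σ (1, 1, 1) := fun h => by
  obtain ⟨q, hq, h0⟩ := hσ.2 quadrant isOpen_quadrant Subset.rfl ⟨(1, 1), by simp [quadrant]⟩
  exact h0 (h.eq_zero hq.1 hq.2)

theorem isConductivity_of_pos {σ : ℝ → ℝ → ℝ} (hs : SmoothOnQuadrant σ)
    (h : ∀ ρ p : ℝ, 0 < ρ → 0 < p → 0 < σ ρ p) : IsConductivity σ :=
  ⟨hs, fun _ _ hU ⟨q, hq⟩ => ⟨q, hq, ne_of_gt (h _ _ (hU hq).1 (hU hq).2)⟩⟩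

/-! ### The kernel, and the extension as a subspace of `ℝ³`. -/

/-- The parameters of the scalings admitted for `σ`. -/
def scalings (σ : ℝ → ℝ → ℝ) : Submodule ℝ (ℝ × ℝ × ℝ) where
  carrier := {a | Invariant σ a}
  zero_mem' := fun ρ p _ _ => by simp [wρ, wp, wσ]
  add_mem' := fun {a b} ha hb ρ p hρ hp => by
    have h1 := ha ρ p hρ hp
    have h2 := hb ρ p hρ hp
    simp only [wρ, wp, wσ, Prod.fst_add, Prod.snd_add] at h1 h2 ⊢
    linear_combination h1 + h2
  smul_mem' := fun c a ha ρ p hρ hp => by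
    have h1 := ha ρ p hρ hp
    simp only [wρ, wp, wσ, Prod.smul_fst, Prod.smul_snd, smul_eq_mul] at h1 ⊢
    linear_combination c * h1

theorem mem_scalings {σ : ℝ → ℝ → ℝ} {a : ℝ × ℝ × ℝ} : a ∈ scalings σ ↔ Invariant σ a := Iff.rfl

/-- The subspace of `ℝ³` is proper, since it misses `(1, 1, 1)`. -/
theorem finrank_scalings_le {σ : ℝ → ℝ → ℝ} (hσ : IsConductivity σ) :
    Module.finrank ℝ (scalings σ) ≤ 2 := by
  have h : scalings σ ≠ ⊤ := fun h => hσ.not_invariant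
    (mem_scalings.1 (h ▸ Submodule.mem_top))
  have := Submodule.finrank_lt h
  simp at this
  omega

/-- A conductivity without scalings. -/
def expConductivity (ρ p : ℝ) : ℝ := Real.exp (ρ + p)

theorem isConductivity_expConductivity : IsConductivity expConductivity :=
  isConductivity_of_pos (contDiff_fst.add contDiff_snd).exp.contDiffOn fun _ _ _ _ =>
    Real.exp_pos _

theorem Invariant.eq_zero_of_expConductivity {a : ℝ × ℝ × ℝ} (h : Invariant expConductivity a) :
    a = 0 := by
  have h := (invariant_iff isConductivity_expConductivity.1).1 h 1
  simp only [expConductivity, ← Real.exp_add, Real.exp_eq_exp, one_mul] at h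
  have h1 := h 1 1 one_pos one_pos
  have h2 := h 2 1 two_pos one_pos
  have h3 := h 1 2 one_pos two_pos
  have e1 : wρ a = 0 := Real.exp_eq_one_iff _ |>.1 (by linarith)
  have e2 : wp a = 0 := Real.exp_eq_one_iff _ |>.1 (by linarith)
  have e3 : wσ a = 0 := by
    rw [e1, e2, Real.exp_zero] at h1
    linarith
  simp only [wρ, wp, wσ] at e1 e2 e3
  refine Prod.ext ?_ (Prod.ext ?_ ?_) <;> simp only [Prod.fst_zero, Prod.snd_zero] <;> linarith

theorem mem_kernel_iff {γ : ℝ} (hγ : 1 < γ) {X : Phase → Phase} : X ∈ kernel γ ↔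
    ∃ (a₁ a₂ : ℝ) (h : ℝ → ℝ → ℝ), ContDiff ℝ ∞ (fun q : ℝ × ℝ => h q.1 q.2) ∧
      EqOn X (a₁ • Y1 + a₂ • Y2 + Yθ h) region := by
  constructor
  · intro hX
    -- One conductivity suffices: for `expConductivity` the scaling part of the normal form is zero.
    have hX' : Admitted γ expConductivity X :=
      (Submodule.mem_iInf _).1 ((Submodule.mem_iInf _).1 hX _) isConductivity_expConductivity
    obtain ⟨a₁, a₂, h, a, hh, ha, e⟩ := hX'.normal_form hγ isConductivity_expConductivity
    rw [ha.eq_zero_of_expConductivity, map_zero, add_zero] at e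
    exact ⟨a₁, a₂, h, hh, e⟩
  · rintro ⟨a₁, a₂, h, hh, e⟩
    refine (Submodule.mem_iInf _).2 fun σ => (Submodule.mem_iInf _).2 fun hσ => ?_
    have hm : a₁ • Y1 + a₂ • Y2 + Yθ h ∈ symmetries γ σ :=
      add_mem (add_mem (Submodule.smul_mem _ _ (admitted_Y1 γ))
        (Submodule.smul_mem _ _ (admitted_Y2 γ))) (admitted_Yθ γ hσ.1 hh)
    exact Admitted.congr hm e

theorem kernel_le (γ : ℝ) {σ : ℝ → ℝ → ℝ} (hσ : IsConductivity σ) :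
    kernel γ ≤ symmetries γ σ := iInf₂_le σ hσ

theorem scalingField_mem_symmetries (γ : ℝ) {σ : ℝ → ℝ → ℝ} (hσ : SmoothOnQuadrant σ)
    {a : ℝ × ℝ × ℝ} : scalingField a ∈ symmetries γ σ ↔ a ∈ scalings σ :=
  ⟨fun h => Admitted.invariant hσ h, fun h => Invariant.admitted hσ h⟩

theorem eq_zero_of_scalingField_mem_kernel {γ : ℝ} {a : ℝ × ℝ × ℝ}
    (h : scalingField a ∈ kernel γ) : a = 0 :=
  ((scalingField_mem_symmetries γ isConductivity_expConductivity.1).1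
    (kernel_le γ isConductivity_expConductivity h)).eq_zero_of_expConductivity

/-- The normal form holds on `region` only, but membership in the kernel is insensitive to values
elsewhere. So the decomposition becomes an equality of functions on the whole space. -/
theorem exists_sub_mem_kernel {γ : ℝ} (hγ : 1 < γ) {σ : ℝ → ℝ → ℝ} (hσ : IsConductivity σ)
    {X : Phase → Phase} (hX : X ∈ symmetries γ σ) :
    ∃ a ∈ scalings σ, X - scalingField a ∈ kernel γ := by
  obtain ⟨a₁, a₂, h, a, hh, ha, e⟩ := Admitted.normal_form hγ hσ hX
  refine ⟨a, ha, (mem_kernel_iff hγ).2 ⟨a₁, a₂, h, hh, fun x hx => ?_⟩⟩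
  rw [Pi.sub_apply, e hx, Pi.add_apply, add_sub_cancel_right]

theorem symmetries_eq {γ : ℝ} (hγ : 1 < γ) {σ : ℝ → ℝ → ℝ} (hσ : IsConductivity σ) :
    symmetries γ σ = kernel γ ⊔ (scalings σ).map scalingField := by
  refine le_antisymm (fun X hX => ?_) (sup_le (kernel_le γ hσ) ?_)
  · obtain ⟨a, ha, hK⟩ := exists_sub_mem_kernel hγ hσ hX
    exact Submodule.mem_sup.2 ⟨_, hK, _, Submodule.mem_map_of_mem ha, sub_add_cancel _ _⟩
  · rintro _ ⟨a, ha, rfl⟩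
    exact (scalingField_mem_symmetries γ hσ.1).2 ha

/-- The classes of the scalings modulo the kernel. -/
def scalingClass (γ : ℝ) {σ : ℝ → ℝ → ℝ} (hσ : SmoothOnQuadrant σ) : scalings σ →ₗ[ℝ]
    symmetries γ σ ⧸ (kernel γ).submoduleOf (symmetries γ σ) :=
  ((kernel γ).submoduleOf (symmetries γ σ)).mkQ ∘ₗ
    (scalingField ∘ₗ (scalings σ).subtype).codRestrict (symmetries γ σ) fun a =>
      (scalingField_mem_symmetries γ hσ).2 a.2

theorem scalingClass_bijective {γ : ℝ} (hγ : 1 < γ) {σ : ℝ → ℝ → ℝ} (hσ : IsConductivity σ) :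
    Function.Bijective (scalingClass γ hσ.1) := by
  constructor
  · refine (injective_iff_map_eq_zero _).2 fun a ha => Subtype.ext ?_
    exact eq_zero_of_scalingField_mem_kernel (show scalingField a ∈ kernel γ from
      (Submodule.Quotient.mk_eq_zero ((kernel γ).submoduleOf (symmetries γ σ))).1 ha)
  · intro q
    obtain ⟨⟨X, hX⟩, rfl⟩ := Submodule.Quotient.mk_surjective _ q
    obtain ⟨a, ha, hK⟩ := exists_sub_mem_kernel hγ hσ hX
    refine ⟨⟨a, ha⟩, ((Submodule.Quotient.eq _).2 ?_)⟩
    have := neg_mem hK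
    rw [neg_sub] at this
    exact this

theorem extensionRank_eq {γ : ℝ} (hγ : 1 < γ) {σ : ℝ → ℝ → ℝ} (hσ : IsConductivity σ) :
    extensionRank γ σ = Module.finrank ℝ (scalings σ) := by
  rw [Module.finrank_eq_rank]
  exact (LinearEquiv.ofBijective _ (scalingClass_bijective hγ hσ)).rank_eq.symm

theorem Y3_eq : Y3 = scalingField (1, 0, 0) := by simp [scalingField]

theorem Y4_eq : Y4 = scalingField (0, 1, 0) := by simp [scalingField]

theorem Y5_eq : Y5 = scalingField (0, 0, 1) := by simp [scalingField]

/-! ### The rows of the classification. -/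

/-- The exponents of a regular row are `wσ / wρ` and `-wp / wρ` of its field; those of a singular
row, where `wρ = 0`, reduce to `wσ / wp`. -/
theorem Row4.exists_scaling {σ : ℝ → ℝ → ℝ} (hσ : SmoothOnQuadrant σ) {X : Phase → Phase}
    (h : Row4 σ X) : ∃ a ∈ scalings σ, a ≠ 0 ∧ X = scalingField a := by
  cases h with
  | y3 F hF h =>
    refine ⟨(1, 0, 0), invariant_of_eq_rpow_mul (m := 1 / 2) (k := 0) (F := F) hσ
      (fun ρ p hρ hp => ?_) ?_ ?_, by simp, Y3_eq⟩
    · rw [h ρ p hρ hp, Real.sqrt_eq_rpow, Real.rpow_zero, mul_one]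
    · norm_num [wσ, wρ]
    · norm_num [wp, wρ]
  | y4 α hα F hF h =>
    have hα := sub_ne_zero.2 hα
    refine ⟨(α, 1, 0), invariant_of_eq_rpow_mul (m := 1 / 2) (k := 1 / (α - 2)) (F := F) hσ
      (fun ρ p hρ hp => ?_) ?_ ?_, by simp, ?_⟩
    · rw [h ρ p hρ hp, Real.sqrt_eq_rpow]
    · simp only [wσ, wρ]; ring
    · simp only [wp, wρ]; field_simp; ring
    · simp only [scalingField, LinearMap.coe_mk, AddHom.coe_mk]; module
  | y4_singular F hF h =>
    refine ⟨(2, 1, 0), invariant_of_eq_mul_rpow (n := 0) (F := F) hσ (fun ρ p hρ hp => ?_) ?_ ?_,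
      by simp, ?_⟩
    · rw [h ρ p hρ hp, Real.rpow_zero, mul_one]
    · norm_num [wρ]
    · norm_num [wσ]
    · simp only [scalingField, LinearMap.coe_mk, AddHom.coe_mk]; module
  | y5 α β hαβ F hF h =>
    refine ⟨(β, α, 1), invariant_of_eq_rpow_mul hσ h ?_ ?_, by simp, ?_⟩
    · simp only [wσ, wρ]; field_simp; ring
    · simp only [wp, wρ]; field_simp; ring
    · simp only [scalingField, LinearMap.coe_mk, AddHom.coe_mk]; module
  | y5_singular α hα F hF h =>
    have hα := sub_ne_zero.2 hα
    refine ⟨(2 * α - 1, α, 1), invariant_of_eq_mul_rpow hσ h ?_ ?_, by simp, ?_⟩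
    · simp only [wρ]; ring
    · simp only [wσ, wp]; field_simp; ring
    · simp only [scalingField, LinearMap.coe_mk, AddHom.coe_mk]; module

/-- The last nonzero coordinate of `a` is normalized to 1, and `wρ = 0` separates the singular rows.
The profile `F` is `σ` restricted to `ρ = 1`, or to `p = 1` in the singular rows. -/
theorem exists_row4 {σ : ℝ → ℝ → ℝ} (hσ : IsConductivity σ) {a : ℝ × ℝ × ℝ}
    (ha : a ∈ scalings σ) (h0 : a ≠ 0) : ∃ X, Row4 σ X := by
  obtain ⟨a₃, a₄, a₅⟩ := a
  have hr := hσ.1.contDiffOn_right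
  have hl := hσ.1.contDiffOn_left
  by_cases h5 : a₅ = 0
  · subst h5
    by_cases h4 : a₄ = 0
    · subst h4
      have h3 : a₃ ≠ 0 := fun h => h0 (by simp [h])
      refine ⟨_, .y3 _ hr fun ρ p hρ hp => ?_⟩
      have := Invariant.eq_rpow_mul hσ.1 ha (m := 1 / 2) (k := 0) (by simpa [wρ] using h3)
        (by simp only [wσ, wρ]; ring) (by simp [wp]) hρ hp
      rwa [Real.rpow_zero, mul_one, ← Real.sqrt_eq_rpow] at this
    · have hb : Invariant σ (a₃ / a₄, 1, 0) := by
        have := (scalings σ).smul_mem a₄⁻¹ ha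
        rwa [Prod.smul_mk, Prod.smul_mk, smul_eq_mul, smul_eq_mul, inv_mul_cancel₀ h4, smul_zero,
          inv_mul_eq_div] at this
      by_cases hα : a₃ / a₄ = 2
      · rw [hα] at hb
        refine ⟨_, .y4_singular _ hl fun ρ p hρ hp => ?_⟩
        have := hb.eq_mul_rpow hσ.1 (n := 0) (by norm_num [wρ]) (by norm_num [wp])
          (by norm_num [wσ]) hρ hp
        rwa [Real.rpow_zero, mul_one] at this
      · refine ⟨_, .y4 _ hα _ hr fun ρ p hρ hp => ?_⟩
        have hα' := sub_ne_zero.2 hα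
        generalize a₃ / a₄ = α at *
        rw [Real.sqrt_eq_rpow]
        refine hb.eq_rpow_mul hσ.1 (fun h => hα' ?_) ?_ ?_ hρ hp
        · simp only [wρ] at h; linarith
        · simp only [wσ, wρ]; ring
        · simp only [wp, wρ]; field_simp; ring
  · have hb : Invariant σ (a₃ / a₅, a₄ / a₅, 1) := by
      have := (scalings σ).smul_mem a₅⁻¹ ha
      rwa [Prod.smul_mk, Prod.smul_mk, smul_eq_mul, smul_eq_mul, smul_eq_mul, inv_mul_cancel₀ h5,
        inv_mul_eq_div, inv_mul_eq_div] at this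
    generalize a₃ / a₅ = β at hb
    generalize a₄ / a₅ = α at hb
    by_cases hαβ : 2 * α - β - 1 = 0
    · obtain rfl : β = 2 * α - 1 := by linarith
      -- The excluded value would be the forbidden vector `(1, 1, 1)`.
      have hα : α ≠ 1 := by
        rintro rfl
        norm_num at hb
        exact hσ.not_invariant hb
      refine ⟨_, .y5_singular α hα _ hl fun ρ p hρ hp => ?_⟩
      have hα' := sub_ne_zero.2 hα
      refine hb.eq_mul_rpow hσ.1 ?_ (fun h => hα' ?_) ?_ hρ hp
      · simp only [wρ]; ring
      · simp only [wp] at h; linarith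
      · simp only [wσ, wp]; field_simp; ring
    · refine ⟨_, .y5 α β hαβ _ hr fun ρ p hρ hp => ?_⟩
      refine hb.eq_rpow_mul hσ.1 (fun h => hαβ ?_) ?_ ?_ hρ hp
      · simp only [wρ] at h; linarith
      · simp only [wσ, wρ]; field_simp; ring
      · simp only [wp, wρ]; field_simp; ring

/-- For a monomial the invariance is one linear equation between the weights, so all rows can be
treated together through two independent parameter vectors. -/
theorem Row5.eq_monomial {σ : ℝ → ℝ → ℝ} {X X' : Phase → Phase} (h : Row5 σ X X') :
    ∃ C m n : ℝ, (∀ ρ p : ℝ, 0 < ρ → 0 < p → σ ρ p = C * ρ ^ m * p ^ n) ∧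
      ∃ a b : ℝ × ℝ × ℝ, X = scalingField a ∧ X' = scalingField b ∧
        wσ a = m * wρ a + n * wp a ∧ wσ b = m * wρ b + n * wp b ∧ LinearIndependent ℝ ![a, b] := by
  cases h with
  | y3_y4 C h =>
    refine ⟨C, 1 / 2, 0, fun ρ p hρ hp => ?_, (1, 0, 0), (0, 1, 0), Y3_eq, Y4_eq, ?_, ?_, ?_⟩
    · rw [h ρ p hρ hp, Real.sqrt_eq_rpow, Real.rpow_zero, mul_one]
    · norm_num [wσ, wρ]
    · norm_num [wσ, wρ]
    · simp [LinearIndependent.pair_iff]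
  | y3_y5 α hα C h =>
    have hα := sub_ne_zero.2 hα
    refine ⟨C, 1 / 2, 1 / (2 * (α - 1)), fun ρ p hρ hp => ?_, (1, 0, 0), (0, α, 1), Y3_eq, ?_, ?_, ?_, ?_⟩
    · rw [h ρ p hρ hp, Real.sqrt_eq_rpow]
    · simp only [scalingField, LinearMap.coe_mk, AddHom.coe_mk]; module
    · norm_num [wσ, wρ, wp]
    · simp only [wσ, wρ, wp]; field_simp; ring
    · simp [LinearIndependent.pair_iff]; grind
  | y4_y5 α β hαβ C h =>
    have hαβ := sub_ne_zero.2 hαβ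
    refine ⟨C, _, _, h, (α, 1, 0), (β, 0, 1), ?_, ?_, ?_, ?_, ?_⟩
    · simp only [scalingField, LinearMap.coe_mk, AddHom.coe_mk]; module
    · simp only [scalingField, LinearMap.coe_mk, AddHom.coe_mk]; module
    · simp only [wσ, wρ, wp]; field_simp; ring
    · simp only [wσ, wρ, wp]; field_simp; ring
    · simp [LinearIndependent.pair_iff]

/-- The two independent vectors already exhaust the maximal dimension 2. -/
theorem Row5.scalings_eq {σ : ℝ → ℝ → ℝ} (hσ : IsConductivity σ) {X X' : Phase → Phase}
    (h : Row5 σ X X') : Module.finrank ℝ (scalings σ) = 2 ∧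
      (scalings σ).map scalingField = Submodule.span ℝ {X, X'} := by
  obtain ⟨C, m, n, e, a, b, rfl, rfl, ha, hb, hi⟩ := h.eq_monomial
  have hle : Submodule.span ℝ {a, b} ≤ scalings σ := by
    rw [Submodule.span_le]
    rintro x (rfl | rfl)
    · exact invariant_of_eq_monomial hσ.1 e ha
    · exact invariant_of_eq_monomial hσ.1 e hb
  have h2 : Module.finrank ℝ (Submodule.span ℝ {a, b}) = 2 := by
    have := finrank_span_eq_card hi
    rwa [Matrix.range_cons_cons_empty] at this
  have heq := Submodule.eq_of_le_of_finrank_le hle (h2 ▸ finrank_scalings_le hσ)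
  refine ⟨heq ▸ h2, ?_⟩
  rw [← heq, Submodule.map_span, image_pair]

theorem exists_row5_of_monomial {σ : ℝ → ℝ → ℝ} {C m n : ℝ}
    (h : ∀ ρ p : ℝ, 0 < ρ → 0 < p → σ ρ p = C * ρ ^ m * p ^ n) : ∃ X X', Row5 σ X X' := by
  by_cases hm : m = 1 / 2
  · subst hm
    by_cases hn : n = 0
    · subst hn
      exact ⟨_, _, .y3_y4 C fun ρ p hρ hp => by
        rw [h ρ p hρ hp, Real.sqrt_eq_rpow, Real.rpow_zero, mul_one]⟩
    -- The solution of `n = 1 / (2 (α - 1))`.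
    · refine ⟨_, _, .y3_y5 (1 + 1 / (2 * n)) (by simpa using hn) C fun ρ p hρ hp => ?_⟩
      rw [h ρ p hρ hp, Real.sqrt_eq_rpow]
      congr 2
      field_simp
      ring
  -- Here `k` stands for `α + β - 1`. The exponent of `ρ` determines `k`, and `n = (2 - α) / (2 k)`
  -- then determines `α` and `β`.
  · obtain ⟨k, hk, rfl⟩ : ∃ k, k ≠ 0 ∧ m = (1 - 1 / k) / 2 :=
      ⟨1 / (1 - 2 * m), one_div_ne_zero fun h => hm (by linarith), by rw [one_div_one_div]; ring⟩
    refine ⟨_, _, .y4_y5 (2 - 2 * n * k) (k - 1 + 2 * n * k) (fun h => hk (by linarith)) C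
      fun ρ p hρ hp => ?_⟩
    rw [h ρ p hρ hp, show 2 - 2 * n * k + (k - 1 + 2 * n * k) = 1 + k by ring,
      show (1 - 1 / k) / 2 = (1 + k - 2) / (2 * (1 + k - 1)) by
        rw [add_sub_cancel_left]; field_simp; ring,
      show (2 - (2 - 2 * n * k)) / (2 * (1 + k - 1)) = n by
        rw [add_sub_cancel_left]; field_simp; ring]

/-- The weights `(wρ, wp)` vanish together only on multiples of `(1, 1, 1)`, so they map a
two-dimensional `scalings σ` isomorphically onto `ℝ²`. The preimages of the basis vectors scale `ρ`
and `p` separately, whence `σ` is a monomial. -/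
theorem exists_row5 {σ : ℝ → ℝ → ℝ} (hσ : IsConductivity σ)
    (h : Module.finrank ℝ (scalings σ) = 2) : ∃ X X', Row5 σ X X' := by
  let f : scalings σ →ₗ[ℝ] ℝ × ℝ :=
    { toFun := fun a => (wρ a, wp a)
      map_add' := fun a b => by
        ext <;> simp [wρ, wp] <;> ring
      map_smul' := fun c a => by
        ext <;> simp [wρ, wp] <;> ring }
  have hinj : Function.Injective f := by
    refine (injective_iff_map_eq_zero f).2 fun ⟨a, ha⟩ h0 => Subtype.ext ?_
    have e1 : wρ a = 0 := congrArg Prod.fst h0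
    have e2 : wp a = 0 := congrArg Prod.snd h0
    simp only [wρ, wp] at e1 e2
    have e : a = a.1 • ((1, 1, 1) : ℝ × ℝ × ℝ) := by
      refine Prod.ext ?_ (Prod.ext ?_ ?_) <;> simp <;> linarith
    by_contra hne
    have h1 : a.1 ≠ 0 := fun h1 => hne (by rw [h1, zero_smul] at e; exact e)
    rw [e] at ha
    exact hσ.not_invariant ((Submodule.smul_mem_iff _ h1).1 ha)
  have hsurj : Function.Surjective f :=
    (LinearMap.injective_iff_surjective_of_finrank_eq_finrank (by simp [h])).1 hinj
  obtain ⟨⟨a, ha⟩, ea⟩ := hsurj (1, 0)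
  obtain ⟨⟨b, hb⟩, eb⟩ := hsurj (0, 1)
  have a1 : wρ a = 1 := congrArg Prod.fst ea
  have a2 : wp a = 0 := congrArg Prod.snd ea
  have b1 : wρ b = 0 := congrArg Prod.fst eb
  have b2 : wp b = 1 := congrArg Prod.snd eb
  refine exists_row5_of_monomial (C := σ 1 1) (m := wσ a) (n := wσ b) fun ρ p hρ hp => ?_
  have e1 := Invariant.eq_rpow_mul hσ.1 ha (m := wσ a) (k := 0) (by simp [a1]) (by simp [a1])
    (by simp [a2]) hρ hp
  have e2 := Invariant.eq_mul_rpow hσ.1 hb (n := wσ b) b1 (by simp [b2]) (by simp [b2])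
    one_pos hp
  rw [e1, Real.rpow_zero, mul_one, e2]
  ring

/-! ### Realization of the rows. -/

/-- The values at 1 and 2 give `C = e` and `2^n = e`, so the value at 4 would be `e³` instead of
`e⁴`. -/
theorem exp_ne_monomial {C n : ℝ} (h : ∀ p : ℝ, 0 < p → Real.exp p = C * p ^ n) : False := by
  have h1 := h 1 one_pos
  have h2 := h 2 two_pos
  have h4 := h 4 four_pos
  rw [Real.one_rpow, mul_one] at h1
  rw [← h1] at h2 h4
  have e2 : (2 : ℝ) ^ n = Real.exp 1 := by
    have : Real.exp 2 = Real.exp 1 * Real.exp 1 := by rw [← Real.exp_add]; norm_num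
    exact (mul_left_cancel₀ (Real.exp_pos 1).ne' (this.symm.trans h2)).symm
  have e4 : (4 : ℝ) ^ n = Real.exp 1 * Real.exp 1 := by
    rw [← e2, ← Real.mul_rpow two_pos.le two_pos.le]; norm_num
  rw [e4, ← Real.exp_add, ← Real.exp_add, Real.exp_eq_exp] at h4
  norm_num at h4

theorem finrank_scalings_eq_one {σ : ℝ → ℝ → ℝ} (hσ : IsConductivity σ) {X : Phase → Phase}
    (hX : Row4 σ X) (h : ¬ ∃ X X', Row5 σ X X') : Module.finrank ℝ (scalings σ) = 1 := by
  have h2 := finrank_scalings_le hσ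
  have h3 : Module.finrank ℝ (scalings σ) ≠ 2 := fun e => h (exists_row5 hσ e)
  have h0 : Module.finrank ℝ (scalings σ) ≠ 0 := fun e => by
    obtain ⟨a, ha, h0, -⟩ := hX.exists_scaling hσ.1
    rw [Submodule.finrank_eq_zero.1 e] at ha
    exact h0 ((Submodule.mem_bot ℝ).1 ha)
  omega

theorem smoothOnQuadrant_rpow (m n : ℝ) : SmoothOnQuadrant fun ρ p => ρ ^ m * p ^ n :=
  (contDiffOn_fst.rpow_const_of_ne fun _ hq => ne_of_gt hq.1).mul
    (contDiffOn_snd.rpow_const_of_ne fun _ hq => ne_of_gt hq.2)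

/-- The profile `F = exp` serves every regular row: on `ρ = 1` it is `exp p`, so no row of `Row5`
applies. -/
theorem exists_conductivity_rpow_mul (γ m k : ℝ) (hγ : 1 < γ) : ∃ σ : ℝ → ℝ → ℝ,
    IsConductivity σ ∧ (∀ ρ p : ℝ, 0 < ρ → 0 < p → σ ρ p = ρ ^ m * Real.exp (p * ρ ^ k)) ∧
      ∀ X, Row4 σ X → extensionRank γ σ = 1 := by
  have hσ : IsConductivity fun ρ p => ρ ^ m * Real.exp (p * ρ ^ k) := by
    refine isConductivity_of_pos ?_ fun ρ p hρ hp => by positivity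
    exact (contDiffOn_fst.rpow_const_of_ne fun _ hq => ne_of_gt hq.1).mul
      (contDiffOn_snd.mul (contDiffOn_fst.rpow_const_of_ne fun _ hq => ne_of_gt hq.1)).exp
  refine ⟨_, hσ, fun _ _ _ _ => rfl, fun X hX => ?_⟩
  rw [extensionRank_eq hγ hσ, finrank_scalings_eq_one hσ hX, Nat.cast_one]
  rintro ⟨X₅, X₆, h⟩
  obtain ⟨C, m', n, e, -⟩ := h.eq_monomial
  exact exp_ne_monomial fun p hp => by simpa using e 1 p one_pos hp

theorem exists_conductivity_mul_rpow (γ n : ℝ) (hγ : 1 < γ) : ∃ σ : ℝ → ℝ → ℝ,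
    IsConductivity σ ∧ (∀ ρ p : ℝ, 0 < ρ → 0 < p → σ ρ p = Real.exp ρ * p ^ n) ∧
      ∀ X, Row4 σ X → extensionRank γ σ = 1 := by
  have hσ : IsConductivity fun ρ p => Real.exp ρ * p ^ n := by
    refine isConductivity_of_pos ?_ fun ρ p hρ hp => by positivity
    exact contDiffOn_fst.exp.mul (contDiffOn_snd.rpow_const_of_ne fun _ hq => ne_of_gt hq.2)
  refine ⟨_, hσ, fun _ _ _ _ => rfl, fun X hX => ?_⟩
  rw [extensionRank_eq hγ hσ, finrank_scalings_eq_one hσ hX, Nat.cast_one]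
  rintro ⟨X₅, X₆, h⟩
  obtain ⟨C, m', n, e, -⟩ := h.eq_monomial
  exact exp_ne_monomial fun ρ hρ => by simpa using e ρ 1 hρ one_pos

theorem isConductivity_rpow (m n : ℝ) : IsConductivity fun ρ p => ρ ^ m * p ^ n :=
  isConductivity_of_pos (smoothOnQuadrant_rpow m n) fun ρ p hρ hp => by positivity

end MHD

end

theorem mainTheorem2 (γ : ℝ) (hγ : 1 < γ) :
    -- the kernel: `∂_t`, `∂_s`, `h(s, r v) ∂_θ`
    (∀ X : Phase → Phase, X ∈ kernel γ ↔
      ∃ (a₁ a₂ : ℝ) (h : ℝ → ℝ → ℝ), ContDiff ℝ ∞ (fun q : ℝ × ℝ => h q.1 q.2) ∧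
        EqOn X (a₁ • Y1 + a₂ • Y2 + Yθ h) region) ∧
    -- the classification of the extensions
    (∀ σ : ℝ → ℝ → ℝ, IsConductivity σ →
      -- every admitted generator is expanded in the basis
      (∀ X ∈ symmetries γ σ, ∃ K ∈ kernel γ, ∃ a₃ a₄ a₅ : ℝ,
        X = K + a₃ • Y3 + a₄ • Y4 + a₅ • Y5) ∧
      -- at most two additional generators
      extensionRank γ σ ≤ 2 ∧
      -- no extension outside the rows of the table
      (symmetries γ σ = kernel γ ↔ ¬ ∃ X₄, Row4 σ X₄) ∧
      -- one additional generator
      (extensionRank γ σ = 1 ↔ (∃ X₄, Row4 σ X₄) ∧ ¬ ∃ X₄ X₅, Row5 σ X₄ X₅) ∧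
      (∀ X₄, Row4 σ X₄ → X₄ ∈ symmetries γ σ ∧ X₄ ∉ kernel γ) ∧
      (∀ X₄, Row4 σ X₄ → (¬ ∃ X₅ X₆, Row5 σ X₅ X₆) →
        symmetries γ σ = kernel γ ⊔ Submodule.span ℝ {X₄}) ∧
      -- two additional generators
      (extensionRank γ σ = 2 ↔ ∃ X₄ X₅, Row5 σ X₄ X₅) ∧
      (∀ X₄ X₅, Row5 σ X₄ X₅ →
        symmetries γ σ = kernel γ ⊔ Submodule.span ℝ {X₄, X₅})) ∧
    -- all one-generator rows are realized with exactly one additional generator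
    (∃ σ, IsConductivity σ ∧ Row4 σ Y3 ∧ extensionRank γ σ = 1) ∧
    (∀ α : ℝ, ∃ σ, IsConductivity σ ∧ Row4 σ (Y4 + α • Y3) ∧ extensionRank γ σ = 1) ∧
    (∀ α β : ℝ, ¬ (α = 1 ∧ β = 1) →
      ∃ σ, IsConductivity σ ∧ Row4 σ (Y5 + α • Y4 + β • Y3) ∧ extensionRank γ σ = 1) ∧
    -- all two-generator rows are realized
    (∃ σ, IsConductivity σ ∧ Row5 σ Y3 Y4) ∧
    (∀ α : ℝ, α ≠ 1 → ∃ σ, IsConductivity σ ∧ Row5 σ Y3 (Y5 + α • Y4)) ∧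
    (∀ α β : ℝ, α + β ≠ 1 →
      ∃ σ, IsConductivity σ ∧ Row5 σ (Y4 + α • Y3) (Y5 + β • Y3)) ∧
    -- the full three-parameter extension forces `σ = 0`
    (∀ σ : ℝ → ℝ → ℝ, SmoothOnQuadrant σ →
      Y3 ∈ symmetries γ σ → Y4 ∈ symmetries γ σ → Y5 ∈ symmetries γ σ →
      ∀ ρ p : ℝ, 0 < ρ → 0 < p → σ ρ p = 0) := by
  refine ⟨fun X => mem_kernel_iff hγ, fun σ hσ => ⟨fun X hX => ?_, ?_, ?_, ?_, fun X hX => ?_,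
    fun X hX h5 => ?_, ?_, fun X X' h => ?_⟩, ?_, fun α => ?_, fun α β hαβ => ?_, ?_, fun α hα => ?_,
    fun α β hαβ => ?_, fun σ hσ h3 h4 h5 ρ p hρ hp => ?_⟩
  · obtain ⟨a, -, hK⟩ := exists_sub_mem_kernel hγ hσ hX
    refine ⟨_, hK, a.1, a.2.1, a.2.2, ?_⟩
    simp only [scalingField, LinearMap.coe_mk, AddHom.coe_mk]
    module
  · rw [extensionRank_eq hγ hσ]
    exact_mod_cast finrank_scalings_le hσ
  · refine ⟨fun h ⟨X, hX⟩ => ?_, fun h => le_antisymm (fun X hX => ?_) (kernel_le γ hσ)⟩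
    · obtain ⟨a, ha, h0, -⟩ := hX.exists_scaling hσ.1
      exact h0 (eq_zero_of_scalingField_mem_kernel
        (h ▸ (scalingField_mem_symmetries γ hσ.1).2 ha))
    · obtain ⟨a, ha, hK⟩ := exists_sub_mem_kernel hγ hσ hX
      have h0 : a = 0 := by_contra fun h0 => h (exists_row4 hσ ha h0)
      rwa [h0, map_zero, sub_zero] at hK
  · rw [extensionRank_eq hγ hσ, Nat.cast_eq_one]
    refine ⟨fun h => ⟨?_, fun ⟨X, X', h'⟩ => ?_⟩, fun ⟨⟨X, hX⟩, h⟩ =>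
      finrank_scalings_eq_one hσ hX h⟩
    · have hb : scalings σ ≠ ⊥ := fun hb => by
        rw [Submodule.finrank_eq_zero.2 hb] at h
        exact zero_ne_one h
      obtain ⟨a, ha, h0⟩ := (Submodule.ne_bot_iff _).1 hb
      exact exists_row4 hσ ha h0
    · have := (h'.scalings_eq hσ).1
      omega
  · obtain ⟨a, ha, h0, rfl⟩ := hX.exists_scaling hσ.1
    exact ⟨(scalingField_mem_symmetries γ hσ.1).2 ha,
      fun h => h0 (eq_zero_of_scalingField_mem_kernel h)⟩
  · obtain ⟨a, ha, h0, rfl⟩ := hX.exists_scaling hσ.1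
    have hs : Submodule.span ℝ {a} = scalings σ :=
      Submodule.eq_of_le_of_finrank_eq (by simpa using ha)
        (by rw [finrank_span_singleton h0, finrank_scalings_eq_one hσ hX h5])
    rw [symmetries_eq hγ hσ, ← hs, Submodule.map_span, image_singleton]
  · rw [extensionRank_eq hγ hσ]
    refine ⟨fun h => exists_row5 hσ (by exact_mod_cast h), fun ⟨X, X', h⟩ => ?_⟩
    rw [(h.scalings_eq hσ).1, Nat.cast_ofNat]
  · rw [symmetries_eq hγ hσ, (h.scalings_eq hσ).2]
  · obtain ⟨σ, hσ, e, hr⟩ := exists_conductivity_rpow_mul γ (1 / 2) 0 hγ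
    have hX : Row4 σ Y3 := .y3 Real.exp Real.contDiff_exp.contDiffOn fun ρ p hρ hp => by
      rw [e ρ p hρ hp, Real.rpow_zero, mul_one, Real.sqrt_eq_rpow]
    exact ⟨σ, hσ, hX, hr _ hX⟩
  · by_cases hα : α = 2
    · obtain ⟨σ, hσ, e, hr⟩ := exists_conductivity_mul_rpow γ 0 hγ
      have hX : Row4 σ (Y4 + (2 : ℝ) • Y3) :=
        .y4_singular Real.exp Real.contDiff_exp.contDiffOn fun ρ p hρ hp => by
          rw [e ρ p hρ hp, Real.rpow_zero, mul_one]
      exact ⟨σ, hσ, hα ▸ hX, hr _ hX⟩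
    · obtain ⟨σ, hσ, e, hr⟩ := exists_conductivity_rpow_mul γ (1 / 2) (1 / (α - 2)) hγ
      have hX : Row4 σ (Y4 + α • Y3) :=
        .y4 α hα Real.exp Real.contDiff_exp.contDiffOn fun ρ p hρ hp => by
          rw [e ρ p hρ hp, Real.sqrt_eq_rpow]
      exact ⟨σ, hσ, hX, hr _ hX⟩
  · by_cases h : 2 * α - β - 1 = 0
    · obtain rfl : β = 2 * α - 1 := by linarith
      have hα : α ≠ 1 := fun h => hαβ ⟨h, by rw [h]; norm_num⟩
      obtain ⟨σ, hσ, e, hr⟩ := exists_conductivity_mul_rpow γ (1 / (2 * (α - 1))) hγ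
      have hX := Row4.y5_singular α hα Real.exp Real.contDiff_exp.contDiffOn e
      exact ⟨σ, hσ, hX, hr _ hX⟩
    · obtain ⟨σ, hσ, e, hr⟩ := exists_conductivity_rpow_mul γ _ _ hγ
      have hX := Row4.y5 α β h Real.exp Real.contDiff_exp.contDiffOn e
      exact ⟨σ, hσ, hX, hr _ hX⟩
  · exact ⟨_, isConductivity_rpow (1 / 2) 0, .y3_y4 1 fun ρ p _ _ => by
      rw [Real.rpow_zero, mul_one, one_mul, Real.sqrt_eq_rpow]⟩
  · exact ⟨_, isConductivity_rpow (1 / 2) _, .y3_y5 α hα 1 fun ρ p _ _ => by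
      rw [one_mul, Real.sqrt_eq_rpow]⟩
  · exact ⟨_, isConductivity_rpow _ _, .y4_y5 α β hαβ 1 fun ρ p _ _ => by rw [one_mul]⟩
  -- Only the sum `Y3 + Y4 + Y5` matters, and no nonvanishing of `σ` is assumed.
  · have h : scalingField (1, 1, 1) ∈ symmetries γ σ := by
      have := add_mem (add_mem h3 h4) h5
      rw [Y3_eq, Y4_eq, Y5_eq, ← map_add, ← map_add] at this
      simpa using this
    exact ((scalingField_mem_symmetries γ hσ).1 h).eq_zero hρ hp
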